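/- **Conventions.** An *operadic category* (Batanin–Markl) is a category $\mathcal O$ with a cardinality functor $|\cdot|$ to the category of the sets $\bar n=\{1,\dots,n\}$ and all maps, a chosen terminal object in each connected component (of cardinality $1$), and for every $f:T\to S$ and $i\in|S|$ a fibre $f^{-1}(i)$ with $|f^{-1}(i)|=|f|^{-1}(i)$, functorial in the sense that a morphism $f$ from $h:T\to R$ to $g:S\to R$ over $R$ induces $f_i:h^{-1}(i)\to g^{-1}(i)$, subject to the usual axioms. An *operad* in sets over $\mathcal O$ consists of sets $P(T)$, units in $P(U)$ for the chosen terminal objects $U$, and associative and unital structure maps $\mu_f:\prod_{i\in|S|}P(f^{-1}(i))\times P(S)\to P(T)$ for $f:T\to S$. * For a set $C$, $\mathrm{Bq}(C)$ is the operadic category of bouquets $\binom{c_1\cdots c_n}{c}$, with all maps of inputs between bouquets of the same output colour $c$ as morphisms; the fibre over $i$ consists of the inputs over $i$ and has the colour of $i$ as output colour. A symmetric operad coloured by $C$ is an operad over $\mathrm{Bq}(C)$. An isomorphism between symmetric operads coloured by $C$ and by $C'$ is a bijection $e:C\to C'$ together with an isomorphism from the first to the restriction of the second along $\mathrm{Bq}(e)$.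 * For a symmetric operad $X$ coloured by $C$, $\mathbb I X=\int_{\mathrm{Bq}(C)}X$ is the operadic Grothendieck construction: objects are the elements $t\in X(T)$; a morphism $t\to s$, $s\in X(S)$, is a morphism $f:T\to S$ with elements $\varepsilon_i\in X(f^{-1}(i))$ such that $\mu_f(\varepsilon,s)=t$; its fibres are the $\varepsilon_i$. * For operadic categories $\mathcal A,\mathcal B$, the wreath product $\mathcal A\wr\mathcal B$ has as objects the symbols $(x;y_1,\dots,y_n)$ with $x\in\mathcal A$, $|x|=n$, and $y_1,\dots,y_n\in\mathcal B$ in one connected component $\delta$ of $\mathcal B$; for $n=0$, where the $y_i$ do not determine $\delta$, the component $\delta$ is part of the symbol. A morphism to $(z;w_1,\dots,w_k)$ is a morphism $\varphi:x\to z$ with morphisms $\varphi_{ij}:y_i\to w_j$ for $|\varphi|(i)=j$, between objects with the same component $\delta$. The cardinality of an object is the ordinal sum $\bigoplus_i|y_i|$, and the fibre over $i\in|w_t|$ is $(\varphi^{-1}(t);(\varphi_{st}^{-1}(i))_{s\in|\varphi|^{-1}(t)})$. The chosen local terminal objects are the $(u;v)$ with $u$ and $v$ chosen local terminal. * For an operadic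 category $\mathcal O$, the arity functor $Ar:\mathcal O\to\mathrm{Bq}(\pi_0(\mathcal O))$ sends $T$ to the bouquet with inputs $|T|$, where the colour of $i$ is the component of the $i$-th fibre of $1_T$ and the output colour is the component of $T$. Then $\mathbb A(\mathcal O)=Ar_!(\mathbf 1_{\mathcal O})$, where $\mathbf 1_{\mathcal O}$ is the terminal operad and $Ar_!$ is the left adjoint of the restriction $Ar^*$ of operads. Write $[T]\in\mathbb A(\mathcal O)(Ar(T))$ for the element given by $T$ under the unit of the adjunction. * For symmetric operads $X$ and $Y$ coloured by $C$ and $D$, the Boardman–Vogt tensor product $X\otimes_{BV}Y$ is the symmetric operad coloured by $C\times D$ generated by elements $x\otimes d$ ($x$ in $X$, $d\in D$) and $c\otimes y$ ($c\in C$, $y$ in $Y$), subject to the relations that each $-\otimes d$ and each $c\otimes-$ is a morphism of operads, and to the interchange relation $\mu((c_i\otimes y)_i,\,x\otimes d)=\mu((x\otimes d_j)_j,\,c\otimes y)$ for $x\in X\binom{c_1\cdots c_n}{c}$ and $y\in Y\binom{d_1\cdots d_m}{d}$, where the composites are taken along the two projections of the lexicographically ordered set $\bar n\times\bar m$. **Theorem.**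 Let $X$ be a symmetric operad in $\mathit{Set}$ coloured by a set $C$ and $Y$ one coloured by a set $D$. Then there is an isomorphism of symmetric operads $$\alpha:\;X\otimes_{BV}Y\;\xrightarrow{\ \sim\ }\;\mathbb A(\mathbb I X\wr\mathbb I Y).$$ On colours it sends $(c,d)$ to the connected component of $(u_c;v_d)$, and on generators it is given by $\alpha(x\otimes d)=[(x;v_d,\dots,v_d)]$ and $\alpha(c\otimes y)=[(u_c;y)]$, where $u_c$ and $v_d$ denote the $c$-coloured unit of $X$ and the $d$-coloured unit of $Y$ (for nullary $x$, the symbol $(x;\,)$ is taken with the component of $v_d$). -/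

import Mathlib

open CategoryTheory

universe u v w u' v' w'

/-! ## Operadic categories -/

/-- The set `π₀(O)` of connected components. -/
abbrev Pi0 (O : Type u) [Category.{v} O] : Type u := CategoryTheory.ConnectedComponents O

/-- The connected component of an object. -/
abbrev π₀ {O : Type u} [Category.{v} O] (T : O) : Pi0 O := CategoryTheory.ConnectedComponents.mk T

theorem π₀_eq_of_hom {O : Type u} [Category.{v} O] {T S : O} (f : T ⟶ S) : π₀ T = π₀ S :=
  Quotient.sound (Zigzag.of_hom f)

/-- A function on objects that is constant along morphisms descends to `π₀`. -/
def Pi0.lift {O : Type u} [Category.{v} O] {α : Type w} (F : O → α)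
    (hF : ∀ {T S : O}, (T ⟶ S) → F T = F S) : Pi0 O → α :=
  Quotient.lift F fun T S h => by
    induction h with
    | refl => rfl
    | tail _ h ih =>
      rcases h with ⟨⟨f⟩⟩ | ⟨⟨f⟩⟩
      · exact ih.trans (hF f)
      · exact ih.trans (hF f).symm

/-- An operadic category in the sense of Batanin and Markl: a category with a cardinality functor to
the category of the sets `{1, …, n}` and all maps, a chosen terminal object in every connected
component, and fibre functors. -/
class OperadicCategory (O : Type u) [Category.{v} O] where
  /-- The cardinality functor on objects; `card T` stands for the set `Fin (card T)`. -/
  card : O → ℕ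
  /-- The cardinality functor on morphisms. -/
  cardMap : ∀ {T S : O}, (T ⟶ S) → Fin (card T) → Fin (card S)
  cardMap_id : ∀ (T : O) (k : Fin (card T)), cardMap (𝟙 T) k = k
  cardMap_comp : ∀ {T S R : O} (f : T ⟶ S) (g : S ⟶ R) (k : Fin (card T)),
    cardMap (f ≫ g) k = cardMap g (cardMap f k)
  /-- The chosen object of a connected component. -/
  chosen : Pi0 O → O
  π₀_chosen : ∀ c, π₀ (chosen c) = c
  /-- The chosen object is terminal in its connected component: existence. -/
  toChosen : ∀ T : O, T ⟶ chosen (π₀ T)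
  /-- The chosen object is terminal in its connected component: uniqueness. -/
  hom_chosen_ext : ∀ {T : O} {c : Pi0 O} (f g : T ⟶ chosen c), f = g
  /-- The `i`-th fibre `f⁻¹(i)` of a morphism. -/
  fib : ∀ {T S : O}, (T ⟶ S) → Fin (card S) → O
  /-- The equality `|f⁻¹(i)| = |f|⁻¹(i)`, given as the order-preserving inclusion of `|f⁻¹(i)|` in
  `|T|` with image `|f|⁻¹(i)`. There is at most one such inclusion, and there is one exactly when the
  cardinality of `f⁻¹(i)` is the number of elements of `|f|⁻¹(i)`. -/
  inc : ∀ {T S : O} (f : T ⟶ S) (i : Fin (card S)), Fin (card (fib f i)) ↪o Fin (card T)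
  mem_range_inc : ∀ {T S : O} (f : T ⟶ S) (i : Fin (card S)) (k : Fin (card T)),
    k ∈ Set.range (inc f i) ↔ cardMap f k = i
  card_chosen : ∀ c, card (chosen c) = 1
  /-- The fibres of an identity are chosen local terminal objects. -/
  fib_id : ∀ (T : O) (i : Fin (card T)), ∃ c, fib (𝟙 T) i = chosen c
  /-- The map `f_i : h⁻¹(i) ⟶ g⁻¹(i)` that a morphism `f` from `h : T ⟶ R` to `g : S ⟶ R` over `R`
  induces on the fibres. -/
  fibMap : ∀ {T S R : O} (f : T ⟶ S) (g : S ⟶ R) (h : T ⟶ R), f ≫ g = h →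
    ∀ i : Fin (card R), fib h i ⟶ fib g i
  /-- `|f_i|` is the restriction of `|f|`. -/
  inc_fibMap : ∀ {T S R : O} (f : T ⟶ S) (g : S ⟶ R) (h : T ⟶ R) (e : f ≫ g = h)
    (i : Fin (card R)) (k : Fin (card (fib h i))),
    inc g i (cardMap (fibMap f g h e i) k) = cardMap f (inc h i k)
  /-- `Fib_i : O/R ⥤ O` preserves identities. -/
  fibMap_id : ∀ {S R : O} (g : S ⟶ R) (i : Fin (card R)),
    fibMap (𝟙 S) g g (Category.id_comp g) i = 𝟙 (fib g i)
  /-- `Fib_i : O/R ⥤ O` preserves composition. -/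
  fibMap_comp : ∀ {T S Q R : O} (f : T ⟶ S) (g : S ⟶ Q) (h₁ : T ⟶ R) (h₂ : S ⟶ R) (h₃ : Q ⟶ R)
    (e₁ : f ≫ h₂ = h₁) (e₂ : g ≫ h₃ = h₂) (e₃ : (f ≫ g) ≫ h₃ = h₁) (i : Fin (card R)),
    fibMap (f ≫ g) h₃ h₁ e₃ i = fibMap f h₂ h₁ e₁ i ≫ fibMap g h₃ h₂ e₂ i
  /-- Over a chosen local terminal object, the fibre functor is the domain functor: objects. -/
  fib_chosen : ∀ {T : O} {c : Pi0 O} (f : T ⟶ chosen c) (i : Fin (card (chosen c))),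
    fib f i = T
  /-- Over a chosen local terminal object, the fibre functor is the domain functor: morphisms. -/
  fibMap_chosen : ∀ {T S : O} {c : Pi0 O} (f : T ⟶ S) (g : S ⟶ chosen c)
    (h : T ⟶ chosen c) (e : f ≫ g = h) (i : Fin (card (chosen c))), HEq (fibMap f g h e i) f
  /-- The fibres of `f_i` are fibres of `f`. -/
  fib_fibMap : ∀ {T S R : O} (f : T ⟶ S) (g : S ⟶ R) (h : T ⟶ R) (e : f ≫ g = h)
    (i : Fin (card R)) (j : Fin (card (fib g i))), fib (fibMap f g h e i) j = fib f (inc g i j)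
  /-- The maps `(a_i)_j` and `a_j` between these fibres agree. -/
  fibMap_fibMap : ∀ {T S Q R : O} (a : T ⟶ S) (g : S ⟶ Q) (f : T ⟶ Q) (b : Q ⟶ R)
    (g' : S ⟶ R) (f' : T ⟶ R) (e : a ≫ g = f) (eg : g ≫ b = g') (ef : f ≫ b = f')
    (e' : a ≫ g' = f') (i : Fin (card R))
    (e'' : fibMap a g' f' e' i ≫ fibMap g b g' eg i = fibMap f b f' ef i)
    (j : Fin (card (fib b i))),
    HEq (fibMap (fibMap a g' f' e' i) (fibMap g b g' eg i) (fibMap f b f' ef i) e'' j)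
      (fibMap a g f e (inc b i j))

namespace OperadicCategory

/-- The chosen local terminal objects. -/
def IsTrivial {O : Type u} [Category.{v} O] [OperadicCategory O] (T : O) : Prop :=
  T = chosen (π₀ T)

section basics

variable {O : Type u} [Category.{v} O] [OperadicCategory O]

theorem isTrivial_chosen (c : Pi0 O) : IsTrivial (chosen c) := by
  unfold IsTrivial; rw [π₀_chosen]

theorem isTrivial_of_eq {T : O} {c : Pi0 O} (h : T = chosen c) : IsTrivial T := by
  subst h; exact isTrivial_chosen c

theorem isTrivial_fib_id (T : O) (i : Fin (card T)) : IsTrivial (fib (𝟙 T) i) := by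
  obtain ⟨c, hc⟩ := fib_id T i
  exact isTrivial_of_eq hc

theorem IsTrivial.card_eq {T : O} (h : IsTrivial T) : card T = 1 := by
  unfold IsTrivial at h; rw [h, card_chosen]

theorem IsTrivial.fib_eq {T S : O} (h : IsTrivial S) (f : T ⟶ S) (i : Fin (card S)) :
    fib f i = T := by
  obtain ⟨c, rfl⟩ : ∃ c, S = chosen c := ⟨_, h⟩
  exact fib_chosen f i

/-- All fibres over the same point lie in the same connected component. -/
theorem π₀_fib {T S : O} (f : T ⟶ S) (i : Fin (card S)) :
    π₀ (fib f i) = π₀ (fib (𝟙 S) i) :=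
  π₀_eq_of_hom (fibMap f (𝟙 S) f (Category.comp_id f) i)

theorem cardMap_inc {T S : O} (f : T ⟶ S) (i : Fin (card S)) (k : Fin (card (fib f i))) :
    cardMap f (inc f i k) = i :=
  (mem_range_inc f i _).1 ⟨k, rfl⟩

/-- The fibres of the identity of a fibre are fibres of an identity, up to connected components. -/
theorem π₀_fib_id_fib {T S : O} (f : T ⟶ S) (i : Fin (card S)) (k : Fin (card (fib f i))) :
    π₀ (fib (𝟙 (fib f i)) k) = π₀ (fib (𝟙 T) (inc f i k)) := by
  have := fib_fibMap (𝟙 T) f f (Category.id_comp f) i k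
  rw [fibMap_id] at this
  exact congrArg π₀ this

end basics

/-! ### Comparing order embeddings and sums of ordinals -/

theorem emb_unique {m m' n : ℕ} (p : Fin m ↪o Fin n) (q : Fin m' ↪o Fin n)
    (h : Set.range p = Set.range q) :
    m = m' ∧ ∀ (k : Fin m) (k' : Fin m'), k.val = k'.val → p k = q k' := by
  have hm : m = m' := by
    have := congrArg Set.ncard h
    rw [← Set.image_univ, ← Set.image_univ, Set.ncard_image_of_injective _ p.injective,
      Set.ncard_image_of_injective _ q.injective] at this
    simpa [Set.ncard_univ] using this
  subst hm
  refine ⟨rfl, fun k k' hk => ?_⟩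
  obtain rfl : k = k' := Fin.ext hk
  have := (StrictMono.range_inj p.strictMono q.strictMono).1 h
  exact congrFun this k

section basics2

variable {O : Type u} [Category.{v} O] [OperadicCategory O]

theorem inc_inc {T S R : O} (f : T ⟶ S) (g : S ⟶ R) (h : T ⟶ R) (e : f ≫ g = h)
    (i : Fin (card R)) (j : Fin (card (fib g i))) (k : Fin (card (fib (fibMap f g h e i) j)))
    (k' : Fin (card (fib f (inc g i j)))) (hk : k.val = k'.val) :
    inc h i (inc (fibMap f g h e i) j k) = inc f (inc g i j) k' := by
  refine (emb_unique ((inc (fibMap f g h e i) j).trans (inc h i)) (inc f (inc g i j)) ?_).2 k k' hk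
  ext x
  rw [mem_range_inc]
  constructor
  · rintro ⟨y, rfl⟩
    simp only [RelEmbedding.coe_trans, Function.comp_apply]
    rw [← inc_fibMap f g h e, cardMap_inc]
  · intro hx
    have hx' : cardMap h x = i := by rw [← e, cardMap_comp, hx, cardMap_inc]
    obtain ⟨y, rfl⟩ := (mem_range_inc h i x).2 hx'
    rw [← inc_fibMap f g h e] at hx
    obtain ⟨z, rfl⟩ := (mem_range_inc (fibMap f g h e i) j y).2 ((inc g i).injective hx)
    exact ⟨z, rfl⟩

theorem inc_val_of_forall {T S : O} (f : T ⟶ S) (i : Fin (card S)) (h : ∀ k, cardMap f k = i)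
    (k : Fin (card (fib f i))) : (inc f i k).val = k.val := by
  have := emb_unique (inc f i) (RelEmbedding.refl (· ≤ ·)) (by
    ext x; rw [mem_range_inc]; simp [h])
  have := this.2 k ⟨k.val, this.1 ▸ k.2⟩ rfl
  rw [this]; rfl

theorem inc_val_of_isTrivial {T S : O} (hS : IsTrivial S) (f : T ⟶ S) (i : Fin (card S))
    (k : Fin (card (fib f i))) : (inc f i k).val = k.val := by
  refine inc_val_of_forall f i (fun k => ?_) k
  have : Subsingleton (Fin (card S)) := by rw [hS.card_eq]; infer_instance
  exact Subsingleton.elim _ _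

theorem inc_id (T : O) (i : Fin (card T)) (k : Fin (card (fib (𝟙 T) i))) :
    inc (𝟙 T) i k = i := by
  have := cardMap_inc (𝟙 T) i k
  rwa [cardMap_id] at this

theorem fib_heq {T S T' S' : O} (hT : T = T') (hS : S = S') {f : T ⟶ S} {f' : T' ⟶ S'}
    (hf : HEq f f') {i : Fin (card S)} {i' : Fin (card S')} (hi : i.val = i'.val) :
    fib f i = fib f' i' := by
  subst hT hS; cases hf; cases Fin.ext hi; rfl

theorem inc_heq {T S T' S' : O} (hT : T = T') (hS : S = S') {f : T ⟶ S} {f' : T' ⟶ S'}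
    (hf : HEq f f') {i : Fin (card S)} {i' : Fin (card S')} (hi : i.val = i'.val)
    (k : Fin (card (fib f i))) (k' : Fin (card (fib f' i'))) (hk : k.val = k'.val) :
    (inc f i k).val = (inc f' i' k').val := by
  subst hT hS; cases hf; cases Fin.ext hi; cases Fin.ext hk; rfl

theorem fibMap_heq {T S R T' S' R' : O} (hT : T = T') (hS : S = S') (hR : R = R')
    {f : T ⟶ S} {f' : T' ⟶ S'} (hf : HEq f f') {g : S ⟶ R} {g' : S' ⟶ R'} (hg : HEq g g')
    {h : T ⟶ R} {h' : T' ⟶ R'} (e : f ≫ g = h) (e' : f' ≫ g' = h')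
    {i : Fin (card R)} {i' : Fin (card R')} (hi : i.val = i'.val) :
    HEq (fibMap f g h e i) (fibMap f' g' h' e' i') := by
  subst hT hS hR; cases hf; cases hg; cases Fin.ext hi; subst e; subst e'; rfl

end basics2

end OperadicCategory

open OperadicCategory

/-! ## Operads over an operadic category -/

/-- An operad in sets over an operadic category. The structure map of `f : T ⟶ S` is
`μ f : ∏_i P(f⁻¹(i)) × P(S) → P(T)`; it is written with a family of objects `F i` together with
equalities `F i = f⁻¹(i)`, so that no transport along equalities of fibres is needed. -/
structure Operad (O : Type u) [Category.{v} O] [OperadicCategory O] where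
  obj : O → Type w
  /-- The units, one for each chosen local terminal object. -/
  one : ∀ T : O, IsTrivial T → obj T
  μ : ∀ {T S : O} (f : T ⟶ S) (F : Fin (card S) → O), (∀ i, F i = fib f i) →
    (∀ i, obj (F i)) → obj S → obj T
  /-- The identity of `T` acts with units on its fibres as the identity. -/
  μ_id : ∀ {T : O} (x : obj T),
    μ (𝟙 T) (fib (𝟙 T)) (fun _ => rfl) (fun i => one _ (isTrivial_fib_id T i)) x = x
  /-- Composition with the unit over a chosen local terminal object is the identity. -/
  μ_one : ∀ {T S : O} (hS : IsTrivial S) (f : T ⟶ S) (x : obj T),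
    μ f (fun _ => T) (fun i => (hS.fib_eq f i).symm) (fun _ => x) (one S hS) = x
  /-- Associativity for `h = f ≫ g`. -/
  μ_assoc : ∀ {T S R : O} (f : T ⟶ S) (g : S ⟶ R) (h : T ⟶ R) (e : f ≫ g = h)
    (a : ∀ j, obj (fib f j)) (b : ∀ i, obj (fib g i)) (c : obj R),
    μ h (fib h) (fun _ => rfl)
      (fun i => μ (fibMap f g h e i) (fun j => fib f (inc g i j))
        (fun j => (fib_fibMap f g h e i j).symm) (fun j => a (inc g i j)) (b i)) c =
    μ f (fib f) (fun _ => rfl) a (μ g (fib g) (fun _ => rfl) b c)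

namespace Operad

section

variable {O : Type u} [Category.{v} O] [OperadicCategory O]

theorem μ_congr (P : Operad.{u, v, w} O) {T S : O} {f f' : T ⟶ S} (hf : f = f')
    {F F' : Fin (card S) → O} (hF : ∀ i, F i = fib f i) (hF' : ∀ i, F' i = fib f' i)
    {a : ∀ i, P.obj (F i)} {a' : ∀ i, P.obj (F' i)} (ha : ∀ i, HEq (a i) (a' i))
    {s s' : P.obj S} (hs : s = s') : P.μ f F hF a s = P.μ f' F' hF' a' s' := by
  subst hf hs
  obtain rfl : F = F' := funext fun i => (hF i).trans (hF' i).symm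
  obtain rfl : a = a' := funext fun i => eq_of_heq (ha i)
  rfl

theorem μ_heq (P : Operad.{u, v, w} O) {T S T' S' : O} (hT : T = T') (hS : S = S')
    {f : T ⟶ S} {f' : T' ⟶ S'} (hf : HEq f f')
    {F : Fin (card S) → O} {F' : Fin (card S') → O}
    (hF : ∀ i, F i = fib f i) (hF' : ∀ i, F' i = fib f' i)
    {a : ∀ i, P.obj (F i)} {a' : ∀ i, P.obj (F' i)}
    (ha : ∀ i i', i.val = i'.val → HEq (a i) (a' i'))
    {s : P.obj S} {s' : P.obj S'} (hs : HEq s s') : HEq (P.μ f F hF a s) (P.μ f' F' hF' a' s') := by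
  subst hT hS; cases hf; cases hs
  exact heq_of_eq (P.μ_congr rfl hF hF' (fun i => ha i i rfl) rfl)

theorem one_heq (P : Operad.{u, v, w} O) {T T' : O} (h : T = T') (hT : IsTrivial T)
    (hT' : IsTrivial T') : HEq (P.one T hT) (P.one T' hT') := by
  subst h; rfl

/-- A morphism of operads over the same operadic category. -/
@[ext]
structure Hom (P : Operad.{u, v, w} O) (Q : Operad.{u, v, w'} O) where
  app : ∀ T : O, P.obj T → Q.obj T
  app_one : ∀ (T : O) (h : IsTrivial T), app T (P.one T h) = Q.one T h
  app_μ : ∀ {T S : O} (f : T ⟶ S) (F : Fin (card S) → O) (hF : ∀ i, F i = fib f i)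
    (a : ∀ i, P.obj (F i)) (s : P.obj S),
    app T (P.μ f F hF a s) = Q.μ f F hF (fun i => app (F i) (a i)) (app S s)

instance : Category (Operad.{u, v, w} O) where
  Hom P Q := Hom P Q
  id P := ⟨fun _ x => x, fun _ _ => rfl, fun _ _ _ _ _ => rfl⟩
  comp α β := ⟨fun T x => β.app T (α.app T x), fun T h => by rw [α.app_one, β.app_one],
    fun f F hF a s => by rw [α.app_μ, β.app_μ]⟩

/-- The terminal operad `𝟏_O`. -/
def terminal (O : Type u) [Category.{v} O] [OperadicCategory O] : Operad.{u, v, w} O where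
  obj _ := PUnit
  one _ _ := PUnit.unit
  μ _ _ _ _ _ := PUnit.unit
  μ_id _ := rfl
  μ_one _ _ _ := rfl
  μ_assoc _ _ _ _ _ _ _ := rfl

end

end Operad

/-! ## Operadic functors and restriction of operads -/

/-- A (strict) operadic functor: it preserves cardinalities, fibres and chosen local terminal
objects. Preservation of the cardinality of objects is given as the (unique) order isomorphism. -/
structure OperadicFunctor (O : Type u) [Category.{v} O] [OperadicCategory O]
    (O' : Type u') [Category.{v'} O'] [OperadicCategory O'] where
  functor : O ⥤ O'
  idx : ∀ T : O, Fin (card T) ≃o Fin (card (functor.obj T))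
  idx_cardMap : ∀ {T S : O} (f : T ⟶ S) (k : Fin (card T)),
    cardMap (functor.map f) (idx T k) = idx S (cardMap f k)
  obj_fib : ∀ {T S : O} (f : T ⟶ S) (i : Fin (card S)),
    functor.obj (fib f i) = fib (functor.map f) (idx S i)
  map_fibMap : ∀ {T S R : O} (f : T ⟶ S) (g : S ⟶ R) (h : T ⟶ R) (e : f ≫ g = h)
    (e' : functor.map f ≫ functor.map g = functor.map h) (i : Fin (card R)),
    HEq (functor.map (fibMap f g h e i))
      (fibMap (functor.map f) (functor.map g) (functor.map h) e' (idx R i))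
  isTrivial_obj : ∀ {T : O}, IsTrivial T → IsTrivial (functor.obj T)

namespace OperadicFunctor

section

variable {O : Type u} [Category.{v} O] [OperadicCategory O]
  {O' : Type u'} [Category.{v'} O'] [OperadicCategory O']

theorem idx_val (Φ : OperadicFunctor O O') {T : O} (k : Fin (card T)) :
    (Φ.idx T k).val = k.val := by
  have := (emb_unique (Φ.idx T).toOrderEmbedding (RelEmbedding.refl (· ≤ ·)) (by
    ext x; simp))
  have := this.2 k ⟨k.val, this.1 ▸ k.2⟩ rfl
  exact congrArg Fin.val this

theorem idx_symm_val (Φ : OperadicFunctor O O') {T : O} (k : Fin (card (Φ.functor.obj T))) :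
    ((Φ.idx T).symm k).val = k.val := by
  rw [← Φ.idx_val, OrderIso.apply_symm_apply]

theorem obj_fib' (Φ : OperadicFunctor O O') {T S : O} (f : T ⟶ S) (F : Fin (card S) → O)
    (hF : ∀ i, F i = fib f i) (i : Fin (card (Φ.functor.obj S))) :
    Φ.functor.obj (F ((Φ.idx S).symm i)) = fib (Φ.functor.map f) i := by
  rw [hF, Φ.obj_fib, OrderIso.apply_symm_apply]

theorem idx_inc (Φ : OperadicFunctor O O') {T S : O} (f : T ⟶ S) (i : Fin (card S))
    (i' : Fin (card (Φ.functor.obj S))) (hi : i.val = i'.val)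
    (k : Fin (card (fib f i))) (k' : Fin (card (fib (Φ.functor.map f) i'))) (hk : k.val = k'.val) :
    (inc f i k).val = (inc (Φ.functor.map f) i' k').val := by
  obtain rfl : Φ.idx S i = i' := Fin.ext ((Φ.idx_val i).trans hi)
  have := (emb_unique ((inc f i).trans (Φ.idx T).toOrderEmbedding)
    (inc (Φ.functor.map f) (Φ.idx S i)) (by
      ext x
      rw [mem_range_inc]
      obtain ⟨x, rfl⟩ := (Φ.idx T).surjective x
      rw [Φ.idx_cardMap, (Φ.idx S).injective.eq_iff, ← mem_range_inc]
      constructor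
      · rintro ⟨y, hy⟩; exact ⟨y, (Φ.idx T).injective hy⟩
      · rintro ⟨y, rfl⟩; exact ⟨y, rfl⟩)).2 k k' hk
  rw [← this]
  exact (Φ.idx_val _).symm

/-- The restriction `Φ^*` of operads along an operadic functor. -/
def restrict (Φ : OperadicFunctor O O') (Q : Operad.{u', v', w} O') : Operad.{u, v, w} O where
  obj T := Q.obj (Φ.functor.obj T)
  one T h := Q.one _ (Φ.isTrivial_obj h)
  μ {T S} f F hF a s := Q.μ (Φ.functor.map f) (fun i => Φ.functor.obj (F ((Φ.idx S).symm i)))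
    (Φ.obj_fib' f F hF) (fun i => a ((Φ.idx S).symm i)) s
  μ_id {T} x := by
    refine Eq.trans ?_ (Q.μ_id x)
    refine Q.μ_congr (Φ.functor.map_id T) _ _ (fun i => ?_) rfl
    apply Q.one_heq
    rw [Φ.obj_fib, OrderIso.apply_symm_apply, Φ.functor.map_id]
  μ_one hS f x := Q.μ_one (Φ.isTrivial_obj hS) (Φ.functor.map f) x
  μ_assoc {T S R} f g h e a b c := by
    have key : ∀ {T S : O} (f : T ⟶ S) (a : ∀ j, Q.obj (Φ.functor.obj (fib f j)))
        (j j' : Fin (card S)), j = j' → HEq (a j) (a j') := by rintro T S f a j _ rfl; rfl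
    have e' : Φ.functor.map f ≫ Φ.functor.map g = Φ.functor.map h := by
      rw [← e, Φ.functor.map_comp]
    have eqf : ∀ {T S : O} (f : T ⟶ S) (i : Fin (card (Φ.functor.obj S))),
        Φ.functor.obj (fib f ((Φ.idx S).symm i)) = fib (Φ.functor.map f) i := fun f i =>
      Φ.obj_fib' f (fib f) (fun _ => rfl) i
    have H := Q.μ_assoc (Φ.functor.map f) (Φ.functor.map g) (Φ.functor.map h) e'
      (fun j => cast (congrArg Q.obj (eqf f j)) (a ((Φ.idx S).symm j)))
      (fun j => cast (congrArg Q.obj (eqf g j)) (b ((Φ.idx R).symm j))) c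
    refine Eq.trans (Q.μ_congr rfl _ _ (fun i => ?_) rfl)
      (H.trans (Q.μ_congr rfl _ _ (fun i => ?_) (Q.μ_congr rfl _ _ (fun i => ?_) rfl)))
    · refine Q.μ_heq (eqf h i) (eqf g i) ?_ _ _ ?_ ?_
      · refine (Φ.map_fibMap f g h e e' _).trans ?_
        rw [OrderIso.apply_symm_apply]
      · intro j j' hj
        refine HEq.trans (key f a _ _ ?_) (cast_heq _ _).symm
        apply Fin.ext
        rw [idx_symm_val]
        apply Φ.idx_inc
        · rw [idx_symm_val]
        · rw [idx_symm_val, hj]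
      · exact (cast_heq _ _).symm
    · exact cast_heq _ _
    · exact cast_heq _ _

end

end OperadicFunctor

/-! ## Bouquets -/

/-- A bouquet with colours in `C`: input colours `leaf 1, …, leaf n` and an output colour. -/
@[ext]
structure Bq (C : Type u) where
  n : ℕ
  leaf : Fin n → C
  root : C

namespace Bq

/-- A morphism of bouquets is any map of the sets of inputs, provided that the output colours
agree. -/
@[ext]
structure Hom {C : Type u} (b b' : Bq C) where
  toFun : Fin b.n → Fin b'.n
  root_eq : b.root = b'.root

instance (C : Type u) : Category.{0} (Bq C) where
  Hom := Hom
  id b := ⟨id, rfl⟩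
  comp f g := ⟨g.toFun ∘ f.toFun, f.root_eq.trans g.root_eq⟩

section

variable {C : Type u}

/-- The order-preserving enumeration of the preimage of a point. -/
def emb {n m : ℕ} (f : Fin n → Fin m) (i : Fin m) :
    Fin (Finset.univ.filter (fun k => f k = i)).card ↪o Fin n :=
  (Finset.univ.filter (fun k => f k = i)).orderEmbOfFin rfl

theorem mem_range_emb {n m : ℕ} (f : Fin n → Fin m) (i : Fin m) (k : Fin n) :
    k ∈ Set.range (emb f i) ↔ f k = i := by
  unfold emb
  rw [Finset.range_orderEmbOfFin]
  simp

theorem apply_emb {n m : ℕ} (f : Fin n → Fin m) (i : Fin m) (k) : f (emb f i k) = i :=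
  (mem_range_emb f i _).1 ⟨k, rfl⟩

/-- The map `|h|⁻¹(i) → |g|⁻¹(i)` induced by `f` with `g ∘ f = h`. -/
noncomputable def restr {n m l : ℕ} (f : Fin n → Fin m) (g : Fin m → Fin l) (h : Fin n → Fin l)
    (e : g ∘ f = h) (i : Fin l) (k : Fin (Finset.univ.filter (fun k => h k = i)).card) :
    Fin (Finset.univ.filter (fun k => g k = i)).card :=
  ((mem_range_emb g i (f (emb h i k))).2
    ((congrFun e _).trans (apply_emb h i k))).choose

theorem emb_restr {n m l : ℕ} (f : Fin n → Fin m) (g : Fin m → Fin l) (h : Fin n → Fin l)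
    (e : g ∘ f = h) (i : Fin l) (k) : emb g i (restr f g h e i k) = f (emb h i k) :=
  ((mem_range_emb g i (f (emb h i k))).2
    ((congrFun e _).trans (apply_emb h i k))).choose_spec

/-- The local terminal bouquet of colour `c`. -/
def triv (c : C) : Bq C := ⟨1, fun _ => c, c⟩

/-- The output colour of a connected component. -/
def rootOf : Pi0 (Bq C) → C := Pi0.lift Bq.root (fun {_ _} (f : Hom _ _) => f.root_eq)

/-- The elements over `j` of the fibre over `i` are the elements over the point `j` of the middle
set. -/
theorem mem_range_emb_restr {n m l : ℕ} (f : Fin n → Fin m) (g : Fin m → Fin l) (h : Fin n → Fin l)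
    (e : g ∘ f = h) (i : Fin l) (j) (k : Fin n) :
    k ∈ Set.range ((emb (restr f g h e i) j).trans (emb h i)) ↔ f k = emb g i j := by
  constructor
  · rintro ⟨k, rfl⟩
    refine (emb_restr f g h e i _).symm.trans ?_
    exact congrArg (emb g i) (apply_emb _ _ _)
  · intro hk
    have hk' : h k = i := by
      rw [← e]; exact (congrArg g hk).trans (apply_emb _ _ _)
    obtain ⟨k, rfl⟩ := (mem_range_emb h i k).2 hk'
    rw [← emb_restr f g h e i] at hk
    obtain ⟨k, rfl⟩ := (mem_range_emb _ j k).2 ((emb g i).injective hk)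
    exact ⟨k, rfl⟩

theorem emb_emb {n m l : ℕ} (f : Fin n → Fin m) (g : Fin m → Fin l) (h : Fin n → Fin l)
    (e : g ∘ f = h) (i : Fin l) (j) (k) (k') (hk : k.val = k'.val) :
    emb h i (emb (restr f g h e i) j k) = emb f (emb g i j) k' :=
  (emb_unique ((emb (restr f g h e i) j).trans (emb h i)) (emb f (emb g i j))
    (by ext k; rw [mem_range_emb_restr, mem_range_emb])).2 k k' hk

theorem ext' {b b' : Bq C} (hn : b.n = b'.n)
    (hl : ∀ (k : Fin b.n) (k' : Fin b'.n), k.val = k'.val → b.leaf k = b'.leaf k')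
    (hr : b.root = b'.root) : b = b' := by
  obtain ⟨n, l, r⟩ := b
  obtain ⟨n', l', r'⟩ := b'
  dsimp only at *
  subst hn hr
  obtain rfl : l = l' := funext fun k => hl k k rfl
  rfl

theorem hom_heq {b₁ b₂ b₁' b₂' : Bq C} (h₁ : b₁ = b₁') (h₂ : b₂ = b₂') (f : b₁ ⟶ b₂)
    (f' : b₁' ⟶ b₂') (h : ∀ (k : Fin b₁.n) (k' : Fin b₁'.n), k.val = k'.val →
      (f.toFun k).val = (f'.toFun k').val) : HEq f f' := by
  subst h₁ h₂
  exact heq_of_eq (Hom.ext (funext fun k => Fin.ext (h k k rfl)))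

/-- The fibre over `i`: the inputs over `i` with their colours, and the colour of `i` as output. -/
def fibre {b b' : Bq C} (f : b ⟶ b') (i : Fin b'.n) : Bq C where
  n := (Finset.univ.filter (fun k => f.toFun k = i)).card
  leaf k := b.leaf (emb f.toFun i k)
  root := b'.leaf i

theorem eq_fibre {b b' : Bq C} (f : b ⟶ b') (i : Fin b'.n) (t : Bq C) (p : Fin t.n ↪o Fin b.n)
    (hp : ∀ k, k ∈ Set.range p ↔ f.toFun k = i) (hl : ∀ k, t.leaf k = b.leaf (p k))
    (hr : t.root = b'.leaf i) : t = fibre f i := by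
  have := emb_unique p (emb f.toFun i) (by ext k; rw [hp, mem_range_emb])
  refine ext' this.1 (fun k k' hk => ?_) hr
  rw [hl, this.2 k k' hk]; rfl

theorem emb_val {b b' : Bq C} (f : b ⟶ b') (i : Fin b'.n) {t : Bq C} (p : Fin t.n ↪o Fin b.n)
    (hp : ∀ k, k ∈ Set.range p ↔ f.toFun k = i) (k : Fin t.n) (k' : Fin (fibre f i).n)
    (hk : k.val = k'.val) : p k = emb f.toFun i k' :=
  (emb_unique p (emb f.toFun i) (by ext k; rw [hp, mem_range_emb])).2 k k' hk

theorem hom_toFun_eq {b b' : Bq C} (f : b ⟶ b') (h : b'.n = 1) (i : Fin b'.n) (k) :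
    f.toFun k = i := by
  have : Subsingleton (Fin b'.n) := by rw [h]; infer_instance
  exact Subsingleton.elim _ _

/-- The bouquets with colours in `C` form an operadic category. -/
noncomputable instance : OperadicCategory (Bq C) where
  card b := b.n
  cardMap f := f.toFun
  cardMap_id _ _ := rfl
  cardMap_comp _ _ _ := rfl
  chosen c := triv (rootOf c)
  π₀_chosen c := by
    induction c using Quotient.inductionOn with
    | h b => exact (π₀_eq_of_hom (⟨fun _ => ⟨0, Nat.one_pos⟩, rfl⟩ : b ⟶ triv b.root)).symm
  toChosen b := ⟨fun _ => ⟨0, Nat.one_pos⟩, rfl⟩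
  hom_chosen_ext f g := Hom.ext (funext fun k => (Subsingleton.elim (α := Fin 1) _ _))
  fib f i := fibre f i
  inc f i := emb f.toFun i
  mem_range_inc f i k := mem_range_emb f.toFun i k
  card_chosen _ := rfl
  fib_id b i := by
    refine ⟨π₀ (triv (b.leaf i)), (eq_fibre (𝟙 b) i (triv (b.leaf i))
      (OrderEmbedding.ofStrictMono (fun _ => i)
        (fun x y h => absurd (Subsingleton.elim (α := Fin 1) x y) h.ne)) ?_ ?_ rfl).symm⟩
    · intro k
      constructor
      · rintro ⟨_, rfl⟩; rfl
      · rintro rfl; exact ⟨⟨0, Nat.one_pos⟩, rfl⟩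
    · intro k; rfl
  fibMap f g h e i := ⟨restr f.toFun g.toFun h.toFun (congrArg Hom.toFun e) i, rfl⟩
  inc_fibMap f g h e i k := emb_restr f.toFun g.toFun h.toFun (congrArg Hom.toFun e) i k
  fibMap_id g i := Hom.ext (funext fun k => (emb g.toFun i).injective
    (emb_restr id g.toFun g.toFun rfl i k))
  fibMap_comp f g h₁ h₂ h₃ e₁ e₂ e₃ i := Hom.ext (funext fun k => (emb h₃.toFun i).injective (by
    refine (emb_restr (g.toFun ∘ f.toFun) h₃.toFun h₁.toFun (congrArg Hom.toFun e₃) i k).trans ?_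
    refine Eq.trans ?_ (emb_restr g.toFun h₃.toFun h₂.toFun (congrArg Hom.toFun e₂) i _).symm
    exact congrArg g.toFun (emb_restr f.toFun h₂.toFun h₁.toFun (congrArg Hom.toFun e₁) i _).symm))
  fib_chosen {b c} f i := by
    refine (eq_fibre f i b (RelEmbedding.refl _) (fun k => ?_) (fun _ => rfl) f.root_eq).symm
    exact ⟨fun _ => hom_toFun_eq f rfl i k, fun _ => ⟨k, rfl⟩⟩
  fibMap_chosen {b b' c} f g h e i := by
    have H : ∀ {b : Bq C} (f : b ⟶ triv (rootOf c)),
        b = fibre f i := fun {b} f =>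
      eq_fibre f i b (RelEmbedding.refl _)
        (fun k => ⟨fun _ => hom_toFun_eq f rfl i k, fun _ => ⟨k, rfl⟩⟩) (fun _ => rfl) f.root_eq
    have H' : ∀ {b : Bq C} (f : b ⟶ triv (rootOf c))
        (k : Fin (fibre f i).n), (emb f.toFun i k).val = k.val := fun {b} f k => by
      have := emb_val f i (t := b) (RelEmbedding.refl _)
        (fun k => ⟨fun _ => hom_toFun_eq f rfl i k, fun _ => ⟨k, rfl⟩⟩)
        ⟨k.val, by have := congrArg Bq.n (H f); omega⟩ k rfl
      rw [← this]; rfl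
    refine hom_heq (H h).symm (H g).symm _ _ (fun k k' hk => ?_)
    rw [← H' g]
    refine (congrArg Fin.val (emb_restr f.toFun g.toFun h.toFun
      (congrArg Hom.toFun e) i k)).trans ?_
    congr 2
    apply Fin.ext
    rw [H' h, hk]
  fib_fibMap {b₁ b₂ b₃} f g h e i j := by
    refine eq_fibre f (emb g.toFun i j) _
      ((emb (restr f.toFun g.toFun h.toFun (congrArg Hom.toFun e) i) j).trans (emb h.toFun i))
      (fun k => mem_range_emb_restr f.toFun g.toFun h.toFun (congrArg Hom.toFun e) i j k)
      (fun k => rfl) rfl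
  fibMap_fibMap {b₁ b₂ b₃ b₄} a g f b g' f' e eg ef e' i e'' j := by
    have H : ∀ {b₁ b₂ b₃ : Bq C} (f : b₁ ⟶ b₂) (g : b₂ ⟶ b₃) (h : b₁ ⟶ b₃) (e : f ≫ g = h)
        (i : Fin b₃.n) (j : Fin (fibre g i).n),
        fibre (⟨restr f.toFun g.toFun h.toFun (congrArg Hom.toFun e) i, rfl⟩ :
          fibre h i ⟶ fibre g i) j = fibre f (emb g.toFun i j) := fun {b₁ b₂ b₃} f g h e i j =>
      eq_fibre f (emb g.toFun i j) _
        ((emb (restr f.toFun g.toFun h.toFun (congrArg Hom.toFun e) i) j).trans (emb h.toFun i))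
        (fun k => mem_range_emb_restr f.toFun g.toFun h.toFun (congrArg Hom.toFun e) i j k)
        (fun k => rfl) rfl
    refine hom_heq (H f b f' ef i j) (H g b g' eg i j) _ _ (fun k k' hk => ?_)
    have hn := congrArg Bq.n (H g b g' eg i j)
    generalize hx : Hom.toFun _ k = x
    have h1 := emb_emb g.toFun b.toFun g'.toFun (congrArg Hom.toFun eg) i j x
      ⟨x.val, lt_of_lt_of_eq x.2 hn⟩ rfl
    have h2 := emb_emb f.toFun b.toFun f'.toFun (congrArg Hom.toFun ef) i j k k' hk
    refine congrArg Fin.val (a₁ := ⟨x.val, lt_of_lt_of_eq x.2 hn⟩) ((emb g.toFun (emb b.toFun i j)).injective ?_)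
    refine h1.symm.trans (Eq.trans ?_ (emb_restr a.toFun g.toFun f.toFun (congrArg Hom.toFun e)
      (emb b.toFun i j) k').symm)
    rw [← h2, ← hx]
    refine Eq.trans (congrArg (emb g'.toFun i) ?_) (emb_restr a.toFun g'.toFun f'.toFun
      (congrArg Hom.toFun e') i _)
    exact emb_restr (restr a.toFun g'.toFun f'.toFun (congrArg Hom.toFun e') i)
      (restr g.toFun b.toFun g'.toFun (congrArg Hom.toFun eg) i)
      (restr f.toFun b.toFun f'.toFun (congrArg Hom.toFun ef) i) (congrArg Hom.toFun e'') j k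

theorem isTrivial_triv (c : C) : IsTrivial (triv c) := rfl

theorem eq_triv_of_isTrivial {b : Bq C} (h : IsTrivial b) : b = triv b.root := h

end

/-! ### Change of colours -/

section

variable {C : Type u} {D : Type v}

/-- Change of colours along `e : C → D`. -/
def map (e : C → D) (b : Bq C) : Bq D := ⟨b.n, fun i => e (b.leaf i), e b.root⟩

/-- The operadic functor `Bq(e) : Bq(C) → Bq(D)` of a map of colours. -/
noncomputable def mapFunctor (e : C → D) : OperadicFunctor (Bq C) (Bq D) where
  functor :=
    { obj := map e
      map := fun f => ⟨f.toFun, congrArg e f.root_eq⟩ }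
  idx b := OrderIso.refl _
  idx_cardMap _ _ := rfl
  obj_fib _ _ := rfl
  map_fibMap _ _ _ _ _ _ := HEq.rfl
  isTrivial_obj {b} h := by
    rw [eq_triv_of_isTrivial h]; rfl

end

end Bq

/-! ## The arity functor -/

section arity

variable {O : Type u} [Category.{v} O] [OperadicCategory O]

/-- The arity `Ar(T)`: the inputs of the bouquet are the elements of `|T|`, the colour of the input
`i` is the connected component of the `i`-th fibre of the identity, and the output colour is the
connected component of `T`. -/
def arity (T : O) : Bq (Pi0 O) := ⟨card T, fun i => π₀ (fib (𝟙 T) i), π₀ T⟩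

/-- The morphism `Ar(f)`. -/
def arityMap {T S : O} (f : T ⟶ S) : arity T ⟶ arity S :=
  Bq.Hom.mk (b := arity T) (b' := arity S) (cardMap f) (π₀_eq_of_hom f)

theorem arity_fib {T S : O} (f : T ⟶ S) (i : Fin (card S)) :
    arity (fib f i) = Bq.fibre (arityMap f) i := by
  refine Bq.eq_fibre (b := arity T) (b' := arity S) (arityMap f) i (arity (fib f i)) (inc f i)
    (mem_range_inc f i) (fun k => π₀_fib_id_fib f i k) (π₀_fib f i)

variable (O) in
/-- The arity functor `Ar : O → Bq(π₀(O))`. -/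
noncomputable def arityFunctor : OperadicFunctor O (Bq (Pi0 O)) where
  functor :=
    { obj := arity
      map := arityMap
      map_id := fun T => Bq.Hom.ext (funext fun k => cardMap_id T k)
      map_comp := fun f g => Bq.Hom.ext (funext fun k => cardMap_comp f g k) }
  idx T := OrderIso.refl _
  idx_cardMap _ _ := rfl
  obj_fib f i := arity_fib f i
  map_fibMap {T S R} f g h e e' i := by
    have hn := congrArg Bq.n (arity_fib g i)
    refine Bq.hom_heq (arity_fib h i) (arity_fib g i) _ _ (fun k k' hk => ?_)
    have h1 := (emb_unique (inc g i) (Bq.emb (cardMap g) i)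
      (by ext k; rw [mem_range_inc, Bq.mem_range_emb])).2 (cardMap (fibMap f g h e i) k)
      ⟨_, lt_of_lt_of_eq (Fin.isLt _) hn⟩ rfl
    have h2 := (emb_unique (inc h i) (Bq.emb (cardMap h) i)
      (by ext k; rw [mem_range_inc, Bq.mem_range_emb])).2 k k' hk
    have h3 : Bq.emb (cardMap g) i _ = cardMap f (Bq.emb (cardMap h) i k') :=
      Bq.emb_restr (cardMap f) (cardMap g) (cardMap h) (congrArg Bq.Hom.toFun e') i k'
    have h1 := (inc_fibMap f g h e i k).symm.trans h1
    rw [show inc h i k = _ from h2, ← h3] at h1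
    exact congrArg Fin.val ((Bq.emb (cardMap g) i).injective h1).symm
  isTrivial_obj {T} h := by
    refine Bq.ext' (b' := Bq.triv (π₀ T)) h.card_eq (fun k k' _ => ?_) rfl
    exact congrArg π₀ (h.fib_eq (𝟙 T) k)

end arity

/-! ## Operads given by generators and relations -/

namespace Operad

section presented

variable {O : Type u} [Category.{v} O] [OperadicCategory O]

/-- Formal composites of generators `G`, with units. -/
inductive Term (G : O → Type w) : O → Type (max u v w)
  | gen {T : O} (x : G T) : Term G T
  | one (T : O) (h : IsTrivial T) : Term G T
  | μ {T S : O} (f : T ⟶ S) (F : Fin (card S) → O) (hF : ∀ i, F i = fib f i)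
      (a : ∀ i, Term G (F i)) (s : Term G S) : Term G T

/-- The smallest congruence on formal composites which contains `r` and the axioms of an operad. -/
inductive Term.Rel {G : O → Type w} (r : ∀ T : O, Term G T → Term G T → Prop) :
    ∀ {T : O}, Term G T → Term G T → Prop
  | of {T : O} {x y : Term G T} (h : r T x y) : Term.Rel r x y
  | refl {T : O} (x : Term G T) : Term.Rel r x x
  | symm {T : O} {x y : Term G T} (h : Term.Rel r x y) : Term.Rel r y x
  | trans {T : O} {x y z : Term G T} (h : Term.Rel r x y) (h' : Term.Rel r y z) : Term.Rel r x z
  | congr {T S : O} (f : T ⟶ S) (F : Fin (card S) → O) (hF : ∀ i, F i = fib f i)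
      {a a' : ∀ i, Term G (F i)} {s s' : Term G S} (ha : ∀ i, Term.Rel r (a i) (a' i))
      (hs : Term.Rel r s s') : Term.Rel r (Term.μ f F hF a s) (Term.μ f F hF a' s')
  | μ_id {T : O} (x : Term G T) : Term.Rel r
      (Term.μ (𝟙 T) (fib (𝟙 T)) (fun _ => rfl) (fun i => Term.one _ (isTrivial_fib_id T i)) x) x
  | μ_one {T S : O} (hS : IsTrivial S) (f : T ⟶ S) (x : Term G T) : Term.Rel r
      (Term.μ f (fun _ => T) (fun i => (hS.fib_eq f i).symm) (fun _ => x) (Term.one S hS)) x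
  | μ_assoc {T S R : O} (f : T ⟶ S) (g : S ⟶ R) (h : T ⟶ R) (e : f ≫ g = h)
      (a : ∀ j, Term G (fib f j)) (b : ∀ i, Term G (fib g i)) (c : Term G R) : Term.Rel r
      (Term.μ h (fib h) (fun _ => rfl)
        (fun i => Term.μ (fibMap f g h e i) (fun j => fib f (inc g i j))
          (fun j => (fib_fibMap f g h e i j).symm) (fun j => a (inc g i j)) (b i)) c)
      (Term.μ f (fib f) (fun _ => rfl) a (Term.μ g (fib g) (fun _ => rfl) b c))

/-- The congruence as a setoid. -/
def Term.setoid {G : O → Type w} (r : ∀ T : O, Term G T → Term G T → Prop) (T : O) :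
    Setoid (Term G T) :=
  ⟨Term.Rel r, Term.Rel.refl, Term.Rel.symm, Term.Rel.trans⟩

/-- The class of a formal composite. -/
def Term.cls {G : O → Type w} (r : ∀ T : O, Term G T → Term G T → Prop) {T : O}
    (x : Term G T) : Quotient (Term.setoid r T) :=
  Quotient.mk _ x

theorem Term.cls_μ_out {G : O → Type w} (r : ∀ T : O, Term G T → Term G T → Prop) {T S : O}
    (f : T ⟶ S) (F : Fin (card S) → O) (hF : ∀ i, F i = fib f i) (a : ∀ i, Term G (F i))
    (s : Term G S) :
    Term.cls r (Term.μ f F hF (fun i => (Term.cls r (a i)).out) (Term.cls r s).out) =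
      Term.cls r (Term.μ f F hF a s) :=
  Quotient.sound (Term.Rel.congr f F hF (fun i => Quotient.mk_out (s := Term.setoid r _) (a i))
    (Quotient.mk_out (s := Term.setoid r _) s))

/-- The operad generated by `G` subject to the relations `r`. -/
noncomputable def presented (G : O → Type w) (r : ∀ T : O, Term G T → Term G T → Prop) :
    Operad.{u, v, max u v w} O where
  obj T := Quotient (Term.setoid r T)
  one T h := Term.cls r (Term.one T h)
  μ f F hF a s := Term.cls r (Term.μ f F hF (fun i => (a i).out) s.out)
  μ_id x := by
    induction x using Quotient.inductionOn with
    | h x =>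
      exact (Term.cls_μ_out r _ _ _ (fun i => Term.one _ _) x).trans
        (Quotient.sound (Term.Rel.μ_id x))
  μ_one hS f x := by
    induction x using Quotient.inductionOn with
    | h x =>
      exact (Term.cls_μ_out r _ _ _ (fun i => x) (Term.one _ hS)).trans
        (Quotient.sound (Term.Rel.μ_one hS f x))
  μ_assoc f g h e a b c := by
    have h1 := Quotient.sound (s := Term.setoid r _) (Term.Rel.μ_assoc (r := r) f g h e
      (fun j => (a j).out) (fun j => (b j).out) c.out)
    refine Eq.trans (Quotient.sound (s := Term.setoid r _) ?_)
      (h1.trans (Quotient.sound (s := Term.setoid r _) ?_))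
    · exact Term.Rel.congr h _ _ (fun i => Quotient.mk_out (s := Term.setoid r _) _)
        (Term.Rel.refl _)
    · exact Term.Rel.congr f _ _ (fun i => Term.Rel.refl _)
        (Term.Rel.symm (Quotient.mk_out (s := Term.setoid r _) _))

/-- The element of the presented operad given by a generator. -/
def presentedGen {G : O → Type w} (r : ∀ T : O, Term G T → Term G T → Prop) {T : O} (x : G T) :
    (presented G r).obj T :=
  Term.cls r (Term.gen x)

theorem presented_μ_cls {G : O → Type w} (r : ∀ T : O, Term G T → Term G T → Prop) {T S : O}
    (f : T ⟶ S) (F : Fin (card S) → O) (hF : ∀ i, F i = fib f i) (a : ∀ i, Term G (F i))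
    (s : Term G S) :
    (presented G r).μ f F hF (fun i => Term.cls r (a i)) (Term.cls r s) =
      Term.cls r (Term.μ f F hF a s) :=
  Term.cls_μ_out r f F hF a s

/-- The value of a formal composite in an operad. -/
def Term.eval {G : O → Type w} (Q : Operad.{u, v, w'} O) (φ : ∀ T : O, G T → Q.obj T) :
    ∀ {T : O}, Term G T → Q.obj T
  | _, .gen x => φ _ x
  | _, .one T h => Q.one T h
  | _, .μ f F hF a s => Q.μ f F hF (fun i => (a i).eval Q φ) (s.eval Q φ)

theorem Term.eval_eq {G : O → Type w} {r : ∀ T : O, Term G T → Term G T → Prop}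
    (Q : Operad.{u, v, w'} O) (φ : ∀ T : O, G T → Q.obj T)
    (hr : ∀ (T : O) (x y : Term G T), r T x y → x.eval Q φ = y.eval Q φ) {T : O}
    {x y : Term G T} (h : Term.Rel r x y) : x.eval Q φ = y.eval Q φ := by
  induction h with
  | of h => exact hr _ _ _ h
  | refl => rfl
  | symm _ ih => exact ih.symm
  | trans _ _ ih ih' => exact ih.trans ih'
  | congr f F hF _ _ ih ih' => simp only [Term.eval, ih, ih']
  | μ_id x => exact Q.μ_id _
  | μ_one hS f x => exact Q.μ_one hS f _
  | μ_assoc f g h e a b c =>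
    exact Q.μ_assoc f g h e (fun j => (a j).eval Q φ)
      (fun i => (b i).eval Q φ) (c.eval Q φ)

/-- The universal property of the presented operad. -/
theorem presented_universal {G : O → Type w} {r : ∀ T : O, Term G T → Term G T → Prop}
    (Q : Operad.{u, v, max u v w} O) (φ : ∀ T : O, G T → Q.obj T)
    (hr : ∀ (T : O) (x y : Term G T), r T x y → x.eval Q φ = y.eval Q φ) :
    ∃! ψ : presented G r ⟶ Q, ∀ (T : O) (x : G T), ψ.app T (presentedGen r x) = φ T x := by
  refine ⟨⟨fun T => Quotient.lift (fun x => x.eval Q φ) (fun x y h => Term.eval_eq Q φ hr h),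
    fun _ _ => rfl, fun f F hF a s => ?_⟩, fun T x => rfl, fun ψ hψ => ?_⟩
  · obtain ⟨a, rfl⟩ : ∃ a' : ∀ i, Term G (F i), a = fun i => Term.cls r (a' i) :=
      ⟨fun i => (a i).out, funext fun i => (Quotient.out_eq _).symm⟩
    obtain ⟨s, rfl⟩ := Quotient.exists_rep s
    exact congrArg _ (presented_μ_cls r f F hF a s)
  · have key : ∀ {T : O} (x : Term G T), ψ.app T (Term.cls r x) = x.eval Q φ := by
      intro T x
      induction x with
      | gen x => exact hψ _ x
      | one T h => exact ψ.app_one T h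
      | μ f F hF a s ih ih' =>
        rw [← presented_μ_cls]
        refine (ψ.app_μ f F hF (fun i => Term.cls r (a i)) (Term.cls r s)).trans ?_
        exact Q.μ_congr rfl _ _ (fun i => heq_of_eq (ih i)) ih'
    apply Hom.ext
    funext T x
    obtain ⟨x, rfl⟩ := Quotient.exists_rep x
    exact key x

end presented

/-! ### Left Kan extension of operads -/

section lan

variable {O : Type u} [Category.{v} O] [OperadicCategory O]
  {O' : Type u'} [Category.{v'} O'] [OperadicCategory O']

/-- The generators of `Φ_! P`: an element of `P(T)` in degree `Φ(T)`. -/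
inductive LanGen (Φ : OperadicFunctor O O') (P : Operad.{u, v, w} O) : O' → Type (max u w)
  | mk {T : O} (p : P.obj T) : LanGen Φ P (Φ.functor.obj T)

/-- The relations of `Φ_! P`: units and structure maps of `P` are preserved. -/
inductive LanRel (Φ : OperadicFunctor O O') (P : Operad.{u, v, w} O) :
    ∀ T : O', Term (LanGen Φ P) T → Term (LanGen Φ P) T → Prop
  | one (T : O) (h : IsTrivial T) : LanRel Φ P (Φ.functor.obj T)
      (Term.gen (LanGen.mk (P.one T h))) (Term.one _ (Φ.isTrivial_obj h))
  | μ {T S : O} (f : T ⟶ S) (F : Fin (card S) → O) (hF : ∀ i, F i = fib f i)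
      (a : ∀ i, P.obj (F i)) (s : P.obj S) : LanRel Φ P (Φ.functor.obj T)
      (Term.gen (LanGen.mk (P.μ f F hF a s)))
      (Term.μ (Φ.functor.map f) (fun i => Φ.functor.obj (F ((Φ.idx S).symm i)))
        (Φ.obj_fib' f F hF) (fun i => Term.gen (LanGen.mk (a ((Φ.idx S).symm i))))
        (Term.gen (LanGen.mk s)))

/-- The left Kan extension `Φ_! P` of an operad along an operadic functor, that is, the value at `P`
of the left adjoint of the restriction `Φ^*`. -/
noncomputable def lan (Φ : OperadicFunctor O O') (P : Operad.{u, v, w} O) :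
    Operad.{u', v', max u' v' u w} O' :=
  presented (LanGen Φ P) (LanRel Φ P)

/-- The unit `P → Φ^* Φ_! P`. -/
noncomputable def lanUnit (Φ : OperadicFunctor O O') (P : Operad.{u, v, w} O) :
    Hom P (Φ.restrict (lan Φ P)) where
  app _ p := presentedGen (LanRel Φ P) (LanGen.mk p)
  app_one T h := Quotient.sound (Term.Rel.of (LanRel.one T h))
  app_μ f F hF a s := (Quotient.sound (Term.Rel.of (LanRel.μ f F hF a s))).trans
    (presented_μ_cls _ _ _ _ _ _).symm

/-- `Φ_!` is left adjoint to `Φ^*`: every morphism `P → Φ^* Q` factors uniquely through the unit. -/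
theorem lan_universal (Φ : OperadicFunctor O O') (P : Operad.{u, v, w} O)
    (Q : Operad.{u', v', max u' v' u w} O') (φ : Hom P (Φ.restrict Q)) :
    ∃! ψ : lan Φ P ⟶ Q, ∀ (T : O) (p : P.obj T),
      ψ.app (Φ.functor.obj T) ((lanUnit Φ P).app T p) = φ.app T p := by
  obtain ⟨ψ, hψ, hu⟩ := presented_universal (r := LanRel Φ P) Q
    (fun _ x => LanGen.rec (motive := fun T _ => Q.obj T) (fun p => φ.app _ p) x) (by
      intro _ x y h
      cases h with
      | one T h => exact φ.app_one T h
      | μ f F hF a s => exact φ.app_μ f F hF a s)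
  refine ⟨ψ, fun _ p => hψ _ (LanGen.mk p), fun ψ' h => hu ψ' fun _ x => ?_⟩
  cases x with
  | mk p => exact h _ p

/-- The reflection `𝔸(O) = Ar_!(𝟏_O)` of an operadic category: the left Kan extension of the terminal
operad along the arity functor, a symmetric operad coloured by `π₀(O)`. -/
noncomputable def reflection (O : Type u) [Category.{v} O] [OperadicCategory O] :
    Operad.{u, 0, u} (Bq (Pi0 O)) :=
  lan (arityFunctor O) (terminal.{u, v, u} O)

/-- The element `[T]` of `𝔸(O)` given by an object `T`. -/
noncomputable def reflectionClass {O : Type u} [Category.{v} O] [OperadicCategory O] (T : O) :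
    (reflection O).obj ((arityFunctor O).functor.obj T) :=
  (lanUnit (arityFunctor O) (terminal.{u, v, u} O)).app T PUnit.unit

end lan

end Operad

/-! ## The operadic Grothendieck construction -/

/-- The objects of the operadic Grothendieck construction `∫_O P`: elements `t ∈ P(T)`. -/
structure Groth {O : Type u} [Category.{v} O] [OperadicCategory O] (P : Operad.{u, v, w} O) where
  base : O
  el : P.obj base

namespace Groth

section

variable {O : Type u} [Category.{v} O] [OperadicCategory O] {P : Operad.{u, v, w} O}

/-- A morphism `t ⟶ s` of `∫_O P`: a morphism `f : T ⟶ S` and elements `ε_i ∈ P(f⁻¹(i))` such that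
`μ_f(ε, s) = t`. -/
structure Hom (X Y : Groth P) where
  f : X.base ⟶ Y.base
  ε : ∀ i, P.obj (fib f i)
  eq : P.μ f (fib f) (fun _ => rfl) ε Y.el = X.el

theorem Hom.ext' {X Y : Groth P} (φ ψ : Hom X Y) (h : φ.f = ψ.f)
    (hε : ∀ i, HEq (φ.ε i) (ψ.ε i)) : φ = ψ := by
  obtain ⟨f, ε, e⟩ := φ
  obtain ⟨f', ε', e'⟩ := ψ
  dsimp only at h hε
  subst h
  obtain rfl : ε = ε' := funext fun i => eq_of_heq (hε i)
  rfl

theorem ε_heq {X Y : Groth P} (φ : Hom X Y) {i j : Fin (card Y.base)} (h : i = j) :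
    HEq (φ.ε i) (φ.ε j) := by
  subst h; rfl

instance : Category (Groth P) where
  Hom := Hom
  id X := ⟨𝟙 _, fun i => P.one _ (isTrivial_fib_id X.base i), P.μ_id _⟩
  comp {X Y Z} φ ψ := ⟨φ.f ≫ ψ.f, fun i => P.μ (fibMap φ.f ψ.f (φ.f ≫ ψ.f) rfl i)
    (fun j => fib φ.f (inc ψ.f i j)) (fun j => (fib_fibMap φ.f ψ.f (φ.f ≫ ψ.f) rfl i j).symm)
    (fun j => φ.ε (inc ψ.f i j)) (ψ.ε i),
    (P.μ_assoc φ.f ψ.f (φ.f ≫ ψ.f) rfl φ.ε ψ.ε Z.el).trans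
      ((P.μ_congr rfl _ _ (fun _ => HEq.rfl) ψ.eq).trans φ.eq)⟩
  id_comp {X Y} φ := by
    refine Hom.ext' _ _ (Category.id_comp _) (fun i => ?_)
    have H : ∀ (h : X.base ⟶ Y.base) (e : 𝟙 X.base ≫ φ.f = h),
        HEq (P.μ (fibMap (𝟙 X.base) φ.f h e i)
          (fun j => fib (𝟙 X.base) (inc φ.f i j))
          (fun j => (fib_fibMap (𝟙 X.base) φ.f h e i j).symm)
          (fun j => P.one _ (isTrivial_fib_id X.base (inc φ.f i j))) (φ.ε i)) (φ.ε i) := by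
      intro h e
      obtain rfl : φ.f = h := (Category.id_comp _).symm.trans e
      refine heq_of_eq (Eq.trans (P.μ_congr (fibMap_id φ.f i) _ _ (fun j => ?_) rfl)
        (P.μ_id (φ.ε i)))
      apply P.one_heq
      have := fib_fibMap (𝟙 X.base) φ.f φ.f e i j
      rw [← this, fibMap_id]
    exact H _ rfl
  comp_id {X Y} φ := by
    refine Hom.ext' _ _ (Category.comp_id _) (fun i => ?_)
    have H : ∀ (h : X.base ⟶ Y.base) (e : φ.f ≫ 𝟙 Y.base = h),
        HEq (P.μ (fibMap φ.f (𝟙 Y.base) h e i)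
          (fun j => fib φ.f (inc (𝟙 Y.base) i j))
          (fun j => (fib_fibMap φ.f (𝟙 Y.base) h e i j).symm)
          (fun j => φ.ε (inc (𝟙 Y.base) i j)) (P.one _ (isTrivial_fib_id Y.base i))) (φ.ε i) := by
      intro h e
      obtain rfl : φ.f = h := (Category.comp_id _).symm.trans e
      refine heq_of_eq (Eq.trans (P.μ_congr rfl _ _ (fun j => ?_) rfl)
        (P.μ_one (isTrivial_fib_id Y.base i) (fibMap φ.f (𝟙 Y.base) φ.f e i) (φ.ε i)))
      exact ε_heq φ (inc_id _ _ _)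
    exact H _ rfl
  assoc {X Y Z W} φ ψ χ := by
    refine Hom.ext' _ _ (Category.assoc _ _ _) (fun i => ?_)
    have key : ∀ (h : X.base ⟶ Z.base) (e : φ.f ≫ ψ.f = h) (h' : Y.base ⟶ W.base)
        (e' : ψ.f ≫ χ.f = h') (k k' : X.base ⟶ W.base) (e₁ : h ≫ χ.f = k) (e₂ : φ.f ≫ h' = k'),
        HEq
          (P.μ (fibMap h χ.f k e₁ i) (fun j => fib h (inc χ.f i j))
            (fun j => (fib_fibMap h χ.f k e₁ i j).symm)
            (fun j => P.μ (fibMap φ.f ψ.f h e (inc χ.f i j))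
              (fun l => fib φ.f (inc ψ.f (inc χ.f i j) l))
              (fun l => (fib_fibMap φ.f ψ.f h e (inc χ.f i j) l).symm)
              (fun l => φ.ε (inc ψ.f (inc χ.f i j) l)) (ψ.ε (inc χ.f i j))) (χ.ε i))
          (P.μ (fibMap φ.f h' k' e₂ i) (fun j => fib φ.f (inc h' i j))
            (fun j => (fib_fibMap φ.f h' k' e₂ i j).symm)
            (fun j => φ.ε (inc h' i j))
            (P.μ (fibMap ψ.f χ.f h' e' i) (fun j => fib ψ.f (inc χ.f i j))
              (fun j => (fib_fibMap ψ.f χ.f h' e' i j).symm)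
              (fun j => ψ.ε (inc χ.f i j)) (χ.ε i))) := by
      intro h e h' e' k k' e₁ e₂
      obtain rfl : k = k' := by rw [← e₁, ← e₂, ← e, ← e', Category.assoc]
      have e₃ : fibMap φ.f h' k e₂ i ≫ fibMap ψ.f χ.f h' e' i = fibMap h χ.f k e₁ i := by
        subst e
        exact (fibMap_comp φ.f ψ.f k h' χ.f e₂ e' e₁ i).symm
      have hφ : ∀ j, fib φ.f (inc h' i j) = fib (fibMap φ.f h' k e₂ i) j := fun j =>
        (fib_fibMap φ.f h' k e₂ i j).symm
      have hψ : ∀ j, fib ψ.f (inc χ.f i j) = fib (fibMap ψ.f χ.f h' e' i) j := fun j =>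
        (fib_fibMap ψ.f χ.f h' e' i j).symm
      have A := P.μ_assoc (fibMap φ.f h' k e₂ i) (fibMap ψ.f χ.f h' e' i) (fibMap h χ.f k e₁ i) e₃
        (fun j => cast (congrArg P.obj (hφ j)) (φ.ε (inc h' i j)))
        (fun j => cast (congrArg P.obj (hψ j)) (ψ.ε (inc χ.f i j))) (χ.ε i)
      refine heq_of_eq (Eq.trans (P.μ_congr rfl _ _ (fun j => ?_) rfl) (A.trans
        (P.μ_congr rfl _ _ (fun j => cast_heq _ _)
          (P.μ_congr rfl _ _ (fun j => cast_heq _ _) rfl))))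
      refine P.μ_heq (fib_fibMap h χ.f k e₁ i j).symm (hψ j) ?_ _ _ (fun l l' hl => ?_)
        (cast_heq _ _).symm
      · exact (fibMap_fibMap φ.f ψ.f h χ.f h' k e e' e₁ e₂ i e₃ j).symm
      · refine HEq.trans (ε_heq φ ?_) (cast_heq _ _).symm
        exact (inc_inc ψ.f χ.f h' e' i j l' l hl.symm).symm
    exact key _ rfl _ rfl _ _ rfl rfl

theorem ext_heq {X Y : Groth P} (h : X.base = Y.base) (h' : HEq X.el Y.el) : X = Y := by
  obtain ⟨T, t⟩ := X
  obtain ⟨S, s⟩ := Y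
  dsimp only at h h'
  subst h; cases h'; rfl

theorem hom_heq {X Y X' Y' : Groth P} (hX : X = X') (hY : Y = Y') (φ : X ⟶ Y) (φ' : X' ⟶ Y')
    (hf : HEq φ.f φ'.f) (hε : ∀ (i : Fin (card Y.base)) (i' : Fin (card Y'.base)),
      i.val = i'.val → HEq (φ.ε i) (φ'.ε i')) : HEq φ φ' := by
  subst hX hY
  exact heq_of_eq (Hom.ext' _ _ (eq_of_heq hf) (fun i => hε i i rfl))

variable (P) in
/-- The projection `∫_O P → O`. -/
def proj : Groth P ⥤ O where
  obj X := X.base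
  map φ := φ.f

theorem ε_of_isTrivial {X : Groth P} {S : O} (hS : IsTrivial S)
    (φ : X ⟶ (⟨S, P.one S hS⟩ : Groth P)) (i : Fin (card S)) : HEq (φ.ε i) X.el := by
  have hsub : Subsingleton (Fin (card S)) := by rw [hS.card_eq]; infer_instance
  have h := hS.fib_eq φ.f
  have h1 := P.μ_one hS φ.f (cast (congrArg P.obj (h i)) (φ.ε i))
  have h2 : P.μ φ.f (fib φ.f) (fun _ => rfl) φ.ε (P.one S hS) =
      P.μ φ.f (fun _ => X.base) (fun i => (h i).symm)
        (fun _ => cast (congrArg P.obj (h i)) (φ.ε i)) (P.one S hS) :=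
    P.μ_congr rfl _ _ (fun j => by
      obtain rfl := Subsingleton.elim i j
      exact (cast_heq _ _).symm) rfl
  have h3 : cast (congrArg P.obj (h i)) (φ.ε i) = X.el := h1.symm.trans (h2.symm.trans φ.eq)
  exact (cast_heq _ _).symm.trans (heq_of_eq h3)

/-- The operadic Grothendieck construction is an operadic category: fibres of `(f, ε)` are the
elements `ε_i`, and the chosen local terminal objects are the units of `P`. -/
noncomputable instance : OperadicCategory (Groth P) where
  card X := card X.base
  cardMap φ := cardMap φ.f
  cardMap_id X k := cardMap_id X.base k
  cardMap_comp φ ψ k := cardMap_comp φ.f ψ.f k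
  chosen c := ⟨chosen ((proj P).mapConnectedComponents c), P.one _ (isTrivial_chosen _)⟩
  π₀_chosen c := by
    induction c using Quotient.inductionOn with
    | h X =>
      refine (π₀_eq_of_hom (?_ : X ⟶ ⟨chosen (π₀ X.base), P.one _ (isTrivial_chosen _)⟩)).symm
      exact ⟨toChosen X.base, fun i => cast (congrArg P.obj (fib_chosen _ i).symm) X.el,
        (P.μ_congr rfl _ _ (fun i => cast_heq _ _) rfl).trans
          (P.μ_one (isTrivial_chosen _) (toChosen X.base) X.el)⟩
  toChosen X := ⟨toChosen X.base, fun i => cast (congrArg P.obj (fib_chosen _ i).symm) X.el,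
    (P.μ_congr rfl _ _ (fun i => cast_heq _ _) rfl).trans
      (P.μ_one (isTrivial_chosen _) (toChosen X.base) X.el)⟩
  hom_chosen_ext φ ψ := Hom.ext' _ _ (hom_chosen_ext _ _) (fun i =>
    (ε_of_isTrivial (isTrivial_chosen _) φ i).trans
      (ε_of_isTrivial (isTrivial_chosen _) ψ i).symm)
  fib φ i := ⟨fib φ.f i, φ.ε i⟩
  inc φ i := inc φ.f i
  mem_range_inc φ i k := mem_range_inc φ.f i k
  card_chosen c := card_chosen _
  fib_id X i := by
    refine ⟨π₀ ⟨fib (𝟙 X.base) i, P.one _ (isTrivial_fib_id X.base i)⟩, ext_heq ?_ ?_⟩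
    · exact isTrivial_fib_id X.base i
    · exact P.one_heq (isTrivial_fib_id X.base i) _ _
  fibMap φ ψ χ e i := ⟨fibMap φ.f ψ.f χ.f (congrArg Hom.f e) i,
    fun j => cast (congrArg P.obj (fib_fibMap φ.f ψ.f χ.f (congrArg Hom.f e) i j).symm)
      (φ.ε (inc ψ.f i j)), by
    subst e
    exact P.μ_congr rfl _ _ (fun j => cast_heq _ _) rfl⟩
  inc_fibMap φ ψ χ e i k := inc_fibMap φ.f ψ.f χ.f (congrArg Hom.f e) i k
  fibMap_id {X Y} ψ i := by
    refine Hom.ext' _ _ (fibMap_id ψ.f i) (fun j => (cast_heq _ _).trans ?_)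
    refine P.one_heq ?_ _ _
    have := fib_fibMap (𝟙 X.base) ψ.f ψ.f (Category.id_comp _) i j
    rw [fibMap_id] at this
    exact this.symm
  fibMap_comp φ ψ h₁ h₂ h₃ e₁ e₂ e₃ i := by
    refine Hom.ext' _ _ (fibMap_comp φ.f ψ.f h₁.f h₂.f h₃.f (congrArg Hom.f e₁)
      (congrArg Hom.f e₂) (congrArg Hom.f e₃) i) (fun j => (cast_heq _ _).trans ?_)
    have E₁ : φ.f ≫ h₂.f = h₁.f := congrArg Hom.f e₁
    have E₂ : ψ.f ≫ h₃.f = h₂.f := congrArg Hom.f e₂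
    have E₃ : (φ.f ≫ ψ.f) ≫ h₃.f = h₁.f := congrArg Hom.f e₃
    have hc := fibMap_comp φ.f ψ.f h₁.f h₂.f h₃.f E₁ E₂ E₃ i
    refine P.μ_heq ?_ (fib_fibMap ψ.f h₃.f h₂.f E₂ i j).symm ?_ _ _ (fun l l' hl => ?_)
      (cast_heq _ _).symm
    · exact (fib_fibMap (φ.f ≫ ψ.f) h₃.f h₁.f E₃ i j).symm.trans
        (fib_heq rfl rfl (heq_of_eq hc) rfl)
    · refine (fibMap_fibMap φ.f ψ.f (φ.f ≫ ψ.f) h₃.f h₂.f h₁.f rfl E₂ E₃ E₁ i hc.symm j).symm.trans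
        (fibMap_heq rfl rfl rfl HEq.rfl HEq.rfl _ _ rfl)
    · refine HEq.trans (ε_heq φ ?_) (cast_heq _ _).symm
      exact (inc_inc ψ.f h₃.f h₂.f E₂ i j l' l hl.symm).symm
  fib_chosen φ i := ext_heq (fib_chosen φ.f i) (ε_of_isTrivial (isTrivial_chosen _) φ i)
  fibMap_chosen φ ψ χ e i := by
    refine hom_heq (ext_heq (fib_chosen χ.f i) (ε_of_isTrivial (isTrivial_chosen _) χ i))
      (ext_heq (fib_chosen ψ.f i) (ε_of_isTrivial (isTrivial_chosen _) ψ i)) _ _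
      (fibMap_chosen φ.f ψ.f χ.f (congrArg Hom.f e) i) (fun j j' hj => ?_)
    refine (cast_heq _ _).trans (ε_heq φ (Fin.ext ?_))
    exact (inc_val_of_isTrivial (isTrivial_chosen _) ψ.f i j).trans hj
  fib_fibMap φ ψ χ e i j :=
    ext_heq (fib_fibMap φ.f ψ.f χ.f (congrArg Hom.f e) i j) (cast_heq _ _)
  fibMap_fibMap a g f b g' f' e eg ef e' i e'' j := by
    refine hom_heq
      (ext_heq (fib_fibMap f.f b.f f'.f (congrArg Hom.f ef) i j) (cast_heq _ _))
      (ext_heq (fib_fibMap g.f b.f g'.f (congrArg Hom.f eg) i j) (cast_heq _ _)) _ _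
      (fibMap_fibMap a.f g.f f.f b.f g'.f f'.f (congrArg Hom.f e) (congrArg Hom.f eg)
        (congrArg Hom.f ef) (congrArg Hom.f e') i (congrArg Hom.f e'') j) (fun k k' hk => ?_)
    refine (cast_heq _ _).trans ((cast_heq _ _).trans (HEq.trans (ε_heq a ?_) (cast_heq _ _).symm))
    exact inc_inc g.f b.f g'.f (congrArg Hom.f eg) i j k k' hk

end

end Groth

/-! ## The wreath product of operadic categories -/

/-- The order isomorphism of the ordinal sum `n_1 ⊕ ⋯ ⊕ n_k` with the lexicographically ordered
disjoint union. -/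
noncomputable def sumIdx {k : ℕ} (n : Fin k → ℕ) :
    Fin (∑ i, n i) ≃o _root_.Lex (Σ i : Fin k, Fin (n i)) :=
  Fintype.orderIsoFinOfCardEq _ (by rw [Fintype.card_lex, Fintype.card_sigma]; simp)

/-- The element of the ordinal sum which is the element `p.2` of the summand `p.1`. -/
noncomputable def sumMk {k : ℕ} {n : Fin k → ℕ} (p : Σ i : Fin k, Fin (n i)) : Fin (∑ i, n i) :=
  (sumIdx n).symm (toLex p)

/-- The summand and the position in this summand of an element of the ordinal sum. -/
noncomputable def sumOut {k : ℕ} {n : Fin k → ℕ} (x : Fin (∑ i, n i)) : Σ i : Fin k, Fin (n i) :=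
  ofLex (sumIdx n x)

@[simp] theorem sumOut_sumMk {k : ℕ} {n : Fin k → ℕ} (p : Σ i : Fin k, Fin (n i)) :
    sumOut (sumMk p) = p := by
  simp [sumOut, sumMk]

@[simp] theorem sumMk_sumOut {k : ℕ} {n : Fin k → ℕ} (x : Fin (∑ i, n i)) :
    sumMk (sumOut x) = x := by
  simp [sumOut, sumMk]

theorem sumMk_lt {k : ℕ} {n : Fin k → ℕ} {p q : Σ i : Fin k, Fin (n i)} :
    sumMk p < sumMk q ↔ p.1 < q.1 ∨ p.1 = q.1 ∧ p.2.val < q.2.val := by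
  unfold sumMk
  rw [OrderIso.lt_iff_lt, Sigma.Lex.lt_def]
  obtain ⟨i, a⟩ := p
  obtain ⟨j, b⟩ := q
  refine or_congr Iff.rfl ⟨?_, ?_⟩
  · rintro ⟨h, h'⟩
    obtain rfl : i = j := h
    exact ⟨rfl, h'⟩
  · rintro ⟨h, h'⟩
    obtain rfl : i = j := h
    exact ⟨rfl, h'⟩

/-- An object of the wreath product `A ≀ B`: a symbol `(x; y_1, …, y_n)` with `x ∈ A`, `n = |x|`, and
`y_1, …, y_n ∈ B` in one connected component `d` of `B`. The component is determined by the `y_i`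
unless `n = 0`; it is part of the data, so that also the symbols `(x; )` with `|x| = 0` lie in a
well-defined connected component of `A ≀ B`. -/
structure Wreath (A : Type u) [Category.{v} A] [OperadicCategory A]
    (B : Type u') [Category.{v'} B] [OperadicCategory B] where
  fst : A
  comp : Pi0 B
  snd : Fin (card fst) → B
  π₀_snd : ∀ i, π₀ (snd i) = comp

namespace Wreath

section

variable {A : Type u} [Category.{v} A] [OperadicCategory A]
  {B : Type u'} [Category.{v'} B] [OperadicCategory B]

/-- A morphism of the wreath product: `φ : x ⟶ z` and morphisms `φ_{ij} : y_i ⟶ w_j` for `|φ|(i) = j`.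
The condition on the components follows from the rest unless `|x| = 0`. -/
@[ext]
structure Hom (X Y : Wreath A B) where
  φ : X.fst ⟶ Y.fst
  Φ : ∀ (i : Fin (card X.fst)) (j : Fin (card Y.fst)), cardMap φ i = j → (X.snd i ⟶ Y.snd j)
  comp_eq : X.comp = Y.comp

theorem Hom.ext' {X Y : Wreath A B} {α β : Hom X Y} (h : α.φ = β.φ)
    (hΦ : ∀ i j (hα : cardMap α.φ i = j) (hβ : cardMap β.φ i = j), α.Φ i j hα = β.Φ i j hβ) :
    α = β := by
  obtain ⟨φ, Φ, e⟩ := α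
  obtain ⟨φ', Φ', e'⟩ := β
  dsimp only at h hΦ
  subst h
  obtain rfl : Φ = Φ' := by
    funext i j hij
    exact hΦ i j hij hij
  rfl

/-- The component `φ_{ij}` of an identity. -/
def idΦ (X : Wreath A B) (i j : Fin (card X.fst)) (h : i = j) : X.snd i ⟶ X.snd j :=
  eqToHom (congrArg X.snd h)

theorem Φ_eqToHom {X Y : Wreath A B} (α : Hom X Y) {i i' : Fin (card X.fst)}
    {j j' : Fin (card Y.fst)} (hi : i = i') (hj : j = j') (h : cardMap α.φ i = j)
    (h' : cardMap α.φ i' = j') :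
    HEq (α.Φ i j h) (α.Φ i' j' h') := by
  subst hi hj; rfl

instance : Category (Wreath A B) where
  Hom := Hom
  id X := ⟨𝟙 _, fun i j h => idΦ X i j ((cardMap_id _ _).symm.trans h), rfl⟩
  comp α β := ⟨α.φ ≫ β.φ, fun i k h => α.Φ i (cardMap α.φ i) rfl ≫
    β.Φ (cardMap α.φ i) k ((cardMap_comp _ _ _).symm.trans h), α.comp_eq.trans β.comp_eq⟩
  id_comp {X Y} α := by
    refine Hom.ext' (Category.id_comp _) (fun i j h h' => ?_)
    have : ∀ (i' : Fin (card X.fst)) (hi : i = i') (h'' : cardMap α.φ i' = j),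
        idΦ X i i' hi ≫ α.Φ i' j h'' = α.Φ i j h' := by
      rintro i' rfl h''; simp [idΦ]
    exact this _ (cardMap_id _ _).symm _
  comp_id {X Y} α := by
    refine Hom.ext' (Category.comp_id _) (fun i j h h' => ?_)
    subst h'
    exact Category.comp_id _
  assoc {X Y Z W} α β γ := by
    refine Hom.ext' (Category.assoc _ _ _) (fun i j h h' => ?_)
    refine (Category.assoc _ _ _).trans ?_
    have : ∀ (k k' : Fin (card Z.fst)) (hk : cardMap β.φ (cardMap α.φ i) = k) (hk' : k = k')
        (h₁ : cardMap γ.φ k = j) (h₂ : cardMap γ.φ k' = j) (hk'' : cardMap β.φ (cardMap α.φ i) = k'),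
        β.Φ (cardMap α.φ i) k hk ≫ γ.Φ k j h₁ = β.Φ (cardMap α.φ i) k' hk'' ≫ γ.Φ k' j h₂ := by
      rintro k _ _ rfl _ _ _; rfl
    exact congrArg (α.Φ i _ rfl ≫ ·) (this _ _ _ (cardMap_comp _ _ _) _ _ _)

theorem comp_Φ {X Y Z : Wreath A B} (α : X ⟶ Y) (β : Y ⟶ Z) (γ : X ⟶ Z) (e : α ≫ β = γ)
    (i : Fin (card X.fst)) (j : Fin (card Y.fst)) (k : Fin (card Z.fst)) (hi : cardMap α.φ i = j)
    (hj : cardMap β.φ j = k) (hk : cardMap γ.φ i = k) :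
    α.Φ i j hi ≫ β.Φ j k hj = γ.Φ i k hk := by
  subst e hi; rfl

theorem eq_of {X Y : Wreath A B} (h : X.fst = Y.fst) (hc : X.comp = Y.comp)
    (hs : ∀ (i : Fin (card X.fst)) (j : Fin (card Y.fst)), i.val = j.val → X.snd i = Y.snd j) :
    X = Y := by
  obtain ⟨x, c, y, hy⟩ := X
  obtain ⟨x', c', y', hy'⟩ := Y
  dsimp only at h hc hs
  subst h hc
  obtain rfl : y = y' := funext fun i => hs i i rfl
  rfl

theorem hom_heq {X Y X' Y' : Wreath A B} (hX : X = X') (hY : Y = Y') (α : X ⟶ Y) (β : X' ⟶ Y')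
    (h : HEq α.φ β.φ) (hΦ : ∀ i j (hα : cardMap α.φ i = j) i' j' (hβ : cardMap β.φ i' = j'),
      i.val = i'.val → j.val = j'.val → HEq (α.Φ i j hα) (β.Φ i' j' hβ)) : HEq α β := by
  subst hX hY
  exact heq_of_eq (Hom.ext' (eq_of_heq h) fun i j hα hβ =>
    eq_of_heq (hΦ i j hα i j hβ rfl rfl))

/-- The fibre of `(φ, Φ)` over the element `i` of `|w_t|`:
`(φ⁻¹(t); (φ_{st}⁻¹(i))_{s ∈ |φ|⁻¹(t)})`, in the connected component of the fibres over `i` of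
morphisms to `w_t`. -/
def fibre {X Y : Wreath A B} (α : X ⟶ Y) (p : Σ t : Fin (card Y.fst), Fin (card (Y.snd t))) :
    Wreath A B where
  fst := fib α.φ p.1
  comp := π₀ (fib (𝟙 (Y.snd p.1)) p.2)
  snd s := fib (α.Φ (inc α.φ p.1 s) p.1 (cardMap_inc _ _ _)) p.2
  π₀_snd _ := π₀_fib _ _

theorem fibre_congr {X Y : Wreath A B} (α : X ⟶ Y) {p q : Σ t, Fin (card (Y.snd t))} (h : p = q) :
    fibre α p = fibre α q := by rw [h]

/-- The inclusion of the elements of a fibre. -/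
def fibreFun {X Y : Wreath A B} (α : X ⟶ Y) (p : Σ t : Fin (card Y.fst), Fin (card (Y.snd t)))
    (q : Σ s, Fin (card ((fibre α p).snd s))) : Σ s, Fin (card (X.snd s)) :=
  ⟨inc α.φ p.1 q.1, inc (α.Φ (inc α.φ p.1 q.1) p.1 (cardMap_inc _ _ _)) p.2 q.2⟩

/-- The inclusion of the cardinality of a fibre. -/
noncomputable def fibreInc {X Y : Wreath A B} (α : X ⟶ Y)
    (p : Σ t : Fin (card Y.fst), Fin (card (Y.snd t))) :
    Fin (∑ s, card ((fibre α p).snd s)) ↪o Fin (∑ s, card (X.snd s)) :=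
  OrderEmbedding.ofStrictMono (fun k => sumMk (fibreFun α p (sumOut k))) (fun k l h => by
    obtain ⟨⟨s, a⟩, rfl⟩ : ∃ q, sumMk q = k := ⟨_, sumMk_sumOut k⟩
    obtain ⟨⟨s', a'⟩, rfl⟩ : ∃ q, sumMk q = l := ⟨_, sumMk_sumOut l⟩
    rw [sumMk_lt] at h
    dsimp only
    rw [sumOut_sumMk, sumOut_sumMk, sumMk_lt]
    rcases h with h | ⟨h, h'⟩
    · exact Or.inl ((inc α.φ p.1).strictMono h)
    · obtain rfl : s = s' := h
      exact Or.inr ⟨rfl, (inc (α.Φ _ p.1 (cardMap_inc _ _ s)) p.2).strictMono h'⟩)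

/-- The cardinality of a morphism, on the elements of the summands. -/
def cardFun {X Y : Wreath A B} (α : X ⟶ Y) (q : Σ i : Fin (card X.fst), Fin (card (X.snd i))) :
    Σ i : Fin (card Y.fst), Fin (card (Y.snd i)) :=
  ⟨cardMap α.φ q.1, cardMap (α.Φ q.1 _ rfl) q.2⟩

/-- The cardinality of a morphism. -/
noncomputable def cardHom {X Y : Wreath A B} (α : X ⟶ Y) (k : Fin (∑ i, card (X.snd i))) :
    Fin (∑ i, card (Y.snd i)) :=
  sumMk (cardFun α (sumOut k))

theorem cardHom_sumMk {X Y : Wreath A B} (α : X ⟶ Y) (i : Fin (card X.fst))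
    (j : Fin (card Y.fst)) (h : cardMap α.φ i = j) (a : Fin (card (X.snd i))) :
    cardHom α (sumMk ⟨i, a⟩) =
      sumMk (n := fun j => card (Y.snd j)) ⟨j, cardMap (α.Φ i j h) a⟩ := by
  subst h
  unfold cardHom
  rw [sumOut_sumMk]
  rfl

theorem fibreInc_sumMk {X Y : Wreath A B} (α : X ⟶ Y)
    (p : Σ t : Fin (card Y.fst), Fin (card (Y.snd t)))
    (q : Σ s, Fin (card ((fibre α p).snd s))) :
    fibreInc α p (sumMk q) = sumMk (fibreFun α p q) :=
  congrArg (fun q => sumMk (fibreFun α p q)) (sumOut_sumMk q)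

theorem mem_range_fibreInc {X Y : Wreath A B} (α : X ⟶ Y) (p : Σ t : Fin (card Y.fst), Fin (card (Y.snd t)))
    (k : Fin (∑ s, card (X.snd s))) :
    k ∈ Set.range (fibreInc α p) ↔ cardHom α k = sumMk p := by
  obtain ⟨t, i⟩ := p
  constructor
  · rintro ⟨k, rfl⟩
    obtain ⟨⟨s, a⟩, rfl⟩ : ∃ q, sumMk q = k := ⟨_, sumMk_sumOut k⟩
    refine (congrArg (cardHom α) (fibreInc_sumMk α ⟨t, i⟩ ⟨s, a⟩)).trans ?_
    refine (cardHom_sumMk α _ t (cardMap_inc _ _ _) _).trans ?_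
    exact congrArg (fun i => sumMk (n := fun t => card (Y.snd t)) ⟨t, i⟩)
      (cardMap_inc (α.Φ (inc α.φ t s) t (cardMap_inc _ _ _)) i a)
  · intro h
    obtain ⟨⟨s, a⟩, rfl⟩ : ∃ q, sumMk q = k := ⟨_, sumMk_sumOut k⟩
    rw [cardHom_sumMk α s _ rfl] at h
    have h := congrArg sumOut h
    rw [sumOut_sumMk, sumOut_sumMk] at h
    obtain rfl : cardMap α.φ s = t := congrArg Sigma.fst h
    have h : cardMap (α.Φ s _ rfl) a = i := by simpa using h
    obtain ⟨s', hs⟩ := (mem_range_inc α.φ (cardMap α.φ s) s).2 rfl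
    have : ∀ (r : Fin (card X.fst)) (hr : r = s) (h' : cardMap α.φ r = cardMap α.φ s),
        ∃ b, (⟨r, inc (α.Φ r _ h') i b⟩ : Σ s, Fin (card (X.snd s))) = ⟨s, a⟩ := by
      rintro _ rfl h'
      obtain ⟨b, hb⟩ := (mem_range_inc (α.Φ _ _ h') i a).2 h
      exact ⟨b, by rw [hb]⟩
    obtain ⟨b, hb⟩ := this _ hs (cardMap_inc _ _ _)
    exact ⟨sumMk ⟨s', b⟩, (fibreInc_sumMk α ⟨_, i⟩ ⟨s', b⟩).trans (congrArg sumMk hb)⟩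

/-- The map induced on fibres. -/
def fibreMap {X Y Z : Wreath A B} (α : X ⟶ Y) (β : Y ⟶ Z) (γ : X ⟶ Z) (e : α ≫ β = γ)
    (p : Σ t : Fin (card Z.fst), Fin (card (Z.snd t))) : fibre γ p ⟶ fibre β p :=
  Hom.mk (X := fibre γ p) (Y := fibre β p) (fibMap α.φ β.φ γ.φ (congrArg Hom.φ e) p.1)
    (fun s s' h => fibMap
      (α.Φ (inc γ.φ p.1 s) (inc β.φ p.1 s')
        (by rw [← h]; exact (inc_fibMap α.φ β.φ γ.φ (congrArg Hom.φ e) p.1 s).symm))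
      (β.Φ (inc β.φ p.1 s') p.1 (cardMap_inc _ _ _))
      (γ.Φ (inc γ.φ p.1 s) p.1 (cardMap_inc _ _ _)) (comp_Φ α β γ e _ _ _ _ _ _) p.2) rfl

/-- The local terminal object `(u; v)`. -/
def triv (c : Pi0 A) (d : Pi0 B) : Wreath A B := ⟨chosen c, d, fun _ => chosen d, fun _ => π₀_chosen d⟩

/-- The component in `A` of a connected component. -/
def compFst : Pi0 (Wreath A B) → Pi0 A :=
  Pi0.lift (fun X => π₀ X.fst) (fun {_ _} (α : Hom _ _) => π₀_eq_of_hom α.φ)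

/-- The component in `B` of a connected component. -/
def compSnd : Pi0 (Wreath A B) → Pi0 B :=
  Pi0.lift (fun X => X.comp) (fun {_ _} (α : Hom _ _) => α.comp_eq)

/-- The morphism to the local terminal object. -/
def toTriv (X : Wreath A B) : X ⟶ triv (π₀ X.fst) X.comp :=
  Hom.mk (toChosen X.fst) (fun i _ _ => by
    have := X.π₀_snd i
    exact toChosen (X.snd i) ≫ eqToHom (congrArg chosen this)) rfl

theorem triv_hom_ext {X : Wreath A B} {c : Pi0 A} {d : Pi0 B} (α β : X ⟶ triv c d) : α = β :=
  Hom.ext' (hom_chosen_ext _ _) (fun _ _ _ _ => hom_chosen_ext (O := B) (c := d) _ _)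

theorem fib_idΦ (X : Wreath A B) (i j : Fin (card X.fst)) (h : i = j) (a : Fin (card (X.snd j))) :
    fib (idΦ X i j h) a = fib (𝟙 (X.snd j)) a := by
  subst h; rfl

theorem fibre_id (X : Wreath A B) (p : Σ t : Fin (card X.fst), Fin (card (X.snd t))) :
    fibre (𝟙 X) p = triv (π₀ (fibre (𝟙 X) p).fst) (fibre (𝟙 X) p).comp := by
  refine eq_of (isTrivial_fib_id X.fst p.1) rfl (fun s t _ => ?_)
  refine (fib_idΦ X (inc (𝟙 X.fst) p.1 s) p.1 (inc_id _ _ _) p.2).trans ?_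
  exact isTrivial_fib_id (X.snd p.1) p.2

theorem fibreFun_fibreMap {X Y Z : Wreath A B} (α : X ⟶ Y) (β : Y ⟶ Z) (γ : X ⟶ Z)
    (e : α ≫ β = γ) (p : Σ t : Fin (card Z.fst), Fin (card (Z.snd t)))
    (q : Σ s, Fin (card ((fibre γ p).snd s))) :
    fibreFun β p (cardFun (fibreMap α β γ e p) q) = cardFun α (fibreFun γ p q) := by
  have h := inc_fibMap α.φ β.φ γ.φ (congrArg Hom.φ e) p.1 q.1
  have H : ∀ (j : Fin (card Y.fst)) (h : cardMap α.φ (inc γ.φ p.1 q.1) = j),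
      cardFun α (fibreFun γ p q) = ⟨j, cardMap (α.Φ (inc γ.φ p.1 q.1) j h)
        (inc (γ.Φ (inc γ.φ p.1 q.1) p.1 (cardMap_inc _ _ _)) p.2 q.2)⟩ := by
    rintro _ rfl; rfl
  rw [H _ h.symm]
  exact congrArg (Sigma.mk _) (inc_fibMap (α.Φ (inc γ.φ p.1 q.1) _ h.symm)
    (β.Φ (inc β.φ p.1 _) p.1 (cardMap_inc _ _ _))
    (γ.Φ (inc γ.φ p.1 q.1) p.1 (cardMap_inc _ _ _)) (comp_Φ α β γ e _ _ _ _ _ _) p.2 q.2)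

theorem fibreMap_id {X Y : Wreath A B} (β : X ⟶ Y)
    (p : Σ t : Fin (card Y.fst), Fin (card (Y.snd t))) :
    fibreMap (𝟙 X) β β (Category.id_comp β) p = 𝟙 (fibre β p) := by
  refine Hom.ext' (fibMap_id β.φ p.1) (fun s s' h h' => ?_)
  obtain rfl : s = s' := (cardMap_id _ _).symm.trans h'
  exact fibMap_id (β.Φ (inc β.φ p.1 s) p.1 (cardMap_inc _ _ _)) p.2

theorem fibreMap_comp {X Y Z W : Wreath A B} (α : X ⟶ Y) (β : Y ⟶ Z) (h₁ : X ⟶ W) (h₂ : Y ⟶ W)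
    (h₃ : Z ⟶ W) (e₁ : α ≫ h₂ = h₁) (e₂ : β ≫ h₃ = h₂) (e₃ : (α ≫ β) ≫ h₃ = h₁)
    (p : Σ t : Fin (card W.fst), Fin (card (W.snd t))) :
    fibreMap (α ≫ β) h₃ h₁ e₃ p = fibreMap α h₂ h₁ e₁ p ≫ fibreMap β h₃ h₂ e₂ p := by
  refine Hom.ext' (fibMap_comp α.φ β.φ h₁.φ h₂.φ h₃.φ (congrArg Hom.φ e₁)
    (congrArg Hom.φ e₂) (congrArg Hom.φ e₃) p.1) (fun s s'' h h' => ?_)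
  let s' := cardMap (fibMap α.φ h₂.φ h₁.φ (congrArg Hom.φ e₁) p.1) s
  have a₁ : inc h₂.φ p.1 s' = cardMap α.φ (inc h₁.φ p.1 s) :=
    inc_fibMap α.φ h₂.φ h₁.φ (congrArg Hom.φ e₁) p.1 s
  have b₂ : cardMap (fibMap β.φ h₃.φ h₂.φ (congrArg Hom.φ e₂) p.1) s' = s'' :=
    (cardMap_comp _ _ _).symm.trans h'
  have a₂ : inc h₃.φ p.1 s'' = cardMap β.φ (inc h₂.φ p.1 s') := by
    rw [← b₂]
    exact inc_fibMap β.φ h₃.φ h₂.φ (congrArg Hom.φ e₂) p.1 s'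
  have a₃ : cardMap (α.φ ≫ β.φ) (inc h₁.φ p.1 s) = inc h₃.φ p.1 s'' := by
    rw [cardMap_comp, ← a₁, ← a₂]
  have c₁ := comp_Φ α β (α ≫ β) rfl (inc h₁.φ p.1 s) (inc h₂.φ p.1 s') (inc h₃.φ p.1 s'')
    a₁.symm a₂.symm a₃
  have H : ∀ (f : X.snd (inc h₁.φ p.1 s) ⟶ Z.snd (inc h₃.φ p.1 s''))
      (hf : f = Hom.Φ (α ≫ β) _ _ a₃) (e : f ≫ h₃.Φ _ p.1 (cardMap_inc _ _ _) = _),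
      (fibreMap (α ≫ β) h₃ h₁ e₃ p).Φ s s'' h =
        fibMap f (h₃.Φ _ p.1 (cardMap_inc _ _ _)) (h₁.Φ _ p.1 (cardMap_inc _ _ _)) e p.2 := by
    rintro _ rfl e; rfl
  exact (H _ c₁ (by rw [c₁]; exact comp_Φ _ _ _ e₃ _ _ _ _ _ _)).trans
    (fibMap_comp _ _ _ (h₂.Φ (inc h₂.φ p.1 s') p.1 (cardMap_inc _ _ _)) _
      (comp_Φ _ _ _ e₁ _ _ _ _ _ _) (comp_Φ _ _ _ e₂ _ _ _ _ _ _) _ p.2)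

theorem fibre_triv {X : Wreath A B} {c : Pi0 A} {d : Pi0 B} (α : X ⟶ triv c d)
    (p : Σ t : Fin (card (triv c d : Wreath A B).fst), Fin (card ((triv c d : Wreath A B).snd t))) :
    fibre α p = X := by
  refine eq_of (fib_chosen α.φ p.1) ?_ (fun s s' h => ?_)
  · refine (congrArg π₀ (fib_chosen (𝟙 (chosen d : B)) p.2)).trans ?_
    exact (π₀_chosen d).trans α.comp_eq.symm
  · refine (fib_chosen (O := B) (c := d) (α.Φ (inc α.φ p.1 s) p.1 (cardMap_inc _ _ _)) p.2).trans ?_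
    exact congrArg X.snd (Fin.ext ((inc_val_of_isTrivial (isTrivial_chosen c) α.φ p.1 s).trans h))

theorem fibreMap_triv {X Y : Wreath A B} {c : Pi0 A} {d : Pi0 B} (α : X ⟶ Y) (β : Y ⟶ triv c d)
    (γ : X ⟶ triv c d) (e : α ≫ β = γ)
    (p : Σ t : Fin (card (triv c d : Wreath A B).fst), Fin (card ((triv c d : Wreath A B).snd t))) :
    HEq (fibreMap α β γ e p) α := by
  refine hom_heq (fibre_triv γ p) (fibre_triv β p) _ _
    (fibMap_chosen α.φ β.φ γ.φ (congrArg Hom.φ e) p.1) (fun i j h i' j' h' hi hj => ?_)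
  refine (fibMap_chosen (O := B) (c := d) _ _ _ _ p.2).trans ?_
  refine Φ_eqToHom α ?_ ?_ _ _
  · exact Fin.ext ((inc_val_of_isTrivial (isTrivial_chosen c) γ.φ p.1 i).trans hi)
  · exact Fin.ext ((inc_val_of_isTrivial (isTrivial_chosen c) β.φ p.1 j).trans hj)

theorem fibre_fibreMap {X Y Z : Wreath A B} (α : X ⟶ Y) (β : Y ⟶ Z) (γ : X ⟶ Z)
    (e : α ≫ β = γ) (p : Σ t : Fin (card Z.fst), Fin (card (Z.snd t)))
    (q : Σ s, Fin (card ((fibre β p).snd s))) :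
    fibre (fibreMap α β γ e p) q = fibre α (fibreFun β p q) := by
  refine eq_of (fib_fibMap α.φ β.φ γ.φ (congrArg Hom.φ e) p.1 q.1) ?_ (fun s s' h => ?_)
  · exact π₀_fib_id_fib (β.Φ (inc β.φ p.1 q.1) p.1 (cardMap_inc _ _ _)) p.2 q.2
  · refine (fib_fibMap (α.Φ (inc γ.φ p.1 (inc _ q.1 s)) (inc β.φ p.1 q.1) _) _ _ _ p.2 q.2).trans ?_
    refine fib_heq ?_ rfl (Φ_eqToHom α ?_ rfl _ _) rfl
    · exact congrArg X.snd (inc_inc α.φ β.φ γ.φ (congrArg Hom.φ e) p.1 q.1 s s' h)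
    · exact inc_inc α.φ β.φ γ.φ (congrArg Hom.φ e) p.1 q.1 s s' h

theorem fibreMap_fibreMap {X Y Z W : Wreath A B} (a : X ⟶ Y) (g : Y ⟶ Z) (f : X ⟶ Z) (b : Z ⟶ W)
    (g' : Y ⟶ W) (f' : X ⟶ W) (e : a ≫ g = f) (eg : g ≫ b = g') (ef : f ≫ b = f')
    (e' : a ≫ g' = f') (p : Σ t : Fin (card W.fst), Fin (card (W.snd t)))
    (e'' : fibreMap a g' f' e' p ≫ fibreMap g b g' eg p = fibreMap f b f' ef p)
    (q : Σ s, Fin (card ((fibre b p).snd s))) :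
    HEq (fibreMap (fibreMap a g' f' e' p) (fibreMap g b g' eg p) (fibreMap f b f' ef p) e'' q)
      (fibreMap a g f e (fibreFun b p q)) := by
  refine hom_heq (fibre_fibreMap f b f' ef p q) (fibre_fibreMap g b g' eg p q) _ _
    (fibMap_fibMap a.φ g.φ f.φ b.φ g'.φ f'.φ (congrArg Hom.φ e) (congrArg Hom.φ eg)
      (congrArg Hom.φ ef) (congrArg Hom.φ e') p.1 (congrArg Hom.φ e'') q.1)
    (fun s t h s' t' h' hs ht => ?_)
  have hs' := inc_inc f.φ b.φ f'.φ (congrArg Hom.φ ef) p.1 q.1 s s' hs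
  have ht' := inc_inc g.φ b.φ g'.φ (congrArg Hom.φ eg) p.1 q.1 t t' ht
  let I := inc f'.φ p.1 (inc (fibreMap f b f' ef p).φ q.1 s)
  let J := inc g'.φ p.1 (inc (fibreMap g b g' eg p).φ q.1 t)
  let K := inc b.φ p.1 q.1
  have fI : cardMap f.φ I = K := by
    rw [show I = _ from hs']; exact cardMap_inc _ _ _
  have gJ : cardMap g.φ J = K := by
    rw [show J = _ from ht']; exact cardMap_inc _ _ _
  have aI : cardMap a.φ I = J := by
    refine (inc_fibMap a.φ g'.φ f'.φ (congrArg Hom.φ e') p.1 _).symm.trans (congrArg _ ?_)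
    refine (inc_fibMap (fibreMap a g' f' e' p).φ (fibreMap g b g' eg p).φ
      (fibreMap f b f' ef p).φ (congrArg Hom.φ e'') q.1 s).symm.trans (congrArg _ h)
  have H := fibMap_fibMap (a.Φ I J aI) (g.Φ J K gJ) (f.Φ I K fI)
    (b.Φ K p.1 (cardMap_inc _ _ _)) (g'.Φ J p.1 (cardMap_inc _ _ _))
    (f'.Φ I p.1 (cardMap_inc _ _ _)) (comp_Φ _ _ _ e _ _ _ _ _ _) (comp_Φ _ _ _ eg _ _ _ _ _ _)
    (comp_Φ _ _ _ ef _ _ _ _ _ _) (comp_Φ _ _ _ e' _ _ _ _ _ _) p.2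
    (comp_Φ _ _ _ e'' (inc (fibreMap f b f' ef p).φ q.1 s) (inc (fibreMap g b g' eg p).φ q.1 t)
      q.1 ((inc_fibMap (fibreMap a g' f' e' p).φ (fibreMap g b g' eg p).φ
      (fibreMap f b f' ef p).φ (congrArg Hom.φ e'') q.1 s).symm.trans (congrArg _ h))
      (cardMap_inc _ _ _) (cardMap_inc _ _ _)) q.2
  refine H.trans (fibMap_heq (congrArg X.snd hs') (congrArg Y.snd ht') rfl ?_ ?_ _ _ rfl)
  · exact Φ_eqToHom a hs' ht' _ _
  · exact Φ_eqToHom g ht' rfl _ _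

/-- The wreath product is an operadic category. -/
noncomputable instance : OperadicCategory (Wreath A B) where
  card X := ∑ i, card (X.snd i)
  cardMap α := cardHom α
  cardMap_id X k := by
    obtain ⟨⟨s, a⟩, rfl⟩ : ∃ q, sumMk q = k := ⟨_, sumMk_sumOut k⟩
    refine (cardHom_sumMk (𝟙 X) s s (cardMap_id _ _) a).trans ?_
    have : Hom.Φ (𝟙 X) s s (cardMap_id _ _) = 𝟙 _ := rfl
    rw [this, cardMap_id]
  cardMap_comp {X Y Z} α β k := by
    obtain ⟨⟨s, a⟩, rfl⟩ : ∃ q, sumMk q = k := ⟨_, sumMk_sumOut k⟩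
    rw [cardHom_sumMk α s _ rfl, cardHom_sumMk β _ _ rfl,
      cardHom_sumMk (α ≫ β) s _ (cardMap_comp _ _ _)]
    rw [← comp_Φ α β (α ≫ β) rfl s _ _ rfl rfl (cardMap_comp _ _ _), cardMap_comp]
  chosen c := triv (compFst c) (compSnd c)
  π₀_chosen c := by
    induction c using Quotient.inductionOn with
    | h X => exact (π₀_eq_of_hom (toTriv X)).symm
  toChosen X := toTriv X
  hom_chosen_ext α β := triv_hom_ext α β
  fib α k := fibre α (sumOut k)
  inc α k := fibreInc α (sumOut k)
  mem_range_inc α k l := by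
    have := mem_range_fibreInc α (sumOut k) l
    rwa [sumMk_sumOut] at this
  card_chosen c := by
    refine (Finset.sum_congr rfl (fun _ _ => card_chosen (O := B) (compSnd c))).trans ?_
    rw [Finset.sum_const, Finset.card_univ, Fintype.card_fin, smul_eq_mul, mul_one]
    exact card_chosen (compFst c)
  fib_id X k := ⟨π₀ (fibre (𝟙 X) (sumOut k)), fibre_id X (sumOut k)⟩
  fibMap α β γ e k := fibreMap α β γ e (sumOut k)
  inc_fibMap α β γ e k l := by
    obtain ⟨q, rfl⟩ : ∃ q, sumMk q = l := ⟨_, sumMk_sumOut l⟩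
    have h : cardHom (fibreMap α β γ e (sumOut k)) (sumMk q) =
        sumMk (cardFun (fibreMap α β γ e (sumOut k)) q) :=
      congrArg (fun q => sumMk (cardFun (fibreMap α β γ e (sumOut k)) q)) (sumOut_sumMk q)
    refine (congrArg (fibreInc β (sumOut k)) h).trans ?_
    refine (fibreInc_sumMk β (sumOut k) _).trans ?_
    rw [fibreFun_fibreMap]
    refine Eq.trans ?_ (congrArg (cardHom α) (fibreInc_sumMk γ (sumOut k) q)).symm
    exact congrArg (fun q => sumMk (cardFun α q)) (sumOut_sumMk _).symm
  fibMap_id β k := fibreMap_id β (sumOut k)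
  fibMap_comp α β h₁ h₂ h₃ e₁ e₂ e₃ k := fibreMap_comp α β h₁ h₂ h₃ e₁ e₂ e₃ (sumOut k)
  fib_chosen α k := fibre_triv α (sumOut k)
  fibMap_chosen α β γ e k := fibreMap_triv α β γ e (sumOut k)
  fib_fibMap α β γ e k l := by
    refine (fibre_fibreMap α β γ e (sumOut k) (sumOut l)).trans (fibre_congr α ?_)
    exact (sumOut_sumMk _).symm
  fibMap_fibMap a g f b g' f' e eg ef e' k e'' l := by
    have hl : fibreFun b (sumOut k) (sumOut l) = sumOut (fibreInc b (sumOut k) l) :=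
      (sumOut_sumMk _).symm
    refine (fibreMap_fibreMap a g f b g' f' e eg ef e' (sumOut k) e'' (sumOut l)).trans ?_
    rw [hl]

end

end Wreath

/-! ## The Boardman–Vogt tensor product -/

namespace Operad

section BV

variable {C D : Type u}

/-- The bouquet with inputs the pairs `(i, j)` in lexicographic order, of colours `(c_i, d_j)`. -/
def _root_.Bq.prod (b : Bq C) (b' : Bq D) : Bq (C × D) where
  n := b.n * b'.n
  leaf k := (b.leaf (finProdFinEquiv.symm k).1, b'.leaf (finProdFinEquiv.symm k).2)
  root := (b.root, b'.root)

/-- The projection `(i, j) ↦ i`. -/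
def _root_.Bq.prodFst (b : Bq C) (b' : Bq D) :
    b.prod b' ⟶ Bq.map (fun c => (c, b'.root)) b :=
  Bq.Hom.mk (b := b.prod b') (b' := Bq.map (fun c => (c, b'.root)) b)
    (fun k => (finProdFinEquiv.symm k).1) rfl

/-- The projection `(i, j) ↦ j`. -/
def _root_.Bq.prodSnd (b : Bq C) (b' : Bq D) :
    b.prod b' ⟶ Bq.map (fun d => (b.root, d)) b' :=
  Bq.Hom.mk (b := b.prod b') (b' := Bq.map (fun d => (b.root, d)) b')
    (fun k => (finProdFinEquiv.symm k).2) rfl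

theorem _root_.Bq.prodFst_fib (b : Bq C) (b' : Bq D) (i : Fin b.n) :
    Bq.map (fun d => (b.leaf i, d)) b' = fib (b.prodFst b') i := by
  refine Bq.eq_fibre (b.prodFst b') i (Bq.map (fun d => (b.leaf i, d)) b')
    (OrderEmbedding.ofStrictMono (fun j : Fin b'.n => finProdFinEquiv (i, j))
      (fun j j' h => ?_)) (fun k => ?_) (fun k => ?_) rfl
  · have h : j.val < j'.val := h
    have h1 : (finProdFinEquiv (i, j)).val = j.val + b'.n * i.val := finProdFinEquiv_apply_val _
    have h2 : (finProdFinEquiv (i, j')).val = j'.val + b'.n * i.val := finProdFinEquiv_apply_val _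
    have h3 : (finProdFinEquiv (i, j)).val < (finProdFinEquiv (i, j')).val := by omega
    exact h3
  · constructor
    · rintro ⟨j, rfl⟩
      exact congrArg Prod.fst (finProdFinEquiv.symm_apply_apply (i, j))
    · intro h
      refine ⟨(finProdFinEquiv.symm k).2, ?_⟩
      have : (i, (finProdFinEquiv.symm k).2) = finProdFinEquiv.symm k := Prod.ext h.symm rfl
      exact (congrArg finProdFinEquiv this).trans (finProdFinEquiv.apply_symm_apply k)
  · have := finProdFinEquiv.symm_apply_apply (i, k)
    exact (congrArg (fun p : Fin b.n × Fin b'.n => (b.leaf p.1, b'.leaf p.2)) this).symm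

theorem _root_.Bq.prodSnd_fib (b : Bq C) (b' : Bq D) (j : Fin b'.n) :
    Bq.map (fun c => (c, b'.leaf j)) b = fib (b.prodSnd b') j := by
  refine Bq.eq_fibre (b.prodSnd b') j (Bq.map (fun c => (c, b'.leaf j)) b)
    (OrderEmbedding.ofStrictMono (fun i : Fin b.n => finProdFinEquiv (i, j))
      (fun i i' h => ?_)) (fun k => ?_) (fun k => ?_) rfl
  · have h : i.val < i'.val := h
    have h0 : b'.n * i.val < b'.n * i'.val := Nat.mul_lt_mul_of_pos_left h (Fin.pos j)
    have h1 : (finProdFinEquiv (i, j)).val = j.val + b'.n * i.val := finProdFinEquiv_apply_val _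
    have h2 : (finProdFinEquiv (i', j)).val = j.val + b'.n * i'.val := finProdFinEquiv_apply_val _
    have h3 : (finProdFinEquiv (i, j)).val < (finProdFinEquiv (i', j)).val := by omega
    exact h3
  · constructor
    · rintro ⟨i, rfl⟩
      exact congrArg Prod.snd (finProdFinEquiv.symm_apply_apply (i, j))
    · intro h
      refine ⟨(finProdFinEquiv.symm k).1, ?_⟩
      have : ((finProdFinEquiv.symm k).1, j) = finProdFinEquiv.symm k := Prod.ext rfl h.symm
      exact (congrArg finProdFinEquiv this).trans (finProdFinEquiv.apply_symm_apply k)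
  · have := finProdFinEquiv.symm_apply_apply (k, j)
    exact (congrArg (fun p : Fin b.n × Fin b'.n => (b.leaf p.1, b'.leaf p.2)) this).symm

/-- The generators `x ⊗ d` and `c ⊗ y` of the Boardman–Vogt tensor product. -/
inductive BVGen (X : Operad.{u, 0, u} (Bq C)) (Y : Operad.{u, 0, u} (Bq D)) :
    Bq (C × D) → Type u
  | left {b : Bq C} (x : X.obj b) (d : D) : BVGen X Y (Bq.map (fun c => (c, d)) b)
  | right (c : C) {b : Bq D} (y : Y.obj b) : BVGen X Y (Bq.map (fun d => (c, d)) b)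

/-- The relations of the Boardman–Vogt tensor product: every `- ⊗ d` and every `c ⊗ -` is a morphism
of operads, and the interchange relation
`μ((c_1 ⊗ y, …, c_n ⊗ y), x ⊗ d) = μ((x ⊗ d_1, …, x ⊗ d_m), c ⊗ y)`, where the two composites are
taken along the projections from the set of pairs `(i, j)` to its factors. -/
inductive BVRel (X : Operad.{u, 0, u} (Bq C)) (Y : Operad.{u, 0, u} (Bq D)) :
    ∀ b : Bq (C × D), Term (BVGen X Y) b → Term (BVGen X Y) b → Prop
  | left_one (d : D) (b : Bq C) (h : IsTrivial b) : BVRel X Y (Bq.map (fun c => (c, d)) b)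
      (Term.gen (BVGen.left (X.one b h) d))
      (Term.one _ ((Bq.mapFunctor (fun c => (c, d))).isTrivial_obj h))
  | left_μ (d : D) {b b' : Bq C} (f : b ⟶ b') (F : Fin b'.n → Bq C) (hF : ∀ i, F i = fib f i)
      (a : ∀ i, X.obj (F i)) (x : X.obj b') : BVRel X Y (Bq.map (fun c => (c, d)) b)
      (Term.gen (BVGen.left (X.μ f F hF a x) d))
      (Term.μ ((Bq.mapFunctor (fun c => (c, d))).functor.map f)
        (fun i => Bq.map (fun c => (c, d)) (F i))
        ((Bq.mapFunctor (fun c => (c, d))).obj_fib' f F hF)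
        (fun i => Term.gen (BVGen.left (a i) d)) (Term.gen (BVGen.left x d)))
  | right_one (c : C) (b : Bq D) (h : IsTrivial b) : BVRel X Y (Bq.map (fun d => (c, d)) b)
      (Term.gen (BVGen.right c (Y.one b h)))
      (Term.one _ ((Bq.mapFunctor (fun d => (c, d))).isTrivial_obj h))
  | right_μ (c : C) {b b' : Bq D} (f : b ⟶ b') (F : Fin b'.n → Bq D) (hF : ∀ i, F i = fib f i)
      (a : ∀ i, Y.obj (F i)) (y : Y.obj b') : BVRel X Y (Bq.map (fun d => (c, d)) b)
      (Term.gen (BVGen.right c (Y.μ f F hF a y)))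
      (Term.μ ((Bq.mapFunctor (fun d => (c, d))).functor.map f)
        (fun i => Bq.map (fun d => (c, d)) (F i))
        ((Bq.mapFunctor (fun d => (c, d))).obj_fib' f F hF)
        (fun i => Term.gen (BVGen.right c (a i))) (Term.gen (BVGen.right c y)))
  | interchange {b : Bq C} {b' : Bq D} (x : X.obj b) (y : Y.obj b') : BVRel X Y (b.prod b')
      (Term.μ (b.prodFst b') (fun i => Bq.map (fun d => (b.leaf i, d)) b') (b.prodFst_fib b')
        (fun i => Term.gen (BVGen.right (b.leaf i) y)) (Term.gen (BVGen.left x b'.root)))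
      (Term.μ (b.prodSnd b') (fun j => Bq.map (fun c => (c, b'.leaf j)) b) (b.prodSnd_fib b')
        (fun j => Term.gen (BVGen.left x (b'.leaf j))) (Term.gen (BVGen.right b.root y)))

/-- The Boardman–Vogt tensor product `X ⊗_BV Y`, a symmetric operad coloured by `C × D`. -/
noncomputable def bvTensor (X : Operad.{u, 0, u} (Bq C)) (Y : Operad.{u, 0, u} (Bq D)) :
    Operad.{u, 0, u} (Bq (C × D)) :=
  presented (BVGen X Y) (BVRel X Y)

/-- The element `x ⊗ d`. -/
noncomputable def bvLeft {X : Operad.{u, 0, u} (Bq C)} (Y : Operad.{u, 0, u} (Bq D)) {b : Bq C} (x : X.obj b)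
    (d : D) : (bvTensor X Y).obj (Bq.map (fun c => (c, d)) b) :=
  presentedGen (BVRel X Y) (BVGen.left x d)

/-- The element `c ⊗ y`. -/
noncomputable def bvRight (X : Operad.{u, 0, u} (Bq C)) {Y : Operad.{u, 0, u} (Bq D)} (c : C) {b : Bq D}
    (y : Y.obj b) : (bvTensor X Y).obj (Bq.map (fun d => (c, d)) b) :=
  presentedGen (BVRel X Y) (BVGen.right c y)

/-- The `c`-coloured unit `u_c`, an object of `∫ X`. -/
noncomputable def unitObj (X : Operad.{u, 0, u} (Bq C)) (c : C) : Groth X :=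
  ⟨Bq.triv c, X.one _ (Bq.isTrivial_triv c)⟩

/-- The object `(x; v_d, …, v_d)` of the wreath product `∫ X ≀ ∫ Y`. -/
noncomputable def wreathLeft {X : Operad.{u, 0, u} (Bq C)} (Y : Operad.{u, 0, u} (Bq D)) {b : Bq C} (x : X.obj b)
    (d : D) : Wreath (Groth X) (Groth Y) where
  fst := ⟨b, x⟩
  comp := π₀ (unitObj Y d)
  snd _ := unitObj Y d
  π₀_snd _ := rfl

/-- The object `(u_c; y)` of the wreath product `∫ X ≀ ∫ Y`. -/
noncomputable def wreathRight (X : Operad.{u, 0, u} (Bq C)) {Y : Operad.{u, 0, u} (Bq D)} (c : C) {b : Bq D}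
    (y : Y.obj b) : Wreath (Groth X) (Groth Y) where
  fst := unitObj X c
  comp := π₀ (⟨b, y⟩ : Groth Y)
  snd _ := ⟨b, y⟩
  π₀_snd _ := rfl

end BV

end Operad

/-! Both operads are presented by generators and relations, so a morphism out of either exists as
soon as the relations hold in the target. The relations needed come from a few morphisms of the
wreath product. For `T = (x; y_1, …, y_n)` let `c_i` and `c` be the input and output colours of `x`,
and let `d` be the common output colour of the `y_i`.

In the reflection, every morphism `T ⟶ S` writes `[T]` as the composite of `[S]` with the classes of
the fibres. The morphism from `(x; y_1, …, y_n)` to `(x; v_d, …, v_d)` over the identity of `x` has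
the fibres `(u_{c_i}; y_i)`. So `[T]` is the composite of `α(x ⊗ d)` with the `α(c_i ⊗ y_i)`
(`wval_eq`). On `(x; y, …, y)` there is also the morphism to `(u_c; y)` which is the identity on
each `y`; its fibres are `(x; v_{d_j}, …, v_{d_j})`. Comparing the two decompositions gives
interchange (`wleft_wright`). Morphisms of one factor combined with identities of the other give
compatibility with composition (`wleft_μ`, `wright_μ`). Hence `α` exists.

Conversely, send `(x; y_1, …, y_n)` to the composite of `x ⊗ d` with the `c_i ⊗ y_i` (`bvOfWreath`).
By the universal property of `Ar_!` this defines a morphism out of the reflection once every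
morphism `T ⟶ S` yields the corresponding equation. Such a morphism factors `x` through the
operation `z` of `S` and each `y_s` through some `w_t`. Expand both and interchange the element
`ε_t` over `t` with `w_t` (`bvw_hom`). The two morphisms are inverse to each other because they are
so on generators (`bvOfWreath_wreathLeft`, `bvOfWreath_wreathRight`, `app_bvOfWreath`).

All these equations are proved for operations on sets. An element of a symmetric operad is
determined by its effect in all actions (`ext_of_action`), since it is recovered from its value on
generic arguments in the action on multilinear formal composites. In an action a structure map
becomes iterated substitution, so transports between equal bouquets and reorderings of inputs reduce
to equalities between arguments. -/

namespace Bq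

/-- The inclusion of the inputs of a fibre. -/
def fibreInc {C : Type u} {b b' : Bq C} (f : b ⟶ b') (i : Fin b'.n) :
    Fin (fibre f i).n ↪o Fin b.n :=
  emb f.toFun i

theorem mem_range_fibreInc {C : Type u} {b b' : Bq C} (f : b ⟶ b') (i : Fin b'.n) (k : Fin b.n) :
    k ∈ Set.range (fibreInc f i) ↔ f.toFun k = i :=
  mem_range_emb f.toFun i k

theorem apply_fibreInc {C : Type u} {b b' : Bq C} (f : b ⟶ b') (i : Fin b'.n)
    (k : Fin (fibre f i).n) : f.toFun (fibreInc f i k) = i :=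
  apply_emb f.toFun i k

end Bq

namespace Operad

/-! ## Actions of symmetric operads -/

/-- An action of a symmetric operad on a set of coloured elements. Composites of elements of the
wrong colours are allowed; units act as identities on elements of the right colour. -/
structure Action {E : Type u} (Q : Operad.{u, 0, u} (Bq E)) where
  carrier : Type u
  HasColour : carrier → E → Prop
  act : ∀ {b : Bq E}, Q.obj b → (Fin b.n → carrier) → carrier
  act_one : ∀ (b : Bq E) (h : IsTrivial b) (a : Fin b.n → carrier) (i : Fin b.n),
    HasColour (a i) (b.leaf i) → act (Q.one b h) a = a i
  act_μ_fib : ∀ {b b' : Bq E} (f : b ⟶ b') (ε : ∀ i : Fin b'.n, Q.obj (Bq.fibre f i))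
    (s : Q.obj b') (a : Fin b.n → carrier),
    act (Q.μ f (fib f) (fun _ => rfl) ε s) a =
      act s (fun i => act (ε i) (fun k => a (Bq.fibreInc f i k)))

namespace Action

variable {E : Type u} {Q : Operad.{u, 0, u} (Bq E)} (𝒜 : Action Q)

/-- Transport along an equality of bouquets is invisible to an action; this is how the casts in
`bvToReflectionGen` disappear. -/
theorem act_congr {b b' : Bq E} (h : b = b') {q : Q.obj b} {q' : Q.obj b'} (hq : HEq q q')
    {a : Fin b.n → 𝒜.carrier} {a' : Fin b'.n → 𝒜.carrier}
    (ha : ∀ k k', k.val = k'.val → a k = a' k') : 𝒜.act q a = 𝒜.act q' a' := by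
  subst h
  cases hq
  obtain rfl : a = a' := funext fun k => ha k k rfl
  rfl

/-- An order embedding is determined by its image, so the enumeration of a fibre may be replaced by
whichever inclusion is at hand: rows, columns, summands of an ordinal sum, or `inc`. -/
theorem act_μ {b b' : Bq E} (f : b ⟶ b') (F : Fin b'.n → Bq E) (hF : ∀ i, F i = Bq.fibre f i)
    (p : ∀ i, Fin (F i).n ↪o Fin b.n) (hp : ∀ i k, k ∈ Set.range (p i) ↔ f.toFun k = i)
    (ε : ∀ i, Q.obj (F i)) (s : Q.obj b') (a : Fin b.n → 𝒜.carrier) :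
    𝒜.act (Q.μ f F hF ε s) a = 𝒜.act s (fun i => 𝒜.act (ε i) (fun k => a (p i k))) := by
  obtain rfl : F = Bq.fibre f := funext hF
  refine (𝒜.act_μ_fib f ε s a).trans ?_
  refine congrArg (𝒜.act s) (funext fun i => congrArg (𝒜.act (ε i)) (funext fun k => ?_))
  exact congrArg a (Bq.emb_val f i (p i) (hp i) k k rfl).symm

end Action

/-! ### The action on multilinear formal composites -/

section multilinear

variable {E : Type u}

/-- The bouquet with the inputs of `T` in `S` and output colour `c`. -/
def subBq (T : Bq E) (S : Finset (Fin T.n)) (c : E) : Bq E :=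
  ⟨S.card, fun k => T.leaf (S.orderEmbOfFin rfl k), c⟩

/-- The inclusion of the inputs. -/
def subEmb (T : Bq E) (S : Finset (Fin T.n)) (c : E) : Fin (subBq T S c).n ↪o Fin T.n :=
  S.orderEmbOfFin rfl

theorem range_subEmb (T : Bq E) (S : Finset (Fin T.n)) (c : E) :
    Set.range (subEmb T S c) = S :=
  Finset.range_orderEmbOfFin S rfl

theorem subEmb_mem (T : Bq E) (S : Finset (Fin T.n)) (c : E) (k : Fin (subBq T S c).n) :
    subEmb T S c k ∈ S :=
  Finset.orderEmbOfFin_mem S rfl k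

theorem exists_subEmb (T : Bq E) {S : Finset (Fin T.n)} (c : E) {k : Fin T.n} (h : k ∈ S) :
    ∃ l, subEmb T S c l = k := by
  have : k ∈ Set.range (subEmb T S c) := by
    rw [range_subEmb]
    exact h
  exact this

/-- The inclusion of `S` in `U`. -/
theorem exists_incl {T : Bq E} {S U : Finset (Fin T.n)} (h : S ⊆ U) (c d : E) :
    ∃ p : Fin (subBq T S c).n ↪o Fin (subBq T U d).n,
      ∀ k, subEmb T U d (p k) = subEmb T S c k := by
  have H : ∀ k, ∃ l, subEmb T U d l = subEmb T S c k := fun k =>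
    exists_subEmb T d (h (subEmb_mem T S c k))
  choose p hp using H
  refine ⟨OrderEmbedding.ofStrictMono p fun k l hkl => ?_, hp⟩
  have := (subEmb T S c).strictMono hkl
  rw [← hp, ← hp] at this
  exact (subEmb T U d).lt_iff_lt.1 this

/-- A formal composite in which every input of `T` in `supp` occurs exactly once. -/
structure Multilinear (Q : Operad.{u, 0, u} (Bq E)) (T : Bq E) where
  supp : Finset (Fin T.n)
  colour : E
  el : Q.obj (subBq T supp colour)

namespace Multilinear

variable {Q : Operad.{u, 0, u} (Bq E)} {T : Bq E}

theorem ext_heq {x y : Multilinear Q T} (h : x.supp = y.supp) (hc : x.colour = y.colour)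
    (he : HEq x.el y.el) : x = y := by
  obtain ⟨S, c, x⟩ := x
  obtain ⟨S', c', y⟩ := y
  dsimp only at h hc he
  subst h hc
  cases he
  rfl

theorem el_heq {x y : Multilinear Q T} (h : x = y) : HEq x.el y.el := by
  subst h; rfl

/-- The family `m` can be substituted in operations with inputs `b`. -/
structure Composable (b : Bq E) (m : Fin b.n → Multilinear Q T) : Prop where
  colour : ∀ i, (m i).colour = b.leaf i
  disjoint : ∀ i j k, k ∈ (m i).supp → k ∈ (m j).supp → i = j

/-- `f` sends an element of `U` to the member of the family `m` whose support it belongs to. -/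
structure IsIndex {b : Bq E} (m : Fin b.n → Multilinear Q T) {U : Finset (Fin T.n)} {r : E}
    (f : subBq T U r ⟶ b) : Prop where
  subset : ∀ i, (m i).supp ⊆ U
  mem : ∀ k, subEmb T U r k ∈ (m (f.toFun k)).supp

/-- Disjointness of the supports makes the index of an input unique. -/
theorem IsIndex.mem_iff {b : Bq E} {m : Fin b.n → Multilinear Q T} (hm : Composable b m)
    {U : Finset (Fin T.n)} {r : E} {f : subBq T U r ⟶ b} (hf : IsIndex m f) (i : Fin b.n)
    (k : Fin (subBq T U r).n) : subEmb T U r k ∈ (m i).supp ↔ f.toFun k = i := by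
  constructor
  · exact fun h => hm.disjoint _ _ _ (hf.mem k) h
  · rintro rfl
    exact hf.mem k

/-- The elements over `i` are exactly the support of `m i`, and composability matches the output
colour. This equality allows the members of `m` to be fed to `Q.μ f` without transport. -/
theorem IsIndex.fibre_eq {b : Bq E} {m : Fin b.n → Multilinear Q T} (hm : Composable b m)
    {U : Finset (Fin T.n)} {r : E} {f : subBq T U r ⟶ b} (hf : IsIndex m f) (i : Fin b.n) :
    subBq T (m i).supp (m i).colour = Bq.fibre f i := by
  obtain ⟨p, hp⟩ := exists_incl (hf.subset i) (m i).colour r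
  refine Bq.eq_fibre f i _ p (fun k => ?_) (fun k => congrArg T.leaf (hp k).symm) (hm.colour i)
  refine Iff.trans ?_ (hf.mem_iff hm i k)
  constructor
  · rintro ⟨k, rfl⟩
    rw [hp]
    exact subEmb_mem T _ _ k
  · intro h
    obtain ⟨l, hl⟩ := exists_subEmb T (m i).colour h
    refine ⟨l, (subEmb T U r).injective ?_⟩
    rw [hp, hl]

-- Existence needs no disjointness: each input in the union is sent to some member whose support
-- contains it.
variable (T) in
theorem exists_isIndex {b : Bq E} (m : Fin b.n → Multilinear Q T) :
    ∃ f : subBq T (Finset.univ.biUnion fun i => (m i).supp) b.root ⟶ b, IsIndex m f := by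
  have H : ∀ k, ∃ i, subEmb T (Finset.univ.biUnion fun i => (m i).supp) b.root k ∈
      (m i).supp := fun k => by
    have := subEmb_mem T (Finset.univ.biUnion fun i => (m i).supp) b.root k
    rw [Finset.mem_biUnion] at this
    obtain ⟨i, -, hi⟩ := this
    exact ⟨i, hi⟩
  choose f hf using H
  exact ⟨⟨f, rfl⟩, fun i => Finset.subset_biUnion_of_mem (fun i => (m i).supp)
    (Finset.mem_univ i), hf⟩

/-- Substitution of the family `m` in the operation `q`. -/
noncomputable def comp {b : Bq E} (m : Fin b.n → Multilinear Q T) (hm : Composable b m)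
    (q : Q.obj b) : Multilinear Q T :=
  ⟨Finset.univ.biUnion fun i => (m i).supp, b.root, Q.μ (exists_isIndex T m).choose
    (fun i => subBq T (m i).supp (m i).colour)
    ((exists_isIndex T m).choose_spec.fibre_eq hm) (fun i => (m i).el) q⟩

/-- The support, the output colour and the index are all forced, so the choice made in `comp` does
not matter. Leaving `U` and `r` free allows a composite to be computed with any convenient index. -/
theorem comp_eq {b : Bq E} {m : Fin b.n → Multilinear Q T} (hm : Composable b m) (q : Q.obj b)
    {U : Finset (Fin T.n)} {r : E} {f : subBq T U r ⟶ b} (hf : IsIndex m f) :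
    comp m hm q = ⟨U, r, Q.μ f (fun i => subBq T (m i).supp (m i).colour) (hf.fibre_eq hm)
      (fun i => (m i).el) q⟩ := by
  obtain rfl : r = b.root := f.root_eq
  obtain rfl : U = Finset.univ.biUnion fun i => (m i).supp := by
    apply Finset.Subset.antisymm
    · intro k hk
      obtain ⟨l, rfl⟩ := exists_subEmb T b.root hk
      exact Finset.mem_biUnion.2 ⟨_, Finset.mem_univ _, hf.mem l⟩
    · exact Finset.biUnion_subset.2 fun i _ => hf.subset i
  refine ext_heq rfl rfl (heq_of_eq (Q.μ_congr (Bq.Hom.ext (funext fun k => ?_)) _ _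
    (fun _ => HEq.rfl) rfl))
  exact ((exists_isIndex T m).choose_spec.mem_iff hm _ k).1 (hf.mem k)

open Classical in
/-- Substitution of a family of elements or zeros. -/
noncomputable def act {b : Bq E} (q : Q.obj b) (a : Fin b.n → Option (Multilinear Q T)) :
    Option (Multilinear Q T) :=
  if h : ∃ m : Fin b.n → Multilinear Q T, Composable b m ∧ a = fun i => some (m i) then
    some (comp h.choose h.choose_spec.1 q) else none

theorem act_some {b : Bq E} (q : Q.obj b) {m : Fin b.n → Multilinear Q T} (hm : Composable b m) :
    act q (fun i => some (m i)) = some (comp m hm q) := by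
  have h : ∃ m' : Fin b.n → Multilinear Q T, Composable b m' ∧
      (fun i => some (m i)) = fun i => some (m' i) := ⟨m, hm, rfl⟩
  unfold act
  rw [dif_pos h]
  have h' : h.choose = m := funext fun i =>
    (Option.some.inj (congrFun h.choose_spec.2 i)).symm
  congr 2

theorem exists_of_act {b : Bq E} {q : Q.obj b} {a : Fin b.n → Option (Multilinear Q T)}
    {x : Multilinear Q T} (h : act q a = some x) :
    ∃ (m : Fin b.n → Multilinear Q T) (hm : Composable b m), a = (fun i => some (m i)) ∧
      x = comp m hm q := by
  unfold act at h
  split_ifs at h with h'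
  exact ⟨_, h'.choose_spec.1, h'.choose_spec.2, (Option.some.inj h).symm⟩

theorem comp_supp {b : Bq E} {m : Fin b.n → Multilinear Q T} (hm : Composable b m) (q : Q.obj b)
    (k : Fin T.n) : k ∈ (comp m hm q).supp ↔ ∃ i, k ∈ (m i).supp := by
  simp [comp]

theorem Composable.fibre {b b' : Bq E} {m : Fin b.n → Multilinear Q T} (hm : Composable b m)
    (f : b ⟶ b') (i : Fin b'.n) :
    Composable (Bq.fibre f i) (fun k => m (Bq.fibreInc f i k)) where
  colour _ := hm.colour _
  disjoint _ _ _ h h' := (Bq.fibreInc f i).injective (hm.disjoint _ _ _ h h')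

theorem Composable.comp {b b' : Bq E} {m : Fin b.n → Multilinear Q T} (hm : Composable b m)
    (f : b ⟶ b') (ε : ∀ i : Fin b'.n, Q.obj (Bq.fibre f i)) :
    Composable b' (fun i => Multilinear.comp _ (hm.fibre f i) (ε i)) where
  colour _ := rfl
  disjoint i j k h h' := by
    rw [comp_supp] at h h'
    obtain ⟨l, hl⟩ := h
    obtain ⟨l', hl'⟩ := h'
    have := hm.disjoint _ _ _ hl hl'
    exact (Bq.apply_fibreInc f i l).symm.trans
      ((congrArg f.toFun this).trans (Bq.apply_fibreInc f j l'))

/-- This is associativity in `Q`: if `p` is an index for `m`, then `p ≫ f` is one for the family of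
partial composites, and the maps that `p` induces on fibres are indices for the subfamilies. -/
theorem comp_μ {b b' : Bq E} {m : Fin b.n → Multilinear Q T} (hm : Composable b m)
    (f : b ⟶ b') (ε : ∀ i : Fin b'.n, Q.obj (Bq.fibre f i)) (s : Q.obj b') :
    Multilinear.comp m hm (Q.μ f (fib f) (fun _ => rfl) ε s) =
      Multilinear.comp (fun i => Multilinear.comp _ (hm.fibre f i) (ε i)) (hm.comp f ε) s := by
  obtain ⟨p, hp⟩ := exists_isIndex T m
  have hpf : IsIndex (fun i => Multilinear.comp _ (hm.fibre f i) (ε i)) (p ≫ f) := by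
    refine ⟨fun i k hk => ?_, fun k => ?_⟩
    · obtain ⟨l, hl⟩ := (comp_supp _ _ _).1 hk
      exact hp.subset _ hl
    · refine (comp_supp _ _ _).2 ?_
      obtain ⟨l, hl⟩ := (Bq.mem_range_fibreInc f (f.toFun (p.toFun k)) (p.toFun k)).2 rfl
      refine ⟨l, ?_⟩
      have h1 := hp.mem k
      rw [← hl] at h1
      exact h1
  rw [comp_eq hm _ hp, comp_eq (hm.comp f ε) _ hpf]
  refine ext_heq rfl rfl (heq_of_eq ?_)
  have A := Q.μ_assoc p f (p ≫ f) rfl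
    (fun j => cast (congrArg Q.obj (hp.fibre_eq hm j)) (m j).el) ε s
  refine Eq.trans (Q.μ_congr rfl _ _ (fun i => (cast_heq _ _).symm) rfl)
    (A.symm.trans (Q.μ_congr rfl _ _ (fun i => ?_) rfl))
  obtain ⟨q, hq⟩ := exists_isIndex T (fun k => m (Bq.fibreInc f i k))
  refine HEq.trans ?_ (el_heq (comp_eq (hm.fibre f i) (ε i) hq).symm)
  -- It remains to identify the map induced by `p` on the fibre over `i` with the index `q` of the
  -- subfamily. Both send an input to the member whose support contains it, and the supports are
  -- disjoint.
  refine Q.μ_heq (hpf.fibre_eq (hm.comp f ε) i).symm rfl ?_ _ _ (fun j j' hj => ?_) HEq.rfl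
  · refine Bq.hom_heq (hpf.fibre_eq (hm.comp f ε) i).symm rfl _ _ (fun k k' hk => ?_)
    refine congrArg Fin.val (a₂ := q.toFun k') ?_
    apply (Bq.fibreInc f i).injective
    refine (inc_fibMap p f (p ≫ f) rfl i k).trans ?_
    refine hm.disjoint _ _ _ (hp.mem _) ?_
    have h1 := hq.mem k'
    refine (congrArg (· ∈ (m (Bq.fibreInc f i (q.toFun k'))).supp) ?_).mpr h1
    -- Both embeddings enumerate the support of the `i`-th partial composite in increasing order.
    refine (emb_unique ((Bq.fibreInc (p ≫ f) i).trans (subEmb T _ b.root))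
      (subEmb T _ (Bq.fibre f i).root) ?_).2 k k' hk
    ext x
    rw [range_subEmb]
    refine Iff.trans ?_ (comp_supp (hm.fibre f i) (ε i) x).symm
    constructor
    · rintro ⟨y, rfl⟩
      have h2 := hp.mem (Bq.fibreInc (p ≫ f) i y)
      obtain ⟨l, hl⟩ := (Bq.mem_range_fibreInc f i (p.toFun (Bq.fibreInc (p ≫ f) i y))).2
        (Bq.apply_fibreInc (p ≫ f) i y)
      exact ⟨l, by rw [hl]; exact h2⟩
    · rintro ⟨l, hl⟩
      obtain ⟨y, rfl⟩ := exists_subEmb T b.root (hp.subset _ hl)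
      have h3 := (hp.mem_iff hm _ y).1 hl
      obtain ⟨z, hz⟩ := (Bq.mem_range_fibreInc (p ≫ f) i y).2
        ((congrArg f.toFun h3).trans (Bq.apply_fibreInc f i l))
      exact ⟨z, congrArg (subEmb T _ b.root) hz⟩
  · obtain rfl : j = j' := Fin.ext hj
    exact cast_heq _ _

/-- For composable families this is `comp_μ`. Otherwise both sides are zero: if all partial
composites exist and are composable, then the original family is composable too. -/
theorem act_μ {b b' : Bq E} (f : b ⟶ b') (ε : ∀ i : Fin b'.n, Q.obj (Bq.fibre f i))
    (s : Q.obj b') (a : Fin b.n → Option (Multilinear Q T)) :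
    act (Q.μ f (fib f) (fun _ => rfl) ε s) a =
      act s (fun i => act (ε i) (fun k => a (Bq.fibreInc f i k))) := by
  by_cases h : ∃ m : Fin b.n → Multilinear Q T, Composable b m ∧ a = fun i => some (m i)
  · obtain ⟨m, hm, rfl⟩ := h
    refine (act_some _ hm).trans ?_
    have : (fun i => act (ε i) (fun k => some (m (Bq.fibreInc f i k)))) =
        fun i => some (comp _ (hm.fibre f i) (ε i)) := funext fun i => act_some _ (hm.fibre f i)
    rw [this, act_some _ (hm.comp f ε), comp_μ]
  · have h1 : act (Q.μ f (fib f) (fun _ => rfl) ε s) a = none := dif_neg h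
    rw [h1]
    symm
    by_contra h2
    obtain ⟨x, hx⟩ := Option.ne_none_iff_exists'.1 h2
    obtain ⟨m', hm', h3, -⟩ := exists_of_act hx
    have H : ∀ i, ∃ (m : Fin (Bq.fibre f i).n → Multilinear Q T) (hm : Composable (Bq.fibre f i) m),
        (fun k => a (Bq.fibreInc f i k)) = (fun k => some (m k)) ∧ m' i = comp m hm (ε i) :=
      fun i => exists_of_act (congrFun h3 i)
    choose m hm ha hc using H
    -- Every input of `b` lies in the fibre over its image, so its argument is nonzero, has the
    -- right colour and is supported inside the corresponding partial composite.
    have H' : ∀ k, ∃ x, a k = some x ∧ x.colour = b.leaf k ∧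
        ∀ l, l ∈ x.supp → l ∈ (m' (f.toFun k)).supp := by
      intro k
      obtain ⟨l, hl⟩ := (Bq.mem_range_fibreInc f (f.toFun k) k).2 rfl
      refine ⟨m (f.toFun k) l, ?_, ?_, fun y hy => ?_⟩
      · have := congrFun (ha (f.toFun k)) l
        rwa [hl] at this
      · refine ((hm (f.toFun k)).colour l).trans (congrArg b.leaf hl)
      · rw [hc, comp_supp]
        exact ⟨l, hy⟩
    choose n hn hn' hn'' using H'
    refine h ⟨n, ⟨hn', fun k k' l hl hl' => ?_⟩, funext hn⟩
    -- Overlapping supports put `k` and `k'` in the same fibre, by disjointness of the partial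
    -- composites; disjointness within this fibre then gives `k = k'`.
    have hk := hm'.disjoint _ _ _ (hn'' _ _ hl) (hn'' _ _ hl')
    obtain ⟨z, hz⟩ := (Bq.mem_range_fibreInc f (f.toFun k) k).2 rfl
    obtain ⟨z', hz'⟩ := (Bq.mem_range_fibreInc f (f.toFun k) k').2 hk.symm
    have e1 : n k = m (f.toFun k) z := by
      have := congrFun (ha (f.toFun k)) z
      rw [hz, hn] at this
      exact Option.some.inj this
    have e2 : n k' = m (f.toFun k) z' := by
      have := congrFun (ha (f.toFun k)) z'
      rw [hz', hn] at this
      exact Option.some.inj this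
    rw [e1] at hl
    rw [e2] at hl'
    rw [← hz, ← hz', (hm _).disjoint _ _ _ hl hl']

end Multilinear

/-! ### Actions separate the elements of a symmetric operad -/

variable (Q : Operad.{u, 0, u} (Bq E)) (T : Bq E)

/-- The action of an operad on its multilinear formal composites and zero. -/
noncomputable def multilinearAction : Action Q where
  carrier := Option (Multilinear Q T)
  HasColour a c := ∃ x, a = some x ∧ x.colour = c
  act q a := Multilinear.act q a
  act_one b h a i := by
    rintro ⟨x, hx, hc⟩
    have hsub : Subsingleton (Fin b.n) := by
      have : b.n = 1 := h.card_eq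
      rw [this]; infer_instance
    obtain rfl : a = fun _ => some x := funext fun j => by rw [Subsingleton.elim j i, hx]
    have hm : Multilinear.Composable b (fun _ => x) :=
      ⟨fun j => by rw [Subsingleton.elim j i, hc], fun j k _ _ _ => Subsingleton.elim j k⟩
    -- A trivial bouquet has equal input and output colours, so the constant map `f` below is a
    -- morphism of bouquets. It is an index, and `Q.μ_one` applies to it.
    have hr : x.colour = b.root := by
      rw [hc]
      have := Bq.eq_triv_of_isTrivial h
      generalize b.root = r at this
      subst this
      rfl
    obtain ⟨S, c, x⟩ := x
    let f : subBq T S c ⟶ b := ⟨fun _ => i, hr⟩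
    have hf : Multilinear.IsIndex (fun _ : Fin b.n => (⟨S, c, x⟩ : Multilinear Q T)) f :=
      ⟨fun _ => Finset.Subset.refl _, fun k => subEmb_mem T S c k⟩
    rw [Multilinear.act_some _ hm, Multilinear.comp_eq hm _ hf]
    exact congrArg (fun x => some (Multilinear.mk S c x)) (Q.μ_one h f x)
  act_μ_fib f ε s a := Multilinear.act_μ f ε s a

variable {Q T} in
/-- Elements of a symmetric operad are determined by their actions. -/
theorem ext_of_action {q q' : Q.obj T} (h : ∀ (𝒜 : Action Q) (a : Fin T.n → 𝒜.carrier),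
    (∀ i, 𝒜.HasColour (a i) (T.leaf i)) → 𝒜.act q a = 𝒜.act q' a) : q = q' := by
  have ht : ∀ k, IsTrivial (subBq T {k} (T.leaf k)) := fun k => by
    refine Bq.ext' (b' := Bq.triv (T.leaf k)) (Finset.card_singleton k) (fun l l' _ => ?_) rfl
    exact congrArg T.leaf (Finset.mem_singleton.1 (subEmb_mem T {k} (T.leaf k) l))
  -- The generic arguments: the input `k` alone, as a unit of its colour.
  let m : Fin T.n → Multilinear Q T := fun k => ⟨{k}, T.leaf k, Q.one _ (ht k)⟩
  have hm : Multilinear.Composable T m := ⟨fun _ => rfl, fun i j k h h' =>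
    (Finset.mem_singleton.1 h).symm.trans (Finset.mem_singleton.1 h')⟩
  -- Substituting the generic arguments in `q` composes `q` with units along the identity and so
  -- returns `q`. The equality is heterogeneous because the bouquet on the full support equals `T`
  -- only propositionally.
  have key : ∀ q : Q.obj T, HEq (Multilinear.comp m hm q).el q := by
    intro q
    refine HEq.trans ?_ (heq_of_eq (Q.μ_id q))
    have hU : (Finset.univ.biUnion fun i => (m i).supp) = Finset.univ := by
      ext k; simp [m]
    obtain ⟨f, hf⟩ := Multilinear.exists_isIndex T m
    refine (Multilinear.el_heq (Multilinear.comp_eq hm q hf)).trans ?_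
    have hemb : ∀ (k : Fin (subBq T (Finset.univ.biUnion fun i => (m i).supp) T.root).n)
        (k' : Fin T.n),
        k.val = k'.val → subEmb T (Finset.univ.biUnion fun i => (m i).supp) T.root k = k' :=
      fun k k' hk => (emb_unique (subEmb T _ T.root) (RelEmbedding.refl (· ≤ ·)) (by
        rw [range_subEmb, hU]
        ext; simp)).2 k k' hk
    have hT : subBq T (Finset.univ.biUnion fun i => (m i).supp) T.root = T := by
      refine Bq.ext' ?_ (fun k k' hk => congrArg T.leaf (hemb k k' hk)) rfl
      change Finset.card _ = _
      rw [hU, Finset.card_univ, Fintype.card_fin]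
    have hf' : HEq f (𝟙 T) := by
      refine Bq.hom_heq hT rfl _ _ (fun k k' hk => ?_)
      have h1 := Finset.mem_singleton.1 (hf.mem k)
      rw [hemb k k' hk] at h1
      exact congrArg Fin.val h1.symm
    refine Q.μ_heq hT rfl hf' _ _ (fun i i' hi => ?_) HEq.rfl
    obtain rfl : i = i' := Fin.ext hi
    refine Q.one_heq ?_ _ _
    exact (hf.fibre_eq hm i).trans (fib_heq hT rfl hf' rfl)
  have h1 := h (multilinearAction Q T) (fun i => some (m i)) (fun i => ⟨m i, rfl, rfl⟩)
  have h2 : Multilinear.act q (fun i => some (m i)) = Multilinear.act q' (fun i => some (m i)) := h1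
  rw [Multilinear.act_some _ hm, Multilinear.act_some _ hm] at h2
  have h3 := (Multilinear.el_heq (Option.some.inj h2)).trans (key q')
  exact eq_of_heq ((key q).symm.trans h3)

/-- A version of `ext_of_action` for elements over equal bouquets. -/
theorem heq_of_action {Q : Operad.{u, 0, u} (Bq E)} {T T' : Bq E} (hT : T = T') {q : Q.obj T}
    {q' : Q.obj T'} (h : ∀ (𝒜 : Action Q) (a : Fin T.n → 𝒜.carrier) (a' : Fin T'.n → 𝒜.carrier),
    (∀ k k', k.val = k'.val → a k = a' k') → (∀ i, 𝒜.HasColour (a i) (T.leaf i)) →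
    𝒜.act q a = 𝒜.act q' a') : HEq q q' := by
  subst hT
  refine heq_of_eq (ext_of_action fun 𝒜 a ha => h 𝒜 a a (fun k k' hk => ?_) ha)
  rw [Fin.ext hk]

end multilinear

end Operad

/-! ## Actions of the reflection of a wreath product -/

/-! ### Ordinal sums of singletons and ordinal sums with one summand -/

theorem sigma_fin_ext {k : ℕ} {n : Fin k → ℕ} {p q : Σ i, Fin (n i)} (h : p.1 = q.1)
    (h' : p.2.val = q.2.val) : p = q := by
  obtain ⟨i, x⟩ := p
  obtain ⟨j, y⟩ := q
  obtain rfl : i = j := h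
  obtain rfl : x = y := Fin.ext h'
  rfl

/-- If all summands are singletons, the map to the index of the summand is an order embedding onto
`Fin k`, hence preserves values. Thus the inputs of `(x; v_d, …, v_d)` are those of `x`, in the same
order. -/
theorem sumOut_fst_val {k : ℕ} {n : Fin k → ℕ} (h : ∀ i, n i = 1) (x : Fin (∑ i, n i)) :
    (sumOut x).1.val = x.val := by
  have hx : x.val < k := by simpa [h] using x.2
  refine congrArg Fin.val ((emb_unique (OrderEmbedding.ofStrictMono
    (fun x : Fin (∑ i, n i) => (sumOut x).1) fun x y hxy => ?_)
    (RelEmbedding.refl (· ≤ ·)) ?_).2 x ⟨x.val, hx⟩ rfl)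
  · rw [← sumMk_sumOut x, ← sumMk_sumOut y, sumMk_lt] at hxy
    refine hxy.resolve_right fun h' => ?_
    have h1 := (sumOut x).2.2.trans_eq (h _)
    have h2 := (sumOut y).2.2.trans_eq (h _)
    omega
  · ext i
    refine ⟨fun _ => ⟨i, rfl⟩, fun _ => ⟨sumMk ⟨i, ⟨0, by rw [h]; exact Nat.one_pos⟩⟩, ?_⟩⟩
    exact congrArg Sigma.fst (sumOut_sumMk (n := n) ⟨i, ⟨0, by rw [h]; exact Nat.one_pos⟩⟩)

/-- With one summand, the position in it is an order embedding onto the whole ordinal. Thus the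
inputs of `(u_c; y)` are those of `y`, in the same order. -/
theorem sumOut_snd_val {k : ℕ} {n : Fin k → ℕ} (h : k = 1) (x : Fin (∑ i, n i)) :
    (sumOut x).2.val = x.val := by
  subst h
  have hn : ∑ i, n i = n 0 := by simp
  have h0 : ∀ i : Fin 1, n i = n 0 := fun i => congrArg n (Subsingleton.elim _ _)
  refine congrArg Fin.val ((emb_unique (OrderEmbedding.ofStrictMono (fun x : Fin (∑ i, n i) =>
    (⟨(sumOut x).2.val, (sumOut x).2.2.trans_eq (h0 _)⟩ : Fin (n 0)))
    fun x y hxy => ?_) (RelEmbedding.refl (· ≤ ·)) ?_).2 x ⟨x.val, x.2.trans_eq hn⟩ rfl)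
  · rw [← sumMk_sumOut x, ← sumMk_sumOut y, sumMk_lt] at hxy
    rcases hxy with h | h
    · exact absurd (Subsingleton.elim (sumOut x).1 (sumOut y).1) h.ne
    · exact h.2
  · ext i
    refine ⟨fun _ => ⟨i, rfl⟩, fun _ => ⟨sumMk ⟨0, i⟩, ?_⟩⟩
    exact Fin.ext (congrArg (fun p : Σ i, Fin (n i) => p.2.val) (sumOut_sumMk (n := n) ⟨0, i⟩))

namespace Operad

/-! ### Operations given by the objects of an operadic category -/

section reflection

variable {O : Type u} [Category.{v} O] [OperadicCategory O]

/-- The terminal operad has one element over each object, so compatibility of the unit of the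
adjunction with structure maps is one equation between classes for each morphism. -/
theorem reflectionClass_μ {T S : O} (f : T ⟶ S) : reflectionClass T =
    (reflection O).μ (arityMap f) (fun i => arity (fib f i)) (arity_fib f)
      (fun i => reflectionClass (fib f i)) (reflectionClass S) :=
  (lanUnit (arityFunctor O) (terminal.{u, v, u} O)).app_μ f (fib f) (fun _ => rfl)
    (fun _ => PUnit.unit) PUnit.unit

theorem reflectionClass_one {T : O} (h : IsTrivial T) : reflectionClass T =
    (reflection O).one (arity T) ((arityFunctor O).isTrivial_obj h) :=
  (lanUnit (arityFunctor O) (terminal.{u, v, u} O)).app_one T h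

namespace Action

variable (𝒜 : Action (reflection O))

/-- The operation given by an object. -/
noncomputable def val (T : O) (a : Fin (card T) → 𝒜.carrier) : 𝒜.carrier :=
  𝒜.act (reflectionClass T) a

/-- The source of all relations in the reflection except the unit relations: below, each of them is
obtained by choosing `f` suitably. -/
theorem val_hom {T S : O} (f : T ⟶ S) (a : Fin (card T) → 𝒜.carrier) :
    𝒜.val T a = 𝒜.val S (fun i => 𝒜.val (fib f i) (fun k => a (inc f i k))) := by
  unfold val
  rw [reflectionClass_μ f]
  exact 𝒜.act_μ (arityMap f) _ (arity_fib f) (fun i => inc f i) (fun i k => mem_range_inc f i k) _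
    (reflectionClass S) a

theorem val_of_isTrivial {T : O} (h : IsTrivial T) (a : Fin (card T) → 𝒜.carrier)
    (i : Fin (card T)) (ha : 𝒜.HasColour (a i) (π₀ (fib (𝟙 T) i))) : 𝒜.val T a = a i := by
  unfold val
  rw [reflectionClass_one h]
  exact 𝒜.act_one (arity T) _ a i ha

end Action

end reflection

/-! ### Operations given by the objects of a wreath product -/

section wreath

variable {A : Type u} [Category.{v} A] [OperadicCategory A]
  {B : Type u} [Category.{v} B] [OperadicCategory B]

namespace Action

variable (𝒜 : Action (reflection (Wreath A B)))

/-- The operation given by an object of a wreath product. -/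
noncomputable def wval (T : Wreath A B) (a : (Σ i, Fin (card (T.snd i))) → 𝒜.carrier) :
    𝒜.carrier :=
  𝒜.val T (fun k => a (sumOut k))

/-- With arguments indexed by pairs, the encoding of ordinal sums cancels out of `val_hom`. -/
theorem wval_hom {T S : Wreath A B} (α : T ⟶ S) (a : (Σ i, Fin (card (T.snd i))) → 𝒜.carrier) :
    𝒜.wval T a =
      𝒜.wval S (fun p => 𝒜.wval (Wreath.fibre α p) (fun q => a (Wreath.fibreFun α p q))) := by
  refine (𝒜.val_hom α _).trans ?_
  refine congrArg (𝒜.val S) (funext fun k => congrArg (𝒜.val _) (funext fun l => ?_))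
  exact congrArg a (sumOut_sumMk _)

theorem wval_congr {T T' : Wreath A B} (h : T = T')
    {a : (Σ i, Fin (card (T.snd i))) → 𝒜.carrier} {a' : (Σ i, Fin (card (T'.snd i))) → 𝒜.carrier}
    (ha : ∀ p p', p.1.val = p'.1.val → p.2.val = p'.2.val → a p = a' p') :
    𝒜.wval T a = 𝒜.wval T' a' := by
  subst h
  exact congrArg (𝒜.wval T) (funext fun p => ha p p rfl rfl)

end Action

end wreath

/-! ### Connected components of the wreath product as pairs of colours -/

section colours

variable {C D : Type u}

/-- The colour of a connected component of `∫ X`. -/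
noncomputable def compColour {X : Operad.{u, 0, u} (Bq C)} : Pi0 (Groth X) → C :=
  Pi0.lift (fun t => t.base.root) (fun {_ _} (φ : Groth.Hom _ _) => φ.f.root_eq)

/-- An element `t` of `X` has a morphism to the unit of its output colour, which is the chosen
object of its component. -/
theorem π₀_unitObj {X : Operad.{u, 0, u} (Bq C)} (c : Pi0 (Groth X)) :
    π₀ (unitObj X (compColour c)) = c := by
  induction c using Quotient.inductionOn with
  | h t => exact (π₀_eq_of_hom (toChosen t)).symm

variable (X : Operad.{u, 0, u} (Bq C)) (Y : Operad.{u, 0, u} (Bq D))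

/-- The pair of colours of a connected component of `∫ X ≀ ∫ Y`. -/
noncomputable def wreathColour : Pi0 (Wreath (Groth X) (Groth Y)) → C × D :=
  Pi0.lift (fun T => (T.fst.base.root, compColour T.comp))
    (fun {_ _} (α : Wreath.Hom _ _) => Prod.ext α.φ.f.root_eq (congrArg compColour α.comp_eq))

/-- The connected components of `∫ X ≀ ∫ Y` are the pairs of colours. -/
noncomputable def colourEquiv : C × D ≃ Pi0 (Wreath (Groth X) (Groth Y)) where
  toFun p := π₀ (wreathLeft Y (unitObj X p.1).el p.2)
  invFun := wreathColour X Y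
  left_inv _ := rfl
  right_inv c := by
    induction c using Quotient.inductionOn with
    | h T =>
      -- `T` maps to the chosen object of its component, which is `(u_c; v_d)` for the colours of
      -- `T`.
      refine Eq.trans ?_ (π₀_eq_of_hom (Wreath.toTriv T)).symm
      refine congrArg π₀ (Wreath.eq_of rfl (π₀_unitObj T.comp) (fun i j _ => ?_))
      exact (congrArg chosen (π₀_unitObj T.comp))

variable {X Y}

/-- A component is recognised by its colours, which are computed on a representative. -/
theorem colourEquiv_eq {p : C × D} {c : Pi0 (Wreath (Groth X) (Groth Y))}
    (h : wreathColour X Y c = p) : c = colourEquiv X Y p := by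
  rw [← h]
  exact ((colourEquiv X Y).apply_symm_apply c).symm

/-- The two bouquets are not definitionally equal: the inputs on the left are numbered by a sum of
ones. The class of `(x; v_d, …, v_d)` has to be transported along this equality to serve as the
image of `x ⊗ d`. -/
theorem arity_wreathLeft {b : Bq C} (x : X.obj b) (d : D) : arity (wreathLeft Y x d) =
    Bq.map (colourEquiv X Y) (Bq.map (fun c => (c, d)) b) := by
  refine Bq.ext' ?_ (fun k k' hk => colourEquiv_eq ?_) (colourEquiv_eq rfl)
  · exact (Finset.sum_const _).trans ((congrArg (· • 1) (Finset.card_fin b.n)).trans (Nat.mul_one _))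
  · refine Prod.ext (congrArg b.leaf (a₁ := (sumOut k).1) (Fin.ext ?_)) rfl
    exact (sumOut_fst_val (k := b.n) (n := fun _ => 1) (fun _ => rfl) k).trans hk

theorem arity_wreathRight (c : C) {b : Bq D} (y : Y.obj b) : arity (wreathRight X c y) =
    Bq.map (colourEquiv X Y) (Bq.map (fun d => (c, d)) b) := by
  refine Bq.ext' ?_ (fun k k' hk => colourEquiv_eq ?_) (colourEquiv_eq rfl)
  · exact (Finset.sum_const (s := (Finset.univ : Finset (Fin 1))) b.n).trans (Nat.one_mul _)
  · refine Prod.ext rfl (congrArg b.leaf (a₁ := (sumOut k).2) (Fin.ext ?_))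
    exact (sumOut_snd_val (k := 1) (n := fun _ => b.n) rfl k).trans hk

end colours

/-! ### The relations of the tensor product, as identities between operations of the reflection -/

section generators

variable {C D : Type u} {X : Operad.{u, 0, u} (Bq C)} {Y : Operad.{u, 0, u} (Bq D)}

theorem isTrivial_unitObj (c : C) : IsTrivial (unitObj X c) := rfl

namespace Action

variable (𝒜 : Action (reflection (Wreath (Groth X) (Groth Y))))

/-- The operation given by `(x; v_d, …, v_d)`. -/
noncomputable def wleft {b : Bq C} (x : X.obj b) (d : D) (a : Fin b.n → 𝒜.carrier) : 𝒜.carrier :=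
  𝒜.wval (wreathLeft Y x d) (fun p => a p.1)

/-- The operation given by `(u_c; y)`. -/
noncomputable def wright (c : C) {b : Bq D} (y : Y.obj b) (a : Fin b.n → 𝒜.carrier) : 𝒜.carrier :=
  𝒜.wval (wreathRight X c y) (fun p => a p.2)

theorem wleft_one (d : D) {b : Bq C} (h : IsTrivial b) (a : Fin b.n → 𝒜.carrier) (i : Fin b.n)
    (ha : 𝒜.HasColour (a i) (colourEquiv X Y (b.leaf i, d))) :
    𝒜.wleft (X.one b h) d a = a i := by
  obtain ⟨c, rfl⟩ : ∃ c, b = Bq.triv c := ⟨_, Bq.eq_triv_of_isTrivial h⟩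
  -- The object is `(u_c; v_d)`, the chosen object of its component, so its class is a unit.
  have hT : IsTrivial (wreathLeft Y (X.one (Bq.triv c) h) d) := rfl
  have hi : ∀ j : Fin 1, a j = a i := fun j => congrArg a (Subsingleton.elim (α := Fin 1) j i)
  have hk := hT.card_eq
  refine (𝒜.val_of_isTrivial hT _ ⟨0, by rw [hk]; exact Nat.one_pos⟩ ?_).trans (hi _)
  exact (congrArg₂ 𝒜.HasColour (hi _) (congrArg π₀ (hT.fib_eq _ _))).mpr ha

theorem wright_one (c : C) {b : Bq D} (h : IsTrivial b) (a : Fin b.n → 𝒜.carrier) (i : Fin b.n)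
    (ha : 𝒜.HasColour (a i) (colourEquiv X Y (c, b.leaf i))) :
    𝒜.wright c (Y.one b h) a = a i := by
  obtain ⟨d, rfl⟩ : ∃ d, b = Bq.triv d := ⟨_, Bq.eq_triv_of_isTrivial h⟩
  have hT : IsTrivial (wreathRight X c (Y.one (Bq.triv d) h)) := rfl
  have hi : ∀ j : Fin 1, a j = a i := fun j => congrArg a (Subsingleton.elim (α := Fin 1) j i)
  have hk := hT.card_eq
  refine (𝒜.val_of_isTrivial hT _ ⟨0, by rw [hk]; exact Nat.one_pos⟩ ?_).trans (hi _)
  exact (congrArg₂ 𝒜.HasColour (hi _) (congrArg π₀ (hT.fib_eq _ _))).mpr ha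

/-- Apply `wval_hom` to the morphism given by `(f, ε)` on the first factor and by identities of
`v_d` on the second; its fibre over `i` is `(ε_i; v_d, …, v_d)`. -/
theorem wleft_μ {b b' : Bq C} (f : b ⟶ b') (ε : ∀ i : Fin b'.n, X.obj (Bq.fibre f i))
    (x : X.obj b') (d : D) (a : Fin b.n → 𝒜.carrier) :
    𝒜.wleft (X.μ f (fib f) (fun _ => rfl) ε x) d a =
      𝒜.wleft x d (fun i => 𝒜.wleft (ε i) d (fun k => a (Bq.fibreInc f i k))) := by
  let α : wreathLeft Y (X.μ f (fib f) (fun _ => rfl) ε x) d ⟶ wreathLeft Y x d :=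
    Wreath.Hom.mk (Groth.Hom.mk f ε rfl) (fun _ _ _ => 𝟙 (unitObj Y d)) rfl
  refine (𝒜.wval_hom α _).trans (congrArg (𝒜.wval _) (funext fun p => ?_))
  have h : fib (𝟙 (unitObj Y d)) p.2 = unitObj Y d := (isTrivial_unitObj d).fib_eq _ _
  refine 𝒜.wval_congr (T' := wreathLeft Y (ε p.1) d)
    (Wreath.eq_of (X := Wreath.fibre α p) rfl (congrArg π₀ h) (fun _ _ _ => h)) ?_
  intro q q' hq _
  exact congrArg (fun k => a (Bq.fibreInc f p.1 k)) (Fin.ext hq)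

/-- Apply `wval_hom` to the morphism given by the identity of `u_c` and by `(f, ε)`; its fibre over
`j` is `(u_c; ε_j)`. -/
theorem wright_μ (c : C) {b b' : Bq D} (f : b ⟶ b') (ε : ∀ i : Fin b'.n, Y.obj (Bq.fibre f i))
    (y : Y.obj b') (a : Fin b.n → 𝒜.carrier) :
    𝒜.wright c (Y.μ f (fib f) (fun _ => rfl) ε y) a =
      𝒜.wright c y (fun i => 𝒜.wright c (ε i) (fun k => a (Bq.fibreInc f i k))) := by
  let φ : (⟨b, Y.μ f (fib f) (fun _ => rfl) ε y⟩ : Groth Y) ⟶ ⟨b', y⟩ := Groth.Hom.mk f ε rfl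
  let α : wreathRight X c (Y.μ f (fib f) (fun _ => rfl) ε y) ⟶ wreathRight X c y :=
    Wreath.Hom.mk (𝟙 (unitObj X c)) (fun _ _ _ => φ) (π₀_eq_of_hom φ)
  refine (𝒜.wval_hom α _).trans (congrArg (𝒜.wval _) (funext fun p => ?_))
  have h : fib (𝟙 (unitObj X c)) p.1 = unitObj X c := (isTrivial_unitObj c).fib_eq _ _
  refine 𝒜.wval_congr (Wreath.eq_of h (π₀_fib φ p.2).symm (fun _ _ _ => rfl)) ?_
  intro q q' _ hq
  exact congrArg (fun k => a (Bq.fibreInc f p.2 k)) (Fin.ext hq)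

/-- The decomposition of `(x; y_1, …, y_n)` into `x` and `y_1, …, y_n`. -/
theorem wval_eq (T : Wreath (Groth X) (Groth Y))
    (a : (Σ i, Fin (card (T.snd i))) → 𝒜.carrier) : 𝒜.wval T a =
      𝒜.wleft T.fst.el (compColour T.comp) (fun i =>
        𝒜.wright (T.fst.base.leaf i) (T.snd i).el (fun j => a ⟨i, j⟩)) := by
  let ψ : ∀ i, T.snd i ⟶ unitObj Y (compColour T.comp) := fun i =>
    toChosen (T.snd i) ≫ eqToHom (congrArg (fun c => unitObj Y (compColour c)) (T.π₀_snd i))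
  -- This morphism keeps `x` and sends each `y_i` to the terminal object `v_d`. Its fibre over `i`
  -- is `(u_{c_i}; y_i)`: a fibre of an identity is a unit, and a fibre over a chosen terminal
  -- object is the whole domain.
  let α : T ⟶ wreathLeft Y T.fst.el (compColour T.comp) :=
    Wreath.Hom.mk (𝟙 T.fst) (fun i _ _ => ψ i) (π₀_unitObj T.comp).symm
  refine (𝒜.wval_hom α _).trans (congrArg (𝒜.wval _) (funext fun p => ?_))
  have h : fib (𝟙 T.fst) p.1 = unitObj X (T.fst.base.leaf p.1) :=
    isTrivial_fib_id T.fst p.1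
  have hinc : ∀ s, inc (𝟙 T.fst) p.1 s = p.1 := fun s => inc_id _ _ s
  have h' : ∀ s, fib (ψ (inc (𝟙 T.fst) p.1 s)) p.2 = T.snd p.1 := fun s =>
    ((isTrivial_unitObj (compColour T.comp)).fib_eq _ _).trans (congrArg T.snd (hinc s))
  refine 𝒜.wval_congr (Wreath.eq_of h ?_ (fun s _ _ => h' s)) ?_
  · refine Eq.trans ?_ (T.π₀_snd p.1).symm
    refine (congrArg π₀ ((isTrivial_unitObj (compColour T.comp)).fib_eq (𝟙 _) p.2)).trans ?_
    exact π₀_unitObj T.comp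
  · intro q q' _ hq
    exact congrArg a (sigma_fin_ext (hinc q.1)
      ((inc_val_of_isTrivial (isTrivial_unitObj (compColour T.comp)) _ p.2 q.2).trans hq))

/-- The interchange relation. -/
theorem wleft_wright {b : Bq C} {b' : Bq D} (x : X.obj b) (y : Y.obj b')
    (a : Fin b.n → Fin b'.n → 𝒜.carrier) :
    𝒜.wleft x b'.root (fun i => 𝒜.wright (b.leaf i) y (fun j => a i j)) =
      𝒜.wright b.root y (fun j => 𝒜.wleft x (b'.leaf j) (fun i => a i j)) := by
  -- Both sides compute the operation of `(x; y, …, y)`. The left one is its decomposition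
  -- `wval_eq`.
  let T : Wreath (Groth X) (Groth Y) := ⟨⟨b, x⟩, π₀ (⟨b', y⟩ : Groth Y), fun _ => ⟨b', y⟩,
    fun _ => rfl⟩
  refine (𝒜.wval_eq T (fun p => a p.1 p.2)).symm.trans ?_
  let φ : (⟨b, x⟩ : Groth X) ⟶ unitObj X b.root := toChosen (⟨b, x⟩ : Groth X)
  -- The second decomposition: the fibre over the input `j` of `y` is `(x; v_{d_j}, …, v_{d_j})`.
  let α : T ⟶ wreathRight X b.root y := Wreath.Hom.mk φ (fun _ _ _ => 𝟙 _) rfl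
  refine (𝒜.wval_hom α _).trans (congrArg (𝒜.wval _) (funext fun p => ?_))
  have h : fib φ p.1 = ⟨b, x⟩ := (isTrivial_unitObj b.root).fib_eq _ _
  have h' : fib (𝟙 (⟨b', y⟩ : Groth Y)) p.2 = unitObj Y (b'.leaf p.2) :=
    isTrivial_fib_id (⟨b', y⟩ : Groth Y) p.2
  refine 𝒜.wval_congr (Wreath.eq_of h (congrArg π₀ h') (fun _ _ _ => h')) ?_
  intro q q' hq _
  refine congrArg₂ a (Fin.ext ?_) (inc_id (⟨b', y⟩ : Groth Y) p.2 q.2)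
  exact (inc_val_of_isTrivial (isTrivial_unitObj b.root) φ p.1 q.1).trans hq

end Action

end generators

end Operad

namespace Operad

section

variable {C D : Type u} {X : Operad.{u, 0, u} (Bq C)} {Y : Operad.{u, 0, u} (Bq D)}

/-! ## From the tensor product to the reflection -/

/-- The images of the generators of the tensor product. -/
noncomputable def bvToReflectionGen : ∀ b : Bq (C × D), BVGen X Y b →
    ((Bq.mapFunctor (colourEquiv X Y)).restrict (reflection (Wreath (Groth X) (Groth Y)))).obj b
  | _, .left x d => cast (congrArg (reflection _).obj (arity_wreathLeft x d))
      (reflectionClass (wreathLeft Y x d))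
  | _, .right c y => cast (congrArg (reflection _).obj (arity_wreathRight c y))
      (reflectionClass (wreathRight X c y))

namespace Action

variable (𝒜 : Action (reflection (Wreath (Groth X) (Groth Y))))

theorem act_bvToReflectionGen_left {b : Bq C} (x : X.obj b) (d : D) (a : Fin b.n → 𝒜.carrier) :
    𝒜.act (b := Bq.map (colourEquiv X Y) (Bq.map (fun c => (c, d)) b))
      (bvToReflectionGen _ (BVGen.left x d)) a = 𝒜.wleft x d a := by
  refine 𝒜.act_congr (arity_wreathLeft x d).symm (cast_heq _ _) (fun k k' hk => ?_)
  refine congrArg a (Fin.ext ?_)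
  exact hk.trans (sumOut_fst_val (k := b.n) (n := fun _ => 1) (fun _ => rfl) k').symm

theorem act_bvToReflectionGen_right (c : C) {b : Bq D} (y : Y.obj b) (a : Fin b.n → 𝒜.carrier) :
    𝒜.act (b := Bq.map (colourEquiv X Y) (Bq.map (fun d => (c, d)) b))
      (bvToReflectionGen _ (BVGen.right c y)) a = 𝒜.wright c y a := by
  refine 𝒜.act_congr (arity_wreathRight c y).symm (cast_heq _ _) (fun k k' hk => ?_)
  refine congrArg a (Fin.ext ?_)
  exact hk.trans (sumOut_snd_val (k := 1) (n := fun _ => b.n) rfl k').symm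

end Action

theorem mem_range_prodFst {n m : ℕ} (i : Fin n) (k : Fin (n * m)) :
    k ∈ Set.range (fun j : Fin m => finProdFinEquiv (i, j)) ↔ (finProdFinEquiv.symm k).1 = i := by
  constructor
  · rintro ⟨j, rfl⟩
    simp
  · rintro rfl
    exact ⟨(finProdFinEquiv.symm k).2, finProdFinEquiv.apply_symm_apply k⟩

theorem mem_range_prodSnd {n m : ℕ} (j : Fin m) (k : Fin (n * m)) :
    k ∈ Set.range (fun i : Fin n => finProdFinEquiv (i, j)) ↔ (finProdFinEquiv.symm k).2 = j := by
  constructor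
  · rintro ⟨j, rfl⟩
    simp
  · rintro rfl
    exact ⟨(finProdFinEquiv.symm k).1, finProdFinEquiv.apply_symm_apply k⟩

/-- The inclusion of a row in the lexicographically ordered product. -/
def rowEmb {n : ℕ} (m : ℕ) (i : Fin n) : Fin m ↪o Fin (n * m) :=
  OrderEmbedding.ofStrictMono (fun j => finProdFinEquiv (i, j)) fun j j' h => by
    have h : j.val < j'.val := h
    rw [Fin.lt_def, finProdFinEquiv_apply_val, finProdFinEquiv_apply_val]
    dsimp only
    omega

/-- The inclusion of a column in the lexicographically ordered product. -/
def colEmb (n : ℕ) {m : ℕ} (j : Fin m) : Fin n ↪o Fin (n * m) :=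
  OrderEmbedding.ofStrictMono (fun i => finProdFinEquiv (i, j)) fun i i' h => by
    have h0 : m * i.val < m * i'.val := Nat.mul_lt_mul_of_pos_left h (Fin.pos j)
    rw [Fin.lt_def, finProdFinEquiv_apply_val, finProdFinEquiv_apply_val]
    dsimp only
    omega

/-- By `ext_of_action` each relation is tested in an arbitrary action, where `act_μ` unfolds the
composites and the relation becomes one of the identities for `wleft` and `wright`. In the unit
relations the colour of the argument is needed on both sides. -/
theorem bvToReflectionGen_rel (b : Bq (C × D)) (s t : Term (BVGen X Y) b) (h : BVRel X Y b s t) :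
    s.eval _ (bvToReflectionGen (X := X) (Y := Y)) = t.eval _ bvToReflectionGen := by
  cases h with
  | left_one d b h =>
    refine ext_of_action (Q := reflection (Wreath (Groth X) (Groth Y)))
      (T := Bq.map (colourEquiv X Y) (Bq.map _ b)) fun 𝒜 a ha => ?_
    have hb : b.n = 1 := h.card_eq
    let i : Fin b.n := ⟨0, hb ▸ Nat.one_pos⟩
    refine (𝒜.act_bvToReflectionGen_left _ d a).trans ((𝒜.wleft_one d h a i (ha i)).trans ?_)
    exact (𝒜.act_one _ _ a i (ha i)).symm
  | right_one c b h =>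
    refine ext_of_action (Q := reflection (Wreath (Groth X) (Groth Y)))
      (T := Bq.map (colourEquiv X Y) (Bq.map _ b)) fun 𝒜 a ha => ?_
    have hb : b.n = 1 := h.card_eq
    let i : Fin b.n := ⟨0, hb ▸ Nat.one_pos⟩
    refine (𝒜.act_bvToReflectionGen_right c _ a).trans ((𝒜.wright_one c h a i (ha i)).trans ?_)
    exact (𝒜.act_one _ _ a i (ha i)).symm
  | @left_μ d b b' f F hF ε x =>
    obtain rfl : F = Bq.fibre f := funext hF
    refine ext_of_action (Q := reflection (Wreath (Groth X) (Groth Y)))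
      (T := Bq.map (colourEquiv X Y) (Bq.map _ b)) fun 𝒜 a _ => ?_
    refine (𝒜.act_bvToReflectionGen_left _ d a).trans ((𝒜.wleft_μ f ε x d a).trans ?_)
    symm
    refine (𝒜.act_μ ((Bq.mapFunctor (colourEquiv X Y)).functor.map
      ((Bq.mapFunctor (fun c => (c, d))).functor.map f)) _ (fun _ => rfl) (Bq.fibreInc f)
      (Bq.mem_range_fibreInc f) _ _ a).trans ?_
    refine (𝒜.act_bvToReflectionGen_left x d _).trans ?_
    exact congrArg (𝒜.wleft x d) (funext fun i => 𝒜.act_bvToReflectionGen_left (ε i) d _)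
  | @right_μ c b b' f F hF ε y =>
    obtain rfl : F = Bq.fibre f := funext hF
    refine ext_of_action (Q := reflection (Wreath (Groth X) (Groth Y)))
      (T := Bq.map (colourEquiv X Y) (Bq.map _ b)) fun 𝒜 a _ => ?_
    refine (𝒜.act_bvToReflectionGen_right c _ a).trans ((𝒜.wright_μ c f ε y a).trans ?_)
    symm
    refine (𝒜.act_μ ((Bq.mapFunctor (colourEquiv X Y)).functor.map
      ((Bq.mapFunctor (fun d => (c, d))).functor.map f)) _ (fun _ => rfl) (Bq.fibreInc f)
      (Bq.mem_range_fibreInc f) _ _ a).trans ?_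
    refine (𝒜.act_bvToReflectionGen_right c y _).trans ?_
    exact congrArg (𝒜.wright c y) (funext fun i => 𝒜.act_bvToReflectionGen_right c (ε i) _)
  | @interchange b b' x y =>
    refine ext_of_action (Q := reflection (Wreath (Groth X) (Groth Y)))
      (T := Bq.map (colourEquiv X Y) (b.prod b')) fun 𝒜 a _ => ?_
    -- The fibres of the first projection are the rows, those of the second the columns, of the
    -- lexicographically ordered product.
    have hl := 𝒜.act_μ ((Bq.mapFunctor (colourEquiv X Y)).functor.map (b.prodFst b'))
      (fun i => Bq.map (colourEquiv X Y) (Bq.map (fun d => (b.leaf i, d)) b'))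
      (fun i => congrArg (Bq.map (colourEquiv X Y)) (b.prodFst_fib b' i))
      (fun i => rowEmb b'.n i) (fun i => mem_range_prodFst i)
      (fun i => bvToReflectionGen _ (BVGen.right (b.leaf i) y))
      (bvToReflectionGen _ (BVGen.left x b'.root)) a
    have hr := 𝒜.act_μ ((Bq.mapFunctor (colourEquiv X Y)).functor.map (b.prodSnd b'))
      (fun j => Bq.map (colourEquiv X Y) (Bq.map (fun c => (c, b'.leaf j)) b))
      (fun j => congrArg (Bq.map (colourEquiv X Y)) (b.prodSnd_fib b' j))
      (fun j => colEmb b.n j) (fun j => mem_range_prodSnd j)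
      (fun j => bvToReflectionGen _ (BVGen.left x (b'.leaf j)))
      (bvToReflectionGen _ (BVGen.right b.root y)) a
    refine hl.trans (Eq.trans ?_ hr.symm)
    refine (𝒜.act_bvToReflectionGen_left x b'.root _).trans
      (Eq.trans ?_ (𝒜.act_bvToReflectionGen_right b.root y _).symm)
    refine Eq.trans (congrArg (𝒜.wleft x b'.root) (funext fun i =>
      𝒜.act_bvToReflectionGen_right (b.leaf i) y _)) ?_
    refine Eq.trans ?_ (congrArg (𝒜.wright b.root y) (funext fun j =>
      (𝒜.act_bvToReflectionGen_left x (b'.leaf j) _).symm))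
    exact 𝒜.wleft_wright x y (fun i j => a (finProdFinEquiv (i, j)))

variable (X Y) in
theorem exists_bvToReflection : ∃ α : bvTensor X Y ⟶ (Bq.mapFunctor (colourEquiv X Y)).restrict
    (reflection (Wreath (Groth X) (Groth Y))),
    ∀ (b : Bq (C × D)) (x : BVGen X Y b), α.app b (presentedGen (BVRel X Y) x) =
      bvToReflectionGen b x :=
  (presented_universal _ bvToReflectionGen bvToReflectionGen_rel).exists

/-! ## Actions of the tensor product -/

namespace Action

variable (𝒜 : Action (bvTensor X Y))

/-- The operation given by `x ⊗ d`. -/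
noncomputable def bvl {b : Bq C} (x : X.obj b) (d : D) (a : Fin b.n → 𝒜.carrier) : 𝒜.carrier :=
  𝒜.act (bvLeft Y x d) a

/-- The operation given by `c ⊗ y`. -/
noncomputable def bvr (c : C) {b : Bq D} (y : Y.obj b) (a : Fin b.n → 𝒜.carrier) : 𝒜.carrier :=
  𝒜.act (bvRight X c y) a

theorem bvl_one (d : D) {b : Bq C} (h : IsTrivial b) (a : Fin b.n → 𝒜.carrier) (i : Fin b.n)
    (ha : 𝒜.HasColour (a i) (b.leaf i, d)) : 𝒜.bvl (X.one b h) d a = a i := by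
  have H : bvLeft Y (X.one b h) d = (bvTensor X Y).one _
      ((Bq.mapFunctor (fun c => (c, d))).isTrivial_obj h) :=
    Quotient.sound (Term.Rel.of (BVRel.left_one d b h))
  refine (congrArg (fun q => 𝒜.act q a) H).trans ?_
  exact 𝒜.act_one (Bq.map (fun c => (c, d)) b) _ a i ha

theorem bvr_one (c : C) {b : Bq D} (h : IsTrivial b) (a : Fin b.n → 𝒜.carrier) (i : Fin b.n)
    (ha : 𝒜.HasColour (a i) (c, b.leaf i)) : 𝒜.bvr c (Y.one b h) a = a i := by
  have H : bvRight X c (Y.one b h) = (bvTensor X Y).one _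
      ((Bq.mapFunctor (fun d => (c, d))).isTrivial_obj h) :=
    Quotient.sound (Term.Rel.of (BVRel.right_one c b h))
  refine (congrArg (fun q => 𝒜.act q a) H).trans ?_
  exact 𝒜.act_one (Bq.map (fun d => (c, d)) b) _ a i ha

theorem bvl_μ {b b' : Bq C} (f : b ⟶ b') (ε : ∀ i : Fin b'.n, X.obj (Bq.fibre f i))
    (x : X.obj b') (d : D) (a : Fin b.n → 𝒜.carrier) :
    𝒜.bvl (X.μ f (fib f) (fun _ => rfl) ε x) d a =
      𝒜.bvl x d (fun i => 𝒜.bvl (ε i) d (fun k => a (Bq.fibreInc f i k))) := by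
  have h : bvLeft Y (X.μ f (fib f) (fun _ => rfl) ε x) d = (bvTensor X Y).μ
      ((Bq.mapFunctor (fun c => (c, d))).functor.map f)
      (fun i => Bq.map (fun c => (c, d)) (Bq.fibre f i)) (fun _ => rfl)
      (fun i => bvLeft Y (ε i) d) (bvLeft Y x d) :=
    (Quotient.sound (Term.Rel.of (BVRel.left_μ d f (fib f) (fun _ => rfl) ε x))).trans
      (presented_μ_cls _ _ _ _ _ _).symm
  refine (congrArg (fun q => 𝒜.act q a) h).trans ?_
  exact 𝒜.act_μ ((Bq.mapFunctor (fun c => (c, d))).functor.map f) _ (fun _ => rfl)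
    (Bq.fibreInc f) (Bq.mem_range_fibreInc f) _ _ a

theorem bvr_μ (c : C) {b b' : Bq D} (f : b ⟶ b') (ε : ∀ i : Fin b'.n, Y.obj (Bq.fibre f i))
    (y : Y.obj b') (a : Fin b.n → 𝒜.carrier) :
    𝒜.bvr c (Y.μ f (fib f) (fun _ => rfl) ε y) a =
      𝒜.bvr c y (fun i => 𝒜.bvr c (ε i) (fun k => a (Bq.fibreInc f i k))) := by
  have h : bvRight X c (Y.μ f (fib f) (fun _ => rfl) ε y) = (bvTensor X Y).μ
      ((Bq.mapFunctor (fun d => (c, d))).functor.map f)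
      (fun i => Bq.map (fun d => (c, d)) (Bq.fibre f i)) (fun _ => rfl)
      (fun i => bvRight X c (ε i)) (bvRight X c y) :=
    (Quotient.sound (Term.Rel.of (BVRel.right_μ c f (fib f) (fun _ => rfl) ε y))).trans
      (presented_μ_cls _ _ _ _ _ _).symm
  refine (congrArg (fun q => 𝒜.act q a) h).trans ?_
  exact 𝒜.act_μ ((Bq.mapFunctor (fun d => (c, d))).functor.map f) _ (fun _ => rfl)
    (Bq.fibreInc f) (Bq.mem_range_fibreInc f) _ _ a

/-- The interchange relation evaluated on the family whose argument at the lexicographic position of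
`(i, j)` is `a i j`. -/
theorem bvl_bvr {b : Bq C} {b' : Bq D} (x : X.obj b) (y : Y.obj b')
    (a : Fin b.n → Fin b'.n → 𝒜.carrier) :
    𝒜.bvl x b'.root (fun i => 𝒜.bvr (b.leaf i) y (fun j => a i j)) =
      𝒜.bvr b.root y (fun j => 𝒜.bvl x (b'.leaf j) (fun i => a i j)) := by
  have h : (bvTensor X Y).μ (b.prodFst b') (fun i => Bq.map (fun d => (b.leaf i, d)) b')
        (b.prodFst_fib b') (fun i => bvRight X (b.leaf i) y) (bvLeft Y x b'.root) =
      (bvTensor X Y).μ (b.prodSnd b') (fun j => Bq.map (fun c => (c, b'.leaf j)) b)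
        (b.prodSnd_fib b') (fun j => bvLeft Y x (b'.leaf j)) (bvRight X b.root y) :=
    (presented_μ_cls _ _ _ _ _ _).trans
      ((Quotient.sound (Term.Rel.of (BVRel.interchange x y))).trans
        (presented_μ_cls _ _ _ _ _ _).symm)
  have h' := congrArg (fun q => 𝒜.act q
    (fun k => a (finProdFinEquiv.symm k).1 (finProdFinEquiv.symm k).2)) h
  have hl := 𝒜.act_μ (b.prodFst b') _ (b.prodFst_fib b') (fun i => rowEmb b'.n i)
    (fun i => mem_range_prodFst i) (fun i => bvRight X (b.leaf i) y) (bvLeft Y x b'.root)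
    (fun k => a (finProdFinEquiv.symm k).1 (finProdFinEquiv.symm k).2)
  have hr := 𝒜.act_μ (b.prodSnd b') _ (b.prodSnd_fib b') (fun j => colEmb b.n j)
    (fun j => mem_range_prodSnd j) (fun j => bvLeft Y x (b'.leaf j)) (bvRight X b.root y)
    (fun k => a (finProdFinEquiv.symm k).1 (finProdFinEquiv.symm k).2)
  have hs : ∀ i j, a (finProdFinEquiv.symm (finProdFinEquiv (i, j))).1
      (finProdFinEquiv.symm (finProdFinEquiv (i, j))).2 = a i j := fun i j => by
    rw [Equiv.symm_apply_apply]
  refine Eq.trans ?_ (hl.symm.trans (h'.trans (hr.trans ?_)))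
  · exact congrArg (𝒜.bvl x b'.root) (funext fun i =>
      congrArg (𝒜.bvr (b.leaf i) y) (funext fun j => (hs i j).symm))
  · exact congrArg (𝒜.bvr b.root y) (funext fun j =>
      congrArg (𝒜.bvl x (b'.leaf j)) (funext fun i => hs i j))

/-- The operation given by `(x; y_1, …, y_n)`. -/
noncomputable def bvw (T : Wreath (Groth X) (Groth Y))
    (a : (Σ i, Fin (card (T.snd i))) → 𝒜.carrier) : 𝒜.carrier :=
  𝒜.bvl T.fst.el (compColour T.comp) (fun i =>
    𝒜.bvr (T.fst.base.leaf i) (T.snd i).el (fun j => a ⟨i, j⟩))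

theorem bvl_hom {t s : Groth X} (φ : t ⟶ s) (d : D) (a : Fin t.base.n → 𝒜.carrier) :
    𝒜.bvl t.el d a =
      𝒜.bvl s.el d (fun i => 𝒜.bvl (φ.ε i) d (fun k => a (Bq.fibreInc φ.f i k))) := by
  exact (congrArg (fun x => 𝒜.bvl x d a) φ.eq.symm).trans (𝒜.bvl_μ φ.f φ.ε s.el d a)

theorem bvr_hom (c : C) {t s : Groth Y} (φ : t ⟶ s) (a : Fin t.base.n → 𝒜.carrier) :
    𝒜.bvr c t.el a =
      𝒜.bvr c s.el (fun i => 𝒜.bvr c (φ.ε i) (fun k => a (Bq.fibreInc φ.f i k))) := by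
  exact (congrArg (fun x => 𝒜.bvr c x a) φ.eq.symm).trans (𝒜.bvr_μ c φ.f φ.ε s.el a)

/-- The counterpart of `wval_hom`. Let `x` and `z` be the first entries of `T` and `S`. Expanding
`x` along `α.φ` leaves, under each input `t` of `z`, the element `ε_t` applied to the `y_s` with `s`
over `t`. Each such `y_s` is then expanded over the common `w_t`, and one interchange of `ε_t` with
`w_t` makes the operations of the fibres appear. -/
theorem bvw_hom {T S : Wreath (Groth X) (Groth Y)} (α : T ⟶ S)
    (a : (Σ i, Fin (card (T.snd i))) → 𝒜.carrier) : 𝒜.bvw T a =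
      𝒜.bvw S (fun p => 𝒜.bvw (Wreath.fibre α p) (fun q => a (Wreath.fibreFun α p q))) := by
  have hc : compColour T.comp = compColour S.comp := congrArg compColour α.comp_eq
  have hr : ∀ t, compColour T.comp = (S.snd t).base.root := fun t =>
    hc.trans (congrArg compColour (S.π₀_snd t)).symm
  unfold bvw
  refine (𝒜.bvl_hom α.φ _ _).trans ?_
  rw [hc]
  refine congrArg (𝒜.bvl S.fst.el _) (funext fun t => ?_)
  -- Interchange expects the second colour to be the output colour of `w_t`. It can be written so
  -- only under an input `t`, since `S` may have none.
  rw [← hc, hr t]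
  refine Eq.trans (congrArg (𝒜.bvl (α.φ.ε t) _) (funext fun s => ?_))
    (𝒜.bvl_bvr (α.φ.ε t) (S.snd t).el (fun s j =>
      𝒜.bvr ((Bq.fibre α.φ.f t).leaf s) ((α.Φ (inc α.φ t s) t (cardMap_inc _ _ _)).ε j)
        (fun k => a (Wreath.fibreFun α ⟨t, j⟩ ⟨s, k⟩))))
  exact 𝒜.bvr_hom _ (α.Φ (inc α.φ t s) t (cardMap_inc _ _ _)) _

end Action

end

end Operad

namespace Operad

section

variable {C D : Type u} {X : Operad.{u, 0, u} (Bq C)} {Y : Operad.{u, 0, u} (Bq D)}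

/-! ## From the reflection to the tensor product -/

/-- The inclusion of a summand of an ordinal sum. -/
noncomputable def summandEmb {k : ℕ} (n : Fin k → ℕ) (i : Fin k) : Fin (n i) ↪o Fin (∑ i, n i) :=
  OrderEmbedding.ofStrictMono (fun j => sumMk ⟨i, j⟩) fun _ _ h => sumMk_lt.2 (Or.inr ⟨rfl, h⟩)

theorem mem_range_summandEmb {k : ℕ} (n : Fin k → ℕ) (i : Fin k) (x : Fin (∑ i, n i)) :
    x ∈ Set.range (summandEmb n i) ↔ (sumOut x).1 = i := by
  constructor
  · rintro ⟨j, rfl⟩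
    exact congrArg Sigma.fst (sumOut_sumMk (n := n) ⟨i, j⟩)
  · rintro rfl
    exact ⟨(sumOut x).2, sumMk_sumOut x⟩

/-- The projection of the inputs of `(x; y_1, …, y_n)` to the inputs of `x`. -/
noncomputable def wreathProj (T : Wreath (Groth X) (Groth Y)) :
    Bq.map (wreathColour X Y) (arity T) ⟶
      Bq.map (fun c => (c, compColour T.comp)) T.fst.base :=
  Bq.Hom.mk (b := Bq.map (wreathColour X Y) (arity T))
    (b' := Bq.map (fun c => (c, compColour T.comp)) T.fst.base) (fun k => (sumOut k).1) rfl

/-- The inputs over `i` form the `i`-th summand of the ordinal sum. The output colours agree because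
all `y_i` lie in the component recorded in `T`. -/
theorem wreathProj_fib (T : Wreath (Groth X) (Groth Y)) (i : Fin T.fst.base.n) :
    Bq.map (fun d => (T.fst.base.leaf i, d)) (T.snd i).base = fib (wreathProj T) i := by
  refine Bq.eq_fibre (wreathProj T) i _ (summandEmb (fun i => card (T.snd i)) i)
    (fun k => mem_range_summandEmb _ i k) (fun j => ?_)
    (Prod.ext rfl (congrArg compColour (T.π₀_snd i)))
  exact (congrArg (fun p : Σ i, Fin (card (T.snd i)) =>
    (T.fst.base.leaf p.1, (T.snd p.1).base.leaf p.2)) (sumOut_sumMk ⟨i, j⟩)).symm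

/-- The element of the tensor product given by `(x; y_1, …, y_n)`. -/
noncomputable def bvOfWreath (T : Wreath (Groth X) (Groth Y)) :
    (bvTensor X Y).obj (Bq.map (wreathColour X Y) (arity T)) :=
  (bvTensor X Y).μ (wreathProj T) _ (wreathProj_fib T)
    (fun i => bvRight X (T.fst.base.leaf i) (T.snd i).el)
    (bvLeft Y T.fst.el (compColour T.comp))

theorem Action.act_bvOfWreath (𝒜 : Action (bvTensor X Y)) (T : Wreath (Groth X) (Groth Y))
    (a : Fin (card T) → 𝒜.carrier) : 𝒜.act (bvOfWreath T) a = 𝒜.bvw T (fun p => a (sumMk p)) :=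
  𝒜.act_μ (wreathProj T) _ (wreathProj_fib T) (fun i => summandEmb (fun i => card (T.snd i)) i)
    (fun i k => mem_range_summandEmb _ i k) _ _ a

/-- For the chosen object `(u_c; v_d)` the composite consists of the two units `u_c ⊗ d` and `c ⊗
v_d`, and each acts as the identity. -/
theorem bvOfWreath_one {T : Wreath (Groth X) (Groth Y)} (h : IsTrivial T) : bvOfWreath T =
    (bvTensor X Y).one (Bq.map (wreathColour X Y) (arity T))
      ((Bq.mapFunctor (wreathColour X Y)).isTrivial_obj ((arityFunctor _).isTrivial_obj h)) := by
  refine ext_of_action (Q := bvTensor X Y) (T := Bq.map (wreathColour X Y) (arity T))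
    fun 𝒜 a ha => ?_
  -- The fibres of the identity of a chosen object are the object itself, so the input colour is the
  -- output colour.
  have hT : ∀ k, 𝒜.HasColour (a k) (T.fst.base.root, compColour T.comp) := fun k =>
    (congrArg (fun S => 𝒜.HasColour (a k) (wreathColour X Y (π₀ S))) (h.fib_eq (𝟙 T) k)).mp (ha k)
  obtain ⟨c, d, rfl⟩ : ∃ c d, T = Wreath.triv c d := ⟨_, _, h⟩
  -- With representatives of the components, the chosen objects reduce to the units of the colours
  -- `t.base.root` and `s.base.root`.
  obtain ⟨t, rfl⟩ := Quotient.exists_rep c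
  obtain ⟨s, rfl⟩ := Quotient.exists_rep d
  let k : Fin (card (Wreath.triv (π₀ t) (π₀ s) : Wreath (Groth X) (Groth Y))) := 
    sumMk ⟨(0 : Fin 1), (0 : Fin 1)⟩
  refine (𝒜.act_bvOfWreath _ a).trans (Eq.trans ?_ (𝒜.act_one _ _ a k (ha k)).symm)
  -- The inner unit is removed first: an `Action` assigns no colours to values of operations, and
  -- the outer unit law needs the colour of its argument.
  have hr : 𝒜.bvr t.base.root (Y.one _ (Bq.isTrivial_triv s.base.root))
      (fun j : Fin 1 => a (sumMk ⟨(0 : Fin 1), j⟩)) = a k :=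
    𝒜.bvr_one t.base.root (Bq.isTrivial_triv s.base.root) _ (0 : Fin 1) (hT k)
  exact (𝒜.bvl_one s.base.root (Bq.isTrivial_triv t.base.root)
    (fun i : Fin 1 => 𝒜.bvr t.base.root (Y.one _ (Bq.isTrivial_triv s.base.root))
      (fun j : Fin 1 => a (sumMk ⟨i, j⟩))) (0 : Fin 1) (by rw [hr]; exact hT k)).trans hr

/-- This is `bvw_hom` read through `ext_of_action`. Together with `bvOfWreath_one` it says that `T ↦
bvOfWreath T` is a morphism from the terminal operad to a restriction of the tensor product. -/
theorem bvOfWreath_μ {T S : Wreath (Groth X) (Groth Y)} (f : T ⟶ S) : bvOfWreath T =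
    (bvTensor X Y).μ ((Bq.mapFunctor (wreathColour X Y)).functor.map (arityMap f))
      (fun i => Bq.map (wreathColour X Y) (arity (fib f i)))
      (fun i => congrArg (Bq.map (wreathColour X Y)) (arity_fib f i))
      (fun i => bvOfWreath (fib f i)) (bvOfWreath S) := by
  refine ext_of_action (Q := bvTensor X Y) (T := Bq.map (wreathColour X Y) (arity T))
    fun 𝒜 a _ => ?_
  have h := 𝒜.act_μ ((Bq.mapFunctor (wreathColour X Y)).functor.map (arityMap f))
      (fun i => Bq.map (wreathColour X Y) (arity (fib f i)))
      (fun i => congrArg (Bq.map (wreathColour X Y)) (arity_fib f i))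
      (fun i => inc f i) (fun i k => mem_range_inc f i k)
      (fun i => bvOfWreath (fib f i)) (bvOfWreath S) a
  refine (𝒜.act_bvOfWreath T a).trans (Eq.trans ?_ h.symm)
  refine (𝒜.bvw_hom f _).trans (Eq.trans ?_ (𝒜.act_bvOfWreath S _).symm)
  refine congrArg (𝒜.bvw S) (funext fun p => ?_)
  refine Eq.trans ?_ (𝒜.act_bvOfWreath (fib f (sumMk p)) _).symm
  -- The fibre over `sumMk p` is by definition the fibre over `sumOut (sumMk p)`. Generalising this
  -- pair to `p₀` lets the equality with `p` be substituted.
  have H : ∀ p₀, p₀ = p → 𝒜.bvw (Wreath.fibre f p) (fun q => a (sumMk (Wreath.fibreFun f p q))) =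
      𝒜.bvw (Wreath.fibre f p₀) (fun q => a (Wreath.fibreInc f p₀ (sumMk q))) := by
    rintro _ rfl
    exact congrArg (𝒜.bvw _) (funext fun q => congrArg a (Wreath.fibreInc_sumMk f _ q).symm)
  exact H _ (sumOut_sumMk p)

variable (X Y) in
theorem exists_reflectionToBv : ∃ ψ : reflection (Wreath (Groth X) (Groth Y)) ⟶
    (Bq.mapFunctor (wreathColour X Y)).restrict (bvTensor X Y),
    ∀ T, ψ.app (arity T) (reflectionClass T) = bvOfWreath T := by
  obtain ⟨ψ, hψ, -⟩ := lan_universal (arityFunctor (Wreath (Groth X) (Groth Y)))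
    (terminal.{u, u, u} _) ((Bq.mapFunctor (wreathColour X Y)).restrict (bvTensor X Y))
    ⟨fun T _ => bvOfWreath T, fun T h => bvOfWreath_one h, fun {T S} f F hF a s => by
      obtain rfl : F = fib f := funext hF
      exact bvOfWreath_μ f⟩
  exact ⟨ψ, fun T => hψ T PUnit.unit⟩

/-! ## The isomorphism -/

/-- The round trips lie over maps of colours that are the identity only propositionally. Once `g` is
replaced by `id`, `θ` becomes an endomorphism fixing the generators, and uniqueness in the universal
property applies. -/
theorem heq_of_hom_presented {E : Type u} {G : Bq E → Type u}
    {r : ∀ T, Term G T → Term G T → Prop} {g : E → E} (hg : g = id)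
    (θ : Hom (presented G r) ((Bq.mapFunctor g).restrict (presented G r)))
    (hθ : ∀ T (x : G T), HEq (θ.app T (presentedGen r x)) (presentedGen r x)) (T : Bq E)
    (q : (presented G r).obj T) : HEq (θ.app T q) q := by
  subst hg
  let θ' : presented G r ⟶ presented G r :=
    Hom.mk θ.app θ.app_one (fun f F hF a s => θ.app_μ f F hF a s)
  have key : ∀ {T : Bq E} (x : Term G T),
      x.eval (presented G r) (fun _ x => presentedGen r x) = Term.cls r x := by
    intro T x
    induction x with
    | gen x => rfl
    | one T h => rfl
    | μ f F hF a s ih ih' =>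
      refine Eq.trans ?_ (presented_μ_cls r f F hF a s)
      exact (presented G r).μ_congr rfl _ _ (fun i => heq_of_eq (ih i)) ih'
  have h : θ' = 𝟙 (presented G r) := (presented_universal (r := r) (presented G r)
    (fun _ x => presentedGen r x) (fun T x y h =>
      (key x).trans (Eq.trans (Quotient.sound (Term.Rel.of h)) (key y).symm))).unique
    (fun T x => eq_of_heq (hθ T x)) (fun _ _ => rfl)
  exact heq_of_eq (congrArg (fun θ : presented G r ⟶ presented G r => θ.app T q) h)

theorem exists_iso_of_bijective {O : Type u} [Category.{v} O] [OperadicCategory O]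
    {P Q : Operad.{u, v, w} O} (θ : P ⟶ Q) (h : ∀ T, Function.Bijective (θ.app T)) :
    ∃ i : P ≅ Q, i.hom = θ := by
  let inv : ∀ T, Q.obj T → P.obj T := fun T => (Equiv.ofBijective _ (h T)).symm
  have hinv : ∀ T q, θ.app T (inv T q) = q := fun T q =>
    (Equiv.ofBijective _ (h T)).apply_symm_apply q
  let ι : Q ⟶ P := Hom.mk inv
    (fun T hT => (h T).1 (by rw [hinv, θ.app_one]))
    (fun f F hF a s => (h _).1 (by
      rw [hinv, θ.app_μ, hinv]
      exact Q.μ_congr rfl _ _ (fun i => heq_of_eq (hinv _ _).symm) rfl))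
  refine ⟨⟨θ, ι, ?_, ?_⟩, rfl⟩
  · apply Hom.ext
    funext T p
    exact (h T).1 (hinv T _)
  · apply Hom.ext
    funext T q
    exact hinv T q

/-- The elements `c_i ⊗ v_d` substituted in `x ⊗ d` are units, and they are applied to arguments of
the right colours. -/
theorem bvOfWreath_wreathLeft {b : Bq C} (x : X.obj b) (d : D) :
    HEq (bvOfWreath (wreathLeft Y x d)) (bvLeft Y x d) := by
  refine heq_of_action (congrArg (Bq.map (wreathColour X Y)) (arity_wreathLeft x d))
    fun 𝒜 a a' ha hc => ?_
  refine (𝒜.act_bvOfWreath _ a).trans (congrArg (𝒜.bvl x d) (funext fun i => ?_))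
  have h : a (sumMk ⟨i, (0 : Fin 1)⟩) = a' i := ha _ i 
    ((sumOut_fst_val (k := b.n) (n := fun _ => 1) (fun _ => rfl) _).symm.trans
      (congrArg (fun p : Σ _ : Fin b.n, Fin 1 => p.1.val) (sumOut_sumMk _)))
  refine (𝒜.bvr_one (b.leaf i) (Bq.isTrivial_triv d) (fun j : Fin 1 => a (sumMk ⟨i, j⟩))
    (0 : Fin 1) ?_).trans h
  refine (congrArg (𝒜.HasColour _) ?_).mp (hc (sumMk ⟨i, (0 : Fin 1)⟩))
  exact congrArg (fun p : Σ _ : Fin b.n, Fin 1 => (b.leaf p.1, d)) (sumOut_sumMk _)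

/-- The outer factor is the unit `u_c ⊗ d`, but its argument is a value, whose colour is unknown.
Interchange moves `u_c` to the inputs of `y`, where the colours are given. -/
theorem bvOfWreath_wreathRight (c : C) {b : Bq D} (y : Y.obj b) :
    HEq (bvOfWreath (wreathRight X c y)) (bvRight X c y) := by
  refine heq_of_action (congrArg (Bq.map (wreathColour X Y)) (arity_wreathRight c y))
    fun 𝒜 a a' ha hc => ?_
  refine (𝒜.act_bvOfWreath _ a).trans ?_
  refine (𝒜.bvl_bvr (X.one _ (Bq.isTrivial_triv c)) y
    (fun (i : Fin 1) j => a (sumMk ⟨i, j⟩))).trans ?_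
  refine congrArg (𝒜.bvr c y) (funext fun j => ?_)
  have h : a (sumMk ⟨(0 : Fin 1), j⟩) = a' j := ha _ j 
    ((sumOut_snd_val (k := 1) (n := fun _ => b.n) rfl _).symm.trans
      (congrArg (fun p : Σ _ : Fin 1, Fin b.n => p.2.val) (sumOut_sumMk _)))
  refine (𝒜.bvl_one (b.leaf j) (Bq.isTrivial_triv c) (fun i : Fin 1 => a (sumMk ⟨i, j⟩))
    (0 : Fin 1) ?_).trans h
  refine (congrArg (𝒜.HasColour _) ?_).mp (hc (sumMk ⟨(0 : Fin 1), j⟩))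
  exact congrArg (fun p : Σ _ : Fin 1, Fin b.n => (c, b.leaf p.2)) (sumOut_sumMk _)

theorem app_heq {O : Type u} [Category.{v} O] [OperadicCategory O] {P : Operad.{u, v, w} O}
    {Q : Operad.{u, v, w'} O} (θ : Hom P Q) {T T' : O} (h : T = T') {p : P.obj T} {p' : P.obj T'}
    (hp : HEq p p') : HEq (θ.app T p) (θ.app T' p') := by
  subst h
  cases hp
  rfl

/-- Applied to the composite of `x ⊗ d` with the `c_i ⊗ y_i`, the morphism `α` gives the composite
of the corresponding classes, which is `[T]` by `wval_eq`. -/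
theorem app_bvOfWreath (α : bvTensor X Y ⟶ (Bq.mapFunctor (colourEquiv X Y)).restrict
    (reflection (Wreath (Groth X) (Groth Y))))
    (hα : ∀ (b : Bq (C × D)) (x : BVGen X Y b), α.app b (presentedGen (BVRel X Y) x) =
      bvToReflectionGen b x) (T : Wreath (Groth X) (Groth Y)) :
    HEq (α.app _ (bvOfWreath T)) (reflectionClass T) := by
  have hT : Bq.map (colourEquiv X Y) (Bq.map (wreathColour X Y) (arity T)) = arity T :=
    Bq.ext' rfl (fun k k' hk => by
      obtain rfl : k = k' := Fin.ext hk
      exact (colourEquiv X Y).apply_symm_apply _) ((colourEquiv X Y).apply_symm_apply _)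
  refine heq_of_action (Q := reflection (Wreath (Groth X) (Groth Y))) hT fun 𝒜 a a' ha _ => ?_
  have h := α.app_μ (wreathProj T) _ (wreathProj_fib T)
    (fun i => bvRight X (T.fst.base.leaf i) (T.snd i).el)
    (bvLeft Y T.fst.el (compColour T.comp))
  refine (congrArg (fun q => 𝒜.act (b := Bq.map (colourEquiv X Y)
    (Bq.map (wreathColour X Y) (arity T))) q a) h).trans ?_
  refine (𝒜.act_μ ((Bq.mapFunctor (colourEquiv X Y)).functor.map (wreathProj T))
    (fun i => Bq.map (colourEquiv X Y)
      (Bq.map (fun d => (T.fst.base.leaf i, d)) (T.snd i).base))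
    (fun i => congrArg (Bq.map (colourEquiv X Y)) (wreathProj_fib T i))
    (fun i => summandEmb (fun i => card (T.snd i)) i)
    (fun i k => mem_range_summandEmb _ i k) _ _ a).trans ?_
  refine (congrArg (fun q => 𝒜.act (b := Bq.map (colourEquiv X Y) (Bq.map _ T.fst.base)) q _)
    (hα _ (BVGen.left T.fst.el (compColour T.comp)))).trans ?_
  refine (𝒜.act_bvToReflectionGen_left T.fst.el (compColour T.comp) _).trans ?_
  have h' : ∀ i, 𝒜.act (b := Bq.map (colourEquiv X Y)
      (Bq.map (fun d => (T.fst.base.leaf i, d)) (T.snd i).base))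
      (α.app _ (bvRight X (T.fst.base.leaf i) (T.snd i).el)) (fun j => a (sumMk ⟨i, j⟩)) =
      𝒜.wright (T.fst.base.leaf i) (T.snd i).el (fun j => a (sumMk ⟨i, j⟩)) := fun i =>
    (congrArg (fun q => 𝒜.act (b := Bq.map (colourEquiv X Y)
      (Bq.map (fun d => (T.fst.base.leaf i, d)) (T.snd i).base)) q (fun j => a (sumMk ⟨i, j⟩)))
      (hα _ (BVGen.right (T.fst.base.leaf i) (T.snd i).el))).trans
    (𝒜.act_bvToReflectionGen_right (T.fst.base.leaf i) (T.snd i).el _)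
  refine (congrArg (𝒜.wleft T.fst.el (compColour T.comp)) (funext h')).trans ?_
  refine (𝒜.wval_eq T (fun p => a (sumMk p))).symm.trans ?_
  exact congrArg (𝒜.val T) (funext fun k => ha _ _ (congrArg Fin.val (sumMk_sumOut k)))

end

end Operad

/-- The formulas on generators are equalities of pairs, bouquet and element, because the bouquets
agree only by `arity_wreathLeft` and `arity_wreathRight`. -/
theorem mainTheorem1 {C D : Type u} (X : Operad.{u, 0, u} (Bq C)) (Y : Operad.{u, 0, u} (Bq D)) :
    ∃ (e : C × D ≃ Pi0 (Wreath (Groth X) (Groth Y)))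
      (α : Operad.bvTensor X Y ≅
        (Bq.mapFunctor e).restrict (Operad.reflection (Wreath (Groth X) (Groth Y)))),
      (∀ (c : C) (d : D), e (c, d) = π₀ (Operad.wreathLeft Y (Operad.unitObj X c).el d)) ∧
      (∀ (b : Bq C) (x : X.obj b) (d : D),
        (⟨_, α.hom.app _ (Operad.bvLeft Y x d)⟩ :
          Σ t, (Operad.reflection (Wreath (Groth X) (Groth Y))).obj t) =
        ⟨_, Operad.reflectionClass (Operad.wreathLeft Y x d)⟩) ∧
      (∀ (c : C) (b : Bq D) (y : Y.obj b),
        (⟨_, α.hom.app _ (Operad.bvRight X c y)⟩ :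
          Σ t, (Operad.reflection (Wreath (Groth X) (Groth Y))).obj t) =
        ⟨_, Operad.reflectionClass (Operad.wreathRight X c y)⟩) := by
  obtain ⟨α, hα⟩ := Operad.exists_bvToReflection X Y
  obtain ⟨ψ, hψ⟩ := Operad.exists_reflectionToBv X Y
  let e := Operad.colourEquiv X Y
  -- `ψ ∘ α` lies over the map of colours `e⁻¹ ∘ e` and fixes the generators `x ⊗ d` and `c ⊗ y`.
  have h₁ : ∀ b q, HEq (ψ.app (Bq.map e b) (α.app b q)) q := by
    let θ : Operad.Hom (Operad.bvTensor X Y)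
        ((Bq.mapFunctor (Operad.wreathColour X Y ∘ e)).restrict (Operad.bvTensor X Y)) :=
      ⟨fun b q => ψ.app (Bq.map e b) (α.app b q),
        fun b h => (congrArg (ψ.app (Bq.map e b)) (α.app_one b h)).trans (ψ.app_one _ _),
        fun {b b'} f F hF a s => (congrArg (ψ.app (Bq.map e b)) (α.app_μ f F hF a s)).trans
          (ψ.app_μ ((Bq.mapFunctor e).functor.map f) _ _ _ _)⟩
    refine Operad.heq_of_hom_presented (funext fun p => e.symm_apply_apply p) θ fun b x => ?_
    refine (heq_of_eq (congrArg (ψ.app (Bq.map e b)) (hα b x))).trans ?_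
    cases x with
    | left x d =>
      refine (Operad.app_heq ψ (Operad.arity_wreathLeft x d).symm (cast_heq _ _)).trans ?_
      exact (heq_of_eq (hψ _)).trans (Operad.bvOfWreath_wreathLeft x d)
    | right c y =>
      refine (Operad.app_heq ψ (Operad.arity_wreathRight c y).symm (cast_heq _ _)).trans ?_
      exact (heq_of_eq (hψ _)).trans (Operad.bvOfWreath_wreathRight c y)
  -- `α ∘ ψ` lies over `e ∘ e⁻¹` and fixes the classes `[T]`, which generate the reflection.
  have h₂ : ∀ t q, HEq (α.app (Bq.map (Operad.wreathColour X Y) t) (ψ.app t q)) q := by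
    let θ : Operad.Hom (Operad.reflection (Wreath (Groth X) (Groth Y)))
        ((Bq.mapFunctor (e ∘ Operad.wreathColour X Y)).restrict
          (Operad.reflection (Wreath (Groth X) (Groth Y)))) :=
      ⟨fun t q => α.app (Bq.map (Operad.wreathColour X Y) t) (ψ.app t q),
        fun t h => (congrArg (α.app (Bq.map _ t)) (ψ.app_one t h)).trans (α.app_one _ _),
        fun {t t'} f F hF a s => (congrArg (α.app (Bq.map _ t)) (ψ.app_μ f F hF a s)).trans
          (α.app_μ ((Bq.mapFunctor (Operad.wreathColour X Y)).functor.map f) _ _ _ _)⟩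
    refine Operad.heq_of_hom_presented (funext fun p => e.apply_symm_apply p) θ fun t x => ?_
    cases x with
    | @mk T p =>
      refine (heq_of_eq (congrArg (α.app (Bq.map (Operad.wreathColour X Y) (arity T)))
        (hψ T))).trans ?_
      exact Operad.app_bvOfWreath α hα T
  obtain ⟨i, rfl⟩ := Operad.exists_iso_of_bijective α fun b => by
    refine ⟨fun q q' h => ?_, fun q => ?_⟩
    · exact eq_of_heq ((h₁ b q).symm.trans
        ((heq_of_eq (congrArg (ψ.app (Bq.map e b)) h)).trans (h₁ b q')))
    -- Since `e⁻¹ (e p)` reduces to `p`, recolouring `b` by `e` and back gives `b` definitionally,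
    -- so `h₂` yields a preimage in the right degree.
    · exact ⟨ψ.app (Bq.map e b) q, eq_of_heq (h₂ (Bq.map e b) q)⟩
  refine ⟨e, i, fun _ _ => rfl, fun b x d => ?_, fun c b y => ?_⟩
  · refine Sigma.ext (Operad.arity_wreathLeft x d).symm ?_
    exact (heq_of_eq (hα _ (Operad.BVGen.left x d))).trans (cast_heq _ _)
  · refine Sigma.ext (Operad.arity_wreathRight c y).symm ?_
    exact (heq_of_eq (hα _ (Operad.BVGen.right c y))).trans (cast_heq _ _)
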